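/- Let $\mathcal C$ be an autonomous (rigid) monoidal category, with chosen left duals $({}^\vee X,\mathrm{ev}_X,\mathrm{coev}_X)$ and right duals, and let $T$ be a Hopf monad on $\mathcal C$: a monad $(T,\mu,\eta)$ with a comonoidal structure $T_2(X,Y)\colon T(X\otimes Y)\to T(X)\otimes T(Y)$, $T_0\colon T(\mathbb 1)\to\mathbb 1$ for which $\mu,\eta$ are comonoidal, having a left antipode $s^l_X\colon T({}^\vee T(X))\to{}^\vee X$ and a right antipode. (Associativity and unit constraints are omitted below.) Assume that $T$ is centralizable, and let $(Z,\partial)$ be a centralizer of $T$: an endofunctor $Z$ and a natural transformation $\partial_{X,Y}\colon X\otimes Y\to T(Y)\otimes Z(X)$ such that for all $X,W$ every natural transformation $\xi_Y\colon X\otimes Y\to T(Y)\otimes W$ is $\xi_Y=(\mathrm{id}_{T(Y)}\otimes r)\,\partial_{X,Y}$ for a unique $r\colon Z(X)\to W$. Then: 1. There are unique $m\colon Z^2\to Z$, $u\colon 1_{\mathcal C}\to Z$, $Z_2$, $Z_0$ such that $(\mathrm{id}\otimes m_X)(\mathrm{id}_{T(Y_1)}\otimes\partial_{Z(X),Y_2})(\partial_{X,Y_1}\otimes\mathrm{id}_{Y_2})=(T_2(Y_1,Y_2)\otimes\mathrm{id})\,\partial_{X,Y_1\otimes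 Y_2}$, $\;u_X=(T_0\otimes\mathrm{id})\,\partial_{X,\mathbb 1}$, $(\mathrm{id}\otimes Z_2(X_1,X_2))\,\partial_{X_1\otimes X_2,Y}=(\mu_Y\otimes\mathrm{id})(\partial_{X_1,T(Y)}\otimes\mathrm{id})(\mathrm{id}_{X_1}\otimes\partial_{X_2,Y})$, $\;(\mathrm{id}\otimes Z_0)\,\partial_{\mathbb 1,Y}=\eta_Y$, and they make $Z$ a bimonad $Z_T$ on $\mathcal C$. 2. Put $i_{X,Y}=(\mathrm{ev}_{T(Y)}\otimes\mathrm{id}_{Z(X)})(\mathrm{id}_{{}^\vee T(Y)}\otimes\partial_{X,Y})\colon{}^\vee T(Y)\otimes X\otimes Y\to Z(X)$ and $T_3(A,X,Y)=(\mathrm{id}\otimes T_2(X,Y))T_2(A,X\otimes Y)$. There is a unique natural transformation $\Omega\colon TZ\to ZT$ such that for all $X,Y$ $$\Omega_X\,T(i_{X,Y})=i_{T(X),T(Y)}\bigl({}^\vee\mu_Y\,s^l_{T(Y)}\,T({}^\vee\mu_Y)\otimes\mathrm{id}_{T(X)\otimes T(Y)}\bigr)T_3({}^\vee T(Y),X,Y),$$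 and $\Omega$ is a comonoidal distributive law of $T$ over $Z_T$. Hence the double $D_T=Z_T\circ_\Omega T$, that is, the functor $ZT$ with product $m_{T(X)}Z^2(\mu_X)Z(\Omega_{T(X)})$, unit $u_{T(X)}\eta_X$ and the composite comonoidal structure, is a bimonad on $\mathcal C$. 3. Put $R_{X,Y}=(u_{T(Y)}\otimes Z(\eta_X))\,\partial_{X,Y}\colon X\otimes Y\to D_T(Y)\otimes D_T(X)$. The monoidal category $D_T\text{-}\mathcal C$ of $D_T$-modules is braided, with braiding $\tau_{(M,r),(N,s)}=(s\otimes r)R_{M,N}$. 4. Let $\mathcal Z(T\text{-}\mathcal C)$ be the center (left half braidings $\sigma_N\colon M\otimes N\to N\otimes M$) of the monoidal category $T\text{-}\mathcal C$ of $T$-modules, with braiding $\tau_{(M,\sigma),(N,\gamma)}=\sigma_N$. The assignment $$I(M,r)=\bigl((M,r\,u_{T(M)}),\sigma\bigr),\qquad \sigma_{(N,s)}=(s\otimes r\,Z(\eta_M))\,\partial_{M,N},\qquad I(f)=f,$$ is a well-defined functor $I\colon D_T\text{-}\mathcal C\to\mathcal Z(T\text{-}\mathcal C)$. It is a strict monoidal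 braided functor and an isomorphism of categories, and $\mathcal U I=U_{D_T}$ as monoidal functors, where $U_{D_T}\colon D_T\text{-}\mathcal C\to\mathcal C$ and $\mathcal U\colon\mathcal Z(T\text{-}\mathcal C)\to\mathcal C$, $((M,r),\sigma)\mapsto M$, are the strict monoidal forgetful functors. -/

import Mathlib

open CategoryTheory MonoidalCategory Functor.LaxMonoidal Functor.OplaxMonoidal

universe v u

/-! Composition is written diagrammatically (`f ≫ g` is "first `f`, then `g`"), and monoidal
categories are not assumed to be strict: `α_`, `λ_`, `ρ_` are the associator and the unitors.
A comonoidal functor is an oplax monoidal functor `F`, with `δ F X Y : F (X ⊗ Y) ⟶ F X ⊗ F Y`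
(also written `F₂`) and `η F : F 𝟙 ⟶ 𝟙` (also written `F₀`).  For a monad `T`, the product is
`T.μ` and the unit is `T.η`; `T`-modules are the objects of `T.Algebra`. -/

/-- A bimonad: a monad whose underlying functor is comonoidal, and whose product and unit are
comonoidal natural transformations. -/
structure Bimonad (C : Type u) [Category.{v} C] [MonoidalCategory C] extends Monad C where
  comonoidal : toFunctor.OplaxMonoidal
  mul_comul : ∀ X Y : C, μ.app (X ⊗ Y) ≫ comonoidal.δ X Y =
    toFunctor.map (comonoidal.δ X Y) ≫ comonoidal.δ (toFunctor.obj X) (toFunctor.obj Y) ≫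
      (μ.app X ⊗ₘ μ.app Y)
  mul_counit : μ.app (𝟙_ C) ≫ comonoidal.η = toFunctor.map comonoidal.η ≫ comonoidal.η
  unit_comul : ∀ X Y : C, η.app (X ⊗ Y) ≫ comonoidal.δ X Y = (η.app X ⊗ₘ η.app Y)
  unit_counit : η.app (𝟙_ C) ≫ comonoidal.η = 𝟙 (𝟙_ C)

attribute [instance] Bimonad.comonoidal

namespace Bimonad

variable {C : Type u} [Category.{v} C] [MonoidalCategory C] (T : Bimonad C)

/-- The category `T-C` of `T`-modules. -/
abbrev Mod : Type (max u v) := T.toMonad.Algebra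

/-- The monoidal product `(M, r) ⊗ (N, s) = (M ⊗ N, (r ⊗ s) T₂(M, N))` of `T`-modules. -/
@[simps]
def tensorMod (M N : T.Mod) : T.Mod where
  A := M.A ⊗ N.A
  a := δ T.toFunctor M.A N.A ≫ (M.a ⊗ₘ N.a)
  unit := by
    have h := T.unit_comul M.A N.A
    rw [reassoc_of% h, tensorHom_comp_tensorHom, M.unit, N.unit, id_tensorHom_id]
  assoc := by
    have h := T.mul_comul M.A N.A
    rw [reassoc_of% h, tensorHom_comp_tensorHom, M.assoc, N.assoc, Functor.map_comp,
      Category.assoc, ← tensorHom_comp_tensorHom, δ_natural_assoc]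

/-- The unit `T`-module `(𝟙, T₀)`. -/
@[simps]
def unitMod : T.Mod where
  A := 𝟙_ C
  a := η T.toFunctor
  unit := T.unit_counit
  assoc := T.mul_counit

/-- The category of modules over a bimonad is monoidal; the morphisms of modules are tensored, and
the associativity and unit constraints are given, as in `C`. -/
instance monoidalMod : MonoidalCategory T.toMonad.Algebra where
  tensorObj M N := T.tensorMod M N
  whiskerLeft M N N' f :=
    { f := M.A ◁ f.f
      h := by
        have h := δ_natural_right T.toFunctor M.A f.f
        dsimp [tensorMod]
        rw [← reassoc_of% h, whiskerLeft_comp_tensorHom, Category.assoc, f.h, tensorHom_comp_whiskerLeft] }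
  whiskerRight {M M'} f N :=
    { f := f.f ▷ N.A
      h := by
        have h := δ_natural_left T.toFunctor f.f N.A
        dsimp [tensorMod]
        rw [← reassoc_of% h, whiskerRight_comp_tensorHom, Category.assoc, f.h, tensorHom_comp_whiskerRight] }
  tensorHom {M M' N N'} f g :=
    { f := f.f ⊗ₘ g.f
      h := by
        have h := δ_natural T.toFunctor f.f g.f
        dsimp [tensorMod]
        rw [← reassoc_of% h, tensorHom_comp_tensorHom, Category.assoc, f.h, g.h, tensorHom_comp_tensorHom] }
  tensorUnit := T.unitMod
  associator M N P := Monad.Algebra.isoMk (α_ M.A N.A P.A) (by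
    have h := oplax_associativity T.toFunctor M.A N.A P.A
    have h' := reassoc_of% h
    dsimp [tensorMod]
    calc T.map (α_ M.A N.A P.A).hom ≫ δ T.toFunctor M.A (N.A ⊗ P.A) ≫
          (M.a ⊗ₘ δ T.toFunctor N.A P.A ≫ (N.a ⊗ₘ P.a))
        = T.map (α_ M.A N.A P.A).hom ≫ δ T.toFunctor M.A (N.A ⊗ P.A) ≫
          T.obj M.A ◁ δ T.toFunctor N.A P.A ≫ (M.a ⊗ₘ (N.a ⊗ₘ P.a)) := by
            rw [whiskerLeft_comp_tensorHom]
      _ = δ T.toFunctor (M.A ⊗ N.A) P.A ≫ δ T.toFunctor M.A N.A ▷ T.obj P.A ≫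
          (α_ (T.obj M.A) (T.obj N.A) (T.obj P.A)).hom ≫ (M.a ⊗ₘ (N.a ⊗ₘ P.a)) := by rw [← h']
      _ = (δ T.toFunctor (M.A ⊗ N.A) P.A ≫
          (δ T.toFunctor M.A N.A ≫ (M.a ⊗ₘ N.a) ⊗ₘ P.a)) ≫ (α_ M.A N.A P.A).hom := by
            rw [← associator_naturality, whiskerRight_comp_tensorHom_assoc, Category.assoc])
  leftUnitor M := Monad.Algebra.isoMk (λ_ M.A) (by
    have h := left_unitality_hom T.toFunctor M.A
    dsimp [tensorMod, unitMod]
    rw [← h, MonoidalCategory.tensorHom_def]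
    simp)
  rightUnitor M := Monad.Algebra.isoMk (ρ_ M.A) (by
    have h := right_unitality_hom T.toFunctor M.A
    dsimp [tensorMod, unitMod]
    rw [← h, MonoidalCategory.tensorHom_def']
    simp)
  tensorHom_def f g :=
    Monad.Algebra.Hom.ext' _ _ _ _ (MonoidalCategory.tensorHom_def f.f g.f)
  id_tensorHom_id M N :=
    Monad.Algebra.Hom.ext' _ _ _ _ (MonoidalCategory.id_tensorHom_id M.A N.A)
  tensorHom_comp_tensorHom f₁ f₂ g₁ g₂ :=
    Monad.Algebra.Hom.ext' _ _ _ _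
      (MonoidalCategory.tensorHom_comp_tensorHom f₁.f f₂.f g₁.f g₂.f)
  whiskerLeft_id M N :=
    Monad.Algebra.Hom.ext' _ _ _ _ (MonoidalCategory.whiskerLeft_id M.A N.A)
  id_whiskerRight M N :=
    Monad.Algebra.Hom.ext' _ _ _ _ (MonoidalCategory.id_whiskerRight M.A N.A)
  associator_naturality f₁ f₂ f₃ :=
    Monad.Algebra.Hom.ext' _ _ _ _ (MonoidalCategory.associator_naturality f₁.f f₂.f f₃.f)
  leftUnitor_naturality f :=
    Monad.Algebra.Hom.ext' _ _ _ _ (MonoidalCategory.leftUnitor_naturality f.f)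
  rightUnitor_naturality f :=
    Monad.Algebra.Hom.ext' _ _ _ _ (MonoidalCategory.rightUnitor_naturality f.f)
  pentagon M N P Q :=
    Monad.Algebra.Hom.ext' _ _ _ _ (MonoidalCategory.pentagon M.A N.A P.A Q.A)
  triangle M N :=
    Monad.Algebra.Hom.ext' _ _ _ _ (MonoidalCategory.triangle M.A N.A)

/-- The forgetful functor `U_T : T-C ⥤ C` is strict monoidal. -/
instance monoidalForget : T.toMonad.forget.Monoidal :=
  Functor.CoreMonoidal.toMonoidal
    { εIso := Iso.refl (𝟙_ C)
      μIso := fun M N => Iso.refl (M.A ⊗ N.A)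
      μIso_hom_natural_left := fun f N => by
        change f.f ▷ N.A ≫ 𝟙 _ = 𝟙 _ ≫ f.f ▷ N.A
        simp
      μIso_hom_natural_right := fun M f => by
        change M.A ◁ f.f ≫ 𝟙 _ = 𝟙 _ ≫ M.A ◁ f.f
        simp
      associativity := fun M N P => by
        change 𝟙 (M.A ⊗ N.A) ▷ P.A ≫ 𝟙 _ ≫ (α_ M.A N.A P.A).hom =
          (α_ M.A N.A P.A).hom ≫ M.A ◁ 𝟙 (N.A ⊗ P.A) ≫ 𝟙 _
        simp
      left_unitality := fun M => by
        change (λ_ M.A).hom = 𝟙 (𝟙_ C) ▷ M.A ≫ 𝟙 _ ≫ (λ_ M.A).hom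
        simp
      right_unitality := fun M => by
        change (ρ_ M.A).hom = M.A ◁ 𝟙 (𝟙_ C) ≫ 𝟙 _ ≫ (ρ_ M.A).hom
        simp }

end Bimonad

/-! ### Hopf monads

In an autonomous (rigid) category every object `X` has chosen left and right duals. In Mathlib's
notation `Xᘁ` is the dual with `ε_ X Xᘁ : Xᘁ ⊗ X ⟶ 𝟙` and `η_ X Xᘁ : 𝟙 ⟶ X ⊗ Xᘁ`; it is called the
*left* dual `∨X` below (and the right dual in Mathlib). Symmetrically `ᘁX`, with
`ε_ ᘁX X : X ⊗ ᘁX ⟶ 𝟙` and `η_ ᘁX X : 𝟙 ⟶ ᘁX ⊗ X`, is called the *right* dual `X∨` below. The dual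
morphisms are `fᘁ` and `ᘁf`. -/

/-- A left antipode `sˡ_X : T(∨T(X)) ⟶ ∨X` of a bimonad. -/
structure Bimonad.LeftAntipode {C : Type u} [Category.{v} C] [MonoidalCategory C]
    [RigidCategory C] (T : Bimonad C) where
  s : ∀ X : C, T.obj ((T.obj X)ᘁ : C) ⟶ (Xᘁ : C)
  naturality : ∀ {X Y : C} (f : X ⟶ Y), T.map ((T.map f)ᘁ) ≫ s X = s Y ≫ (fᘁ)
  ev_eq : ∀ X : C,
    T.map ((T.η.app X)ᘁ ▷ X) ≫ T.map (ε_ X (Xᘁ)) ≫ η T.toFunctor =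
      δ T.toFunctor ((T.obj X)ᘁ : C) X ≫
        (T.map ((T.μ.app X)ᘁ) ≫ s (T.obj X)) ▷ T.obj X ≫ ε_ (T.obj X) ((T.obj X)ᘁ)
  coev_eq : ∀ X : C,
    η T.toFunctor ≫ η_ X (Xᘁ) ≫ T.η.app X ▷ (Xᘁ : C) =
      T.map (η_ (T.obj X) ((T.obj X)ᘁ)) ≫ δ T.toFunctor (T.obj X) ((T.obj X)ᘁ : C) ≫
        (T.μ.app X ⊗ₘ s X)

/-- A right antipode `sʳ_X : T(T(X)∨) ⟶ X∨` of a bimonad. -/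
structure Bimonad.RightAntipode {C : Type u} [Category.{v} C] [MonoidalCategory C]
    [RigidCategory C] (T : Bimonad C) where
  s : ∀ X : C, T.obj (ᘁ(T.obj X) : C) ⟶ (ᘁX : C)
  naturality : ∀ {X Y : C} (f : X ⟶ Y), T.map (ᘁ(T.map f)) ≫ s X = s Y ≫ (ᘁf)
  ev_eq : ∀ X : C,
    T.map (X ◁ (ᘁ(T.η.app X))) ≫ T.map (ε_ (ᘁX) X) ≫ η T.toFunctor =
      δ T.toFunctor X (ᘁ(T.obj X) : C) ≫
        T.obj X ◁ (T.map (ᘁ(T.μ.app X)) ≫ s (T.obj X)) ≫ ε_ (ᘁ(T.obj X)) (T.obj X)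
  coev_eq : ∀ X : C,
    η T.toFunctor ≫ η_ (ᘁX) X ≫ (ᘁX : C) ◁ T.η.app X =
      T.map (η_ (ᘁ(T.obj X)) (T.obj X)) ≫ δ T.toFunctor (ᘁ(T.obj X) : C) (T.obj X) ≫
        (s X ⊗ₘ T.μ.app X)

/-- A Hopf monad on an autonomous category: a bimonad which has a left and a right antipode. -/
structure HopfMonad (C : Type u) [Category.{v} C] [MonoidalCategory C] [RigidCategory C]
    extends Bimonad C where
  leftAntipode : toBimonad.LeftAntipode
  rightAntipode : toBimonad.RightAntipode

/-! ### Comonoidal distributive laws -/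

section DistributiveLaw

variable {C : Type u} [Category.{v} C] [MonoidalCategory C]

/-- `Ω : TP ⟶ PT` is a comonoidal distributive law of the bimonad `T` over the bimonad `P`. -/
structure IsComonoidalDistributiveLaw (T P : Bimonad C)
    (Ω : P.toFunctor ⋙ T.toFunctor ⟶ T.toFunctor ⋙ P.toFunctor) : Prop where
  mul_right : ∀ X : C, T.map (P.μ.app X) ≫ Ω.app X =
    Ω.app (P.obj X) ≫ P.map (Ω.app X) ≫ P.μ.app (T.obj X)
  unit_right : ∀ X : C, T.map (P.η.app X) ≫ Ω.app X = P.η.app (T.obj X)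
  mul_left : ∀ X : C, T.μ.app (P.obj X) ≫ Ω.app X =
    T.map (Ω.app X) ≫ Ω.app (T.obj X) ≫ P.map (T.μ.app X)
  unit_left : ∀ X : C, T.η.app (P.obj X) ≫ Ω.app X = P.map (T.η.app X)
  comul : ∀ X Y : C, Ω.app (X ⊗ Y) ≫ δ (T.toFunctor ⋙ P.toFunctor) X Y =
    δ (P.toFunctor ⋙ T.toFunctor) X Y ≫ (Ω.app X ⊗ₘ Ω.app Y)
  counit : Ω.app (𝟙_ C) ≫ η (T.toFunctor ⋙ P.toFunctor) = η (P.toFunctor ⋙ T.toFunctor)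

/-- The monad `P ∘_Ω T`: its underlying functor is `PT`, its product is
`p_X = m_{T(X)} P²(μ_X) P(Ω_{T(X)})` and its unit is `e_X = u_{T(X)} η_X`, where `(m, u)` and
`(μ, η)` are the products and the units of `P` and `T`. -/
def compositeMonad (T P : Bimonad C)
    (Ω : P.toFunctor ⋙ T.toFunctor ⟶ T.toFunctor ⋙ P.toFunctor)
    (hΩ : IsComonoidalDistributiveLaw T P Ω) : Monad C where
  toFunctor := T.toFunctor ⋙ P.toFunctor
  η :=
    { app := fun X => T.η.app X ≫ P.η.app (T.obj X)
      naturality := fun X Y f => by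
        have h₁ := T.η.naturality f
        have h₂ := P.η.naturality (T.map f)
        dsimp at h₁ h₂ ⊢
        rw [reassoc_of% h₁, h₂, Category.assoc] }
  μ :=
    { app := fun X =>
        P.map (Ω.app (T.obj X)) ≫ P.map (P.map (T.μ.app X)) ≫ P.μ.app (T.obj X)
      naturality := fun X Y f => by
        have h₁ := Ω.naturality (T.map f)
        have h₂ := T.μ.naturality f
        have h₃ := P.μ.naturality (T.map f)
        dsimp at h₁ h₂ h₃ ⊢
        rw [← P.map_comp_assoc, h₁, P.map_comp_assoc, ← P.map_comp_assoc (P.map _),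
          ← P.map_comp, h₂, P.map_comp, P.map_comp_assoc, h₃]
        simp only [Category.assoc] }
  assoc X := by
    have e₁ := hΩ.mul_right (T.obj X)
    have e₂ := Ω.naturality (P.map (T.μ.app X))
    have e₃ := Ω.naturality (Ω.app (T.obj X))
    have e₄ := Ω.naturality (T.μ.app X)
    have e₅ := P.μ.naturality (T.μ.app X)
    have e₆ := hΩ.mul_left (T.obj X)
    have e₇ := T.assoc X
    have e₈ := P.μ.naturality (Ω.app (T.obj X))
    have e₉ := P.μ.naturality (P.map (T.μ.app X))
    have e₁₀ := P.assoc (T.obj X)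
    dsimp at e₁ e₂ e₃ e₄ e₅ e₆ e₇ e₈ e₉ e₁₀ ⊢
    have key : T.map (P.map (Ω.app (T.obj X)) ≫ P.map (P.map (T.μ.app X)) ≫
          P.μ.app (T.obj X)) ≫ Ω.app (T.obj X) ≫ P.map (T.μ.app X) =
        Ω.app (T.obj (P.obj (T.obj X))) ≫ P.map (T.μ.app (P.obj (T.obj X))) ≫
          P.map (Ω.app (T.obj X)) ≫ P.map (P.map (T.μ.app X)) ≫ P.μ.app (T.obj X) := by
      simp only [Functor.map_comp, Category.assoc]
      rw [reassoc_of% e₁, reassoc_of% e₂, reassoc_of% e₃, ← e₅, ← P.map_comp_assoc (T.μ.app _),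
        e₆, ← P.map_comp_assoc (T.map (P.map _)), e₄]
      simp only [Functor.map_comp, Category.assoc]
      rw [← P.map_comp_assoc (P.map (T.map _)), ← P.map_comp, e₇, P.map_comp, P.map_comp_assoc]
    simp only [Functor.map_comp, Category.assoc] at key ⊢
    rw [← reassoc_of% e₈, ← reassoc_of% e₉, ← e₁₀]
    simp only [← P.map_comp_assoc] at key ⊢
    rw [key]
  left_unit X := by
    have e₁ := P.η.naturality (Ω.app (T.obj X))
    have e₂ := P.η.naturality (P.map (T.μ.app X))
    have e₃ := hΩ.unit_left (T.obj X)
    have e₄ := P.left_unit (T.obj X)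
    have e₅ := T.left_unit X
    dsimp at e₁ e₂ e₃ e₄ e₅ ⊢
    rw [Category.assoc, ← reassoc_of% e₁, ← reassoc_of% e₂, reassoc_of% e₃, e₄,
      Category.comp_id, ← P.map_comp, e₅, P.map_id]
  right_unit X := by
    have e₁ := hΩ.unit_right (T.obj X)
    have e₂ := P.η.naturality (T.μ.app X)
    have e₄ := P.right_unit (T.obj X)
    have e₅ := T.right_unit X
    dsimp at e₁ e₂ e₄ e₅ ⊢
    simp only [Functor.map_comp, Category.assoc]
    rw [← P.map_comp_assoc (T.map (P.η.app _)), e₁, ← P.map_comp_assoc (P.η.app _), ← e₂,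
      P.map_comp_assoc, e₄, Category.comp_id, ← P.map_comp, e₅, P.map_id]

/-- The bimonad `P ∘_Ω T`; its comonoidal structure is that of the composite functor `PT`. -/
def compositeBimonad (T P : Bimonad C)
    (Ω : P.toFunctor ⋙ T.toFunctor ⟶ T.toFunctor ⋙ P.toFunctor)
    (hΩ : IsComonoidalDistributiveLaw T P Ω) : Bimonad C where
  toMonad := compositeMonad T P Ω hΩ
  comonoidal := Functor.OplaxMonoidal.comp T.toFunctor P.toFunctor
  mul_comul X Y := by
    have e₁ := P.mul_comul (T.obj X) (T.obj Y)
    have e₂ := T.mul_comul X Y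
    have e₃ := hΩ.comul (T.obj X) (T.obj Y)
    have e₄ := P.μ.naturality (δ T.toFunctor X Y)
    have e₅ := δ_natural P.toFunctor (Ω.app (T.obj X)) (Ω.app (T.obj Y))
    have e₆ := δ_natural P.toFunctor (P.map (T.μ.app X)) (P.map (T.μ.app Y))
    have e₇ := δ_natural P.toFunctor (T.μ.app X) (T.μ.app Y)
    have e₈ := Ω.naturality (δ T.toFunctor X Y)
    change (P.map (Ω.app (T.obj (X ⊗ Y))) ≫ P.map (P.map (T.μ.app (X ⊗ Y))) ≫
        P.μ.app (T.obj (X ⊗ Y))) ≫ P.map (δ T.toFunctor X Y) ≫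
          δ P.toFunctor (T.obj X) (T.obj Y) =
      P.map (T.map (P.map (δ T.toFunctor X Y) ≫ δ P.toFunctor (T.obj X) (T.obj Y))) ≫
        (P.map (δ T.toFunctor (P.obj (T.obj X)) (P.obj (T.obj Y))) ≫
          δ P.toFunctor (T.obj (P.obj (T.obj X))) (T.obj (P.obj (T.obj Y)))) ≫
        ((P.map (Ω.app (T.obj X)) ≫ P.map (P.map (T.μ.app X)) ≫ P.μ.app (T.obj X)) ⊗ₘ
          (P.map (Ω.app (T.obj Y)) ≫ P.map (P.map (T.μ.app Y)) ≫ P.μ.app (T.obj Y)))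
    dsimp at e₁ e₂ e₃ e₄ e₅ e₆ e₇ e₈
    simp only [Functor.map_comp, Category.assoc, ← tensorHom_comp_tensorHom] at e₃ ⊢
    rw [reassoc_of% e₅, reassoc_of% e₆, ← reassoc_of% e₄, e₁]
    have key : Ω.app (T.obj (X ⊗ Y)) ≫ P.map (T.μ.app (X ⊗ Y)) ≫ P.map (δ T.toFunctor X Y) ≫
          δ P.toFunctor (T.obj X) (T.obj Y) =
        T.map (P.map (δ T.toFunctor X Y)) ≫ T.map (δ P.toFunctor (T.obj X) (T.obj Y)) ≫
          δ T.toFunctor (P.obj (T.obj X)) (P.obj (T.obj Y)) ≫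
            (Ω.app (T.obj X) ⊗ₘ Ω.app (T.obj Y)) ≫
              (P.map (T.μ.app X) ⊗ₘ P.map (T.μ.app Y)) := by
      rw [← reassoc_of% e₃, e₇, reassoc_of% e₈, ← P.map_comp_assoc, e₂]
      simp only [Functor.map_comp, Category.assoc]
    simp only [← P.map_comp_assoc] at key ⊢
    rw [key]
  mul_counit := by
    have e₁ := P.mul_counit
    have e₂ := T.mul_counit
    have e₃ := hΩ.counit
    have e₄ := P.μ.naturality (η T.toFunctor)
    have e₅ := Ω.naturality (η T.toFunctor)
    change (P.map (Ω.app (T.obj (𝟙_ C))) ≫ P.map (P.map (T.μ.app (𝟙_ C))) ≫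
        P.μ.app (T.obj (𝟙_ C))) ≫ P.map (η T.toFunctor) ≫ η P.toFunctor =
      P.map (T.map (P.map (η T.toFunctor) ≫ η P.toFunctor)) ≫
        P.map (η T.toFunctor) ≫ η P.toFunctor
    dsimp at e₁ e₂ e₃ e₄ e₅
    simp only [Functor.map_comp, Category.assoc] at e₃ ⊢
    rw [← reassoc_of% e₄, e₁]
    have key : Ω.app (T.obj (𝟙_ C)) ≫ P.map (T.μ.app (𝟙_ C)) ≫ P.map (η T.toFunctor) ≫
          η P.toFunctor =
        T.map (P.map (η T.toFunctor)) ≫ T.map (η P.toFunctor) ≫ η T.toFunctor := by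
      rw [← e₃, reassoc_of% e₅, ← P.map_comp_assoc, e₂]
      simp only [Functor.map_comp, Category.assoc]
    simp only [← P.map_comp_assoc] at key ⊢
    rw [key]
  unit_comul X Y := by
    have e₁ := P.unit_comul (T.obj X) (T.obj Y)
    have e₂ := T.unit_comul X Y
    have e₃ := P.η.naturality (δ T.toFunctor X Y)
    change (T.η.app (X ⊗ Y) ≫ P.η.app (T.obj (X ⊗ Y))) ≫ P.map (δ T.toFunctor X Y) ≫
        δ P.toFunctor (T.obj X) (T.obj Y) =
      ((T.η.app X ≫ P.η.app (T.obj X)) ⊗ₘ (T.η.app Y ≫ P.η.app (T.obj Y)))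
    dsimp at e₁ e₂ e₃
    rw [Category.assoc, ← reassoc_of% e₃, e₁, reassoc_of% e₂, tensorHom_comp_tensorHom]
  unit_counit := by
    have e₁ := P.unit_counit
    have e₂ := T.unit_counit
    have e₃ := P.η.naturality (η T.toFunctor)
    change (T.η.app (𝟙_ C) ≫ P.η.app (T.obj (𝟙_ C))) ≫ P.map (η T.toFunctor) ≫
        η P.toFunctor = 𝟙 (𝟙_ C)
    dsimp at e₁ e₂ e₃
    rw [Category.assoc, ← reassoc_of% e₃, e₁]
    simpa using e₂

end DistributiveLaw

/-! ### Centralizers -/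

section Centralizer

variable {C : Type u} [Category.{v} C] [MonoidalCategory C]

/-- A centralizer `(Z, ∂)` of an endofunctor `T`: an endofunctor `Z` and a natural transformation
`∂_{X,Y} : X ⊗ Y ⟶ T(Y) ⊗ Z(X)` such that, for all `X` and `W`, every natural transformation
`ξ_Y : X ⊗ Y ⟶ T(Y) ⊗ W` factors as `ξ_Y = (id_{T(Y)} ⊗ r) ∂_{X,Y}` for a unique `r : Z(X) ⟶ W`. -/
structure Centralizer (T : C ⥤ C) where
  Z : C ⥤ C
  del : ∀ X Y : C, X ⊗ Y ⟶ T.obj Y ⊗ Z.obj X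
  naturality : ∀ {X X' Y Y' : C} (f : X ⟶ X') (g : Y ⟶ Y'),
    (f ⊗ₘ g) ≫ del X' Y' = del X Y ≫ (T.map g ⊗ₘ Z.map f)
  existsUnique_factor : ∀ (X W : C) (ξ : tensorLeft X ⟶ T ⋙ tensorRight W),
    ∃! r : Z.obj X ⟶ W, ∀ Y : C, ξ.app Y = del X Y ≫ T.obj Y ◁ r

namespace Centralizer

/-- The universal dinatural transformation `i_{X,Y} : ∨T(Y) ⊗ X ⊗ Y ⟶ Z(X)`,
`i_{X,Y} = (ev_{T(Y)} ⊗ id_{Z(X)}) (id_{∨T(Y)} ⊗ ∂_{X,Y})`. -/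
def ι [RigidCategory C] {T : C ⥤ C} (Z : Centralizer T) (X Y : C) :
    (T.obj Y)ᘁ ⊗ (X ⊗ Y) ⟶ Z.Z.obj X :=
  (T.obj Y)ᘁ ◁ Z.del X Y ≫ (α_ ((T.obj Y)ᘁ : C) (T.obj Y) (Z.Z.obj X)).inv ≫
    ε_ (T.obj Y) ((T.obj Y)ᘁ) ▷ Z.Z.obj X ≫ (λ_ (Z.Z.obj X)).hom

variable {T : Bimonad C}

/-- The structural morphisms `m`, `u`, `Z₂`, `Z₀` of the centralizer `Z` of a bimonad `T`. The
`spec` fields are their defining relations, in which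
`∂²_{X,Y₁,Y₂} = (id_{T(Y₁)} ⊗ ∂_{Z(X),Y₂}) (∂_{X,Y₁} ⊗ id_{Y₂})`:
* `(id ⊗ m_X) ∂²_{X,Y₁,Y₂} = (T₂(Y₁,Y₂) ⊗ id) ∂_{X,Y₁⊗Y₂}`;
* `u_X = (T₀ ⊗ id) ∂_{X,𝟙}`;
* `(id ⊗ Z₂(X₁,X₂)) ∂_{X₁⊗X₂,Y} = (μ_Y ⊗ id) (∂_{X₁,T(Y)} ⊗ id) (id ⊗ ∂_{X₂,Y})`;
* `(id ⊗ Z₀) ∂_{𝟙,Y} = η_Y`.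

No algebraic law is required here. -/
structure Structure (Z : Centralizer T.toFunctor) where
  mul : Z.Z ⋙ Z.Z ⟶ Z.Z
  unit : 𝟭 C ⟶ Z.Z
  comul : ∀ X₁ X₂ : C, Z.Z.obj (X₁ ⊗ X₂) ⟶ Z.Z.obj X₁ ⊗ Z.Z.obj X₂
  counit : Z.Z.obj (𝟙_ C) ⟶ 𝟙_ C
  mul_spec : ∀ X Y₁ Y₂ : C,
    Z.del X Y₁ ▷ Y₂ ≫ (α_ (T.obj Y₁) (Z.Z.obj X) Y₂).hom ≫
        T.obj Y₁ ◁ Z.del (Z.Z.obj X) Y₂ ≫ T.obj Y₁ ◁ T.obj Y₂ ◁ mul.app X =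
      (α_ X Y₁ Y₂).hom ≫ Z.del X (Y₁ ⊗ Y₂) ≫ δ T.toFunctor Y₁ Y₂ ▷ Z.Z.obj X ≫
        (α_ (T.obj Y₁) (T.obj Y₂) (Z.Z.obj X)).hom
  unit_spec : ∀ X : C, unit.app X =
    (ρ_ X).inv ≫ Z.del X (𝟙_ C) ≫ η T.toFunctor ▷ Z.Z.obj X ≫ (λ_ (Z.Z.obj X)).hom
  comul_spec : ∀ X₁ X₂ Y : C,
    Z.del (X₁ ⊗ X₂) Y ≫ T.obj Y ◁ comul X₁ X₂ =
      (α_ X₁ X₂ Y).hom ≫ X₁ ◁ Z.del X₂ Y ≫ (α_ X₁ (T.obj Y) (Z.Z.obj X₂)).inv ≫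
        Z.del X₁ (T.obj Y) ▷ Z.Z.obj X₂ ≫
          (α_ (T.obj (T.obj Y)) (Z.Z.obj X₁) (Z.Z.obj X₂)).hom ≫
            T.μ.app Y ▷ (Z.Z.obj X₁ ⊗ Z.Z.obj X₂)
  counit_spec : ∀ Y : C,
    Z.del (𝟙_ C) Y ≫ T.obj Y ◁ counit = (λ_ Y).hom ≫ T.η.app Y ≫ (ρ_ (T.obj Y)).inv

/-- The morphisms `(m, u, Z₂, Z₀)` make the endofunctor `Z` a bimonad: `(Z, m, u)` is a monad,
`(Z, Z₂, Z₀)` is a comonoidal functor, and `m` and `u` are comonoidal. -/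
structure Structure.IsBimonad {Z : Centralizer T.toFunctor} (S : Z.Structure) : Prop where
  assoc : ∀ X : C, Z.Z.map (S.mul.app X) ≫ S.mul.app X = S.mul.app (Z.Z.obj X) ≫ S.mul.app X
  left_unit : ∀ X : C, S.unit.app (Z.Z.obj X) ≫ S.mul.app X = 𝟙 (Z.Z.obj X)
  right_unit : ∀ X : C, Z.Z.map (S.unit.app X) ≫ S.mul.app X = 𝟙 (Z.Z.obj X)
  comul_naturality : ∀ {X X' Y Y' : C} (f : X ⟶ X') (g : Y ⟶ Y'),
    Z.Z.map (f ⊗ₘ g) ≫ S.comul X' Y' = S.comul X Y ≫ (Z.Z.map f ⊗ₘ Z.Z.map g)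
  coassoc : ∀ X Y W : C,
    S.comul (X ⊗ Y) W ≫ S.comul X Y ▷ Z.Z.obj W ≫
        (α_ (Z.Z.obj X) (Z.Z.obj Y) (Z.Z.obj W)).hom =
      Z.Z.map (α_ X Y W).hom ≫ S.comul X (Y ⊗ W) ≫ Z.Z.obj X ◁ S.comul Y W
  left_counit : ∀ X : C,
    Z.Z.map (λ_ X).inv ≫ S.comul (𝟙_ C) X ≫ S.counit ▷ Z.Z.obj X = (λ_ (Z.Z.obj X)).inv
  right_counit : ∀ X : C,
    Z.Z.map (ρ_ X).inv ≫ S.comul X (𝟙_ C) ≫ Z.Z.obj X ◁ S.counit = (ρ_ (Z.Z.obj X)).inv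
  mul_comul : ∀ X Y : C, S.mul.app (X ⊗ Y) ≫ S.comul X Y =
    Z.Z.map (S.comul X Y) ≫ S.comul (Z.Z.obj X) (Z.Z.obj Y) ≫ (S.mul.app X ⊗ₘ S.mul.app Y)
  mul_counit : S.mul.app (𝟙_ C) ≫ S.counit = Z.Z.map S.counit ≫ S.counit
  unit_comul : ∀ X Y : C, S.unit.app (X ⊗ Y) ≫ S.comul X Y = (S.unit.app X ⊗ₘ S.unit.app Y)
  unit_counit : S.unit.app (𝟙_ C) ≫ S.counit = 𝟙 (𝟙_ C)

/-- The centralizer of a bimonad, as a bimonad. -/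
def Structure.bimonad {Z : Centralizer T.toFunctor} (S : Z.Structure) (hS : S.IsBimonad) :
    Bimonad C where
  toFunctor := Z.Z
  η := S.unit
  μ := S.mul
  assoc := hS.assoc
  left_unit := hS.left_unit
  right_unit := hS.right_unit
  comonoidal :=
    { η := S.counit
      δ := S.comul
      δ_natural_left := fun f X' => by
        have h := hS.comul_naturality f (𝟙 X')
        simpa using h.symm
      δ_natural_right := fun X' f => by
        have h := hS.comul_naturality (𝟙 X') f
        simpa using h.symm
      oplax_associativity := hS.coassoc
      oplax_left_unitality := fun X => (hS.left_counit X).symm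
      oplax_right_unitality := fun X => (hS.right_counit X).symm }
  mul_comul := hS.mul_comul
  mul_counit := hS.mul_counit
  unit_comul := hS.unit_comul
  unit_counit := hS.unit_counit

end Centralizer

end Centralizer

/-! ### The double of a Hopf monad -/

section Double

variable {C : Type u} [Category.{v} C] [MonoidalCategory C] [RigidCategory C]

/-- The defining relation of the canonical distributive law `Ω : T Z ⟶ Z T` of a Hopf monad `T`
with centralizer `Z`, where `sˡ` is the left antipode of `T` and
`T₃(A, X, Y) = (id ⊗ T₂(X, Y)) T₂(A, X ⊗ Y)`:
`Ω_X T(i_{X,Y}) = i_{T(X),T(Y)} (∨μ_Y sˡ_{T(Y)} T(∨μ_Y) ⊗ id) T₃(∨T(Y), X, Y)`. -/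
def IsCanonicalLaw (T : HopfMonad C) (Z : Centralizer T.toFunctor)
    (Ω : Z.Z ⋙ T.toFunctor ⟶ T.toFunctor ⋙ Z.Z) : Prop :=
  ∀ X Y : C, T.map (Z.ι X Y) ≫ Ω.app X =
    δ T.toFunctor ((T.obj Y)ᘁ : C) (X ⊗ Y) ≫ T.obj ((T.obj Y)ᘁ : C) ◁ δ T.toFunctor X Y ≫
      (T.map ((T.μ.app Y)ᘁ) ≫ T.leftAntipode.s (T.obj Y) ≫ ((T.μ.app Y)ᘁ)) ▷
          (T.obj X ⊗ T.obj Y) ≫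
        Z.ι (T.obj X) (T.obj Y)

variable (T : HopfMonad C) (Z : Centralizer T.toFunctor) (S : Z.Structure) (hS : S.IsBimonad)
  (Ω : Z.Z ⋙ T.toFunctor ⟶ T.toFunctor ⋙ Z.Z)
  (hΩ : IsComonoidalDistributiveLaw T.toBimonad (S.bimonad hS) Ω)

/-- The double `D_T = Z_T ∘_Ω T`. -/
abbrev double : Bimonad C := compositeBimonad T.toBimonad (S.bimonad hS) Ω hΩ

/-- The R-matrix `R_{X,Y} = (u_{T(Y)} ⊗ Z_T(η_X)) ∂_{X,Y} : X ⊗ Y ⟶ D_T(Y) ⊗ D_T(X)`, where `η`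
and `u` are the units of `T` and `Z_T`. -/
def doubleR (X Y : C) :
    X ⊗ Y ⟶ (double T Z S hS Ω hΩ).obj Y ⊗ (double T Z S hS Ω hΩ).obj X :=
  Z.del X Y ≫ (S.unit.app (T.obj Y) ⊗ₘ Z.Z.map (T.η.app X))

/-- The action `r : Z_T(T(M)) ⟶ M` of a `D_T`-module `(M, r)`. -/
def doubleAct (M : (double T Z S hS Ω hΩ).Mod) : Z.Z.obj (T.obj M.A) ⟶ M.A := M.a

lemma doubleAct_unit (M : (double T Z S hS Ω hΩ).Mod) :
    T.η.app M.A ≫ S.unit.app (T.obj M.A) ≫ doubleAct T Z S hS Ω hΩ M = 𝟙 M.A :=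
  (Category.assoc _ _ _).symm.trans M.unit

lemma doubleAct_assoc (M : (double T Z S hS Ω hΩ).Mod) :
    Z.Z.map (Ω.app (T.obj M.A)) ≫ Z.Z.map (Z.Z.map (T.μ.app M.A)) ≫
        S.mul.app (T.obj M.A) ≫ doubleAct T Z S hS Ω hΩ M =
      Z.Z.map (T.map (doubleAct T Z S hS Ω hΩ M)) ≫ doubleAct T Z S hS Ω hΩ M := by
  have h : (Z.Z.map (Ω.app (T.obj M.A)) ≫ Z.Z.map (Z.Z.map (T.μ.app M.A)) ≫
      S.mul.app (T.obj M.A)) ≫ doubleAct T Z S hS Ω hΩ M =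
    Z.Z.map (T.map (doubleAct T Z S hS Ω hΩ M)) ≫ doubleAct T Z S hS Ω hΩ M := M.assoc
  simpa only [Category.assoc] using h

lemma doubleAct_hom {M M' : (double T Z S hS Ω hΩ).Mod} (f : M ⟶ M') :
    Z.Z.map (T.map f.f) ≫ doubleAct T Z S hS Ω hΩ M' = doubleAct T Z S hS Ω hΩ M ≫ f.f :=
  f.h

/-- The `T`-module `(M, r u_{T(M)})` underlying a `D_T`-module `(M, r)`. -/
@[simps]
def doubleRestrict (M : (double T Z S hS Ω hΩ).Mod) : T.Mod where
  A := M.A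
  a := S.unit.app (T.obj M.A) ≫ doubleAct T Z S hS Ω hΩ M
  unit := doubleAct_unit T Z S hS Ω hΩ M
  assoc := by
    have h := doubleAct_assoc T Z S hS Ω hΩ M
    have e₁ : T.map (S.unit.app (T.obj M.A)) ≫ Ω.app (T.obj M.A) =
      S.unit.app (T.obj (T.obj M.A)) := hΩ.unit_right (T.obj M.A)
    have e₂ := S.unit.naturality (Ω.app (T.obj M.A))
    have e₃ := S.unit.naturality (Z.Z.map (T.μ.app M.A))
    have e₄ := S.unit.naturality (T.μ.app M.A)
    have e₅ := S.unit.naturality (T.map (doubleAct T Z S hS Ω hΩ M))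
    have e₆ := hS.left_unit (T.obj M.A)
    dsimp at e₂ e₃ e₄ e₅
    rw [Functor.map_comp, Category.assoc, reassoc_of% e₅, ← h, ← reassoc_of% e₂,
      ← reassoc_of% e₃, reassoc_of% e₆, reassoc_of% e₁, reassoc_of% e₄]

/-- The morphism `(s ⊗ r Z_T(η_M)) ∂_{M,N} : M ⊗ N ⟶ N ⊗ M` of `C`, for a `D_T`-module `(M, r)`
and a `T`-module `(N, s)`. -/
def doubleBraiding (M : (double T Z S hS Ω hΩ).Mod) (N : T.Mod) : M.A ⊗ N.A ⟶ N.A ⊗ M.A :=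
  Z.del M.A N.A ≫ (N.a ⊗ₘ (Z.Z.map (T.η.app M.A) ≫ doubleAct T Z S hS Ω hΩ M))

lemma doubleBraiding_naturality {M M' : (double T Z S hS Ω hΩ).Mod} (f : M ⟶ M') (N : T.Mod) :
    f.f ▷ N.A ≫ doubleBraiding T Z S hS Ω hΩ M' N =
      doubleBraiding T Z S hS Ω hΩ M N ≫ N.A ◁ f.f := by
  have h := doubleAct_hom T Z S hS Ω hΩ f
  have e₁ := T.η.naturality f.f
  have e₂ := Z.naturality f.f (𝟙 N.A)
  dsimp at e₁
  rw [CategoryTheory.Functor.map_id, MonoidalCategory.id_tensorHom, MonoidalCategory.tensorHom_id] at e₂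
  rw [doubleBraiding, doubleBraiding, reassoc_of% e₂, whiskerLeft_comp_tensorHom,
    ← Z.Z.map_comp_assoc, e₁, Z.Z.map_comp_assoc, h, Category.assoc, tensorHom_comp_whiskerLeft,
    Category.assoc]

/-- The functor `I : D_T-C ⥤ 𝒵(T-C)`, `I(M, r) = ((M, r u_{T(M)}), σ)` and `I(f) = f`, where `σ` is
the half braiding with components `σ_{(N,s)} = (s ⊗ r Z_T(η_M)) ∂_{M,N}`. -/
def doubleFunctor
    (σ : ∀ M : (double T Z S hS Ω hΩ).Mod, HalfBraiding (doubleRestrict T Z S hS Ω hΩ M))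
    (hσ : ∀ M N, ((σ M).β N).hom.f = doubleBraiding T Z S hS Ω hΩ M N) :
    (double T Z S hS Ω hΩ).Mod ⥤ Center T.Mod where
  obj M := ⟨doubleRestrict T Z S hS Ω hΩ M, σ M⟩
  map {M M'} f :=
    { f :=
        { f := f.f
          h := by
            have h := doubleAct_hom T Z S hS Ω hΩ f
            have e := S.unit.naturality (T.map f.f)
            dsimp at e
            change T.map f.f ≫ S.unit.app (T.obj M'.A) ≫ doubleAct T Z S hS Ω hΩ M' =
              (S.unit.app (T.obj M.A) ≫ doubleAct T Z S hS Ω hΩ M) ≫ f.f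
            rw [reassoc_of% e, h, Category.assoc] }
      comm := fun N => by
        apply Monad.Algebra.Hom.ext'
        change f.f ▷ N.A ≫ ((σ M').β N).hom.f = ((σ M).β N).hom.f ≫ N.A ◁ f.f
        rw [hσ, hσ]
        exact doubleBraiding_naturality T Z S hS Ω hΩ f N }
  map_id M := rfl
  map_comp f g := rfl

end Double

/-- A monoidal functor is strict if its structural morphisms `F₂` and `F₀` are identities. -/
structure IsStrictMonoidal {C : Type*} [Category* C] [MonoidalCategory C] {D : Type*}
    [Category* D] [MonoidalCategory D] (F : C ⥤ D) [F.LaxMonoidal] : Prop where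
  obj_tensor : ∀ X Y : C, F.obj X ⊗ F.obj Y = F.obj (X ⊗ Y)
  obj_unit : 𝟙_ D = F.obj (𝟙_ C)
  μ_eq : ∀ X Y : C, μ F X Y = eqToHom (obj_tensor X Y)
  ε_eq : ε F = eqToHom obj_unit

/-!
The module category of a Hopf monad `T` on a category with duals has duals: the antipodes act on the
duals of the underlying objects, with linear evaluation and coevaluation, and such an action is
automatically unital and associative by a "left inverse equals right inverse" argument
(`dual_action_unique`). Consequently the forgetful functor from `T`-modules has a right adjoint, and
so has `T`. The transposes of the universal morphisms `∂_{X,Y} : X ⊗ Y ⟶ T(Y) ⊗ Z(X)` are jointly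
epimorphic, so that their image under `T` is again jointly epimorphic and even universal; the lemmas
`isDetecting_extend` and `exists_factor_extend` say this without transposing. Almost every identity
below is verified after composition with such a family.

The structure of a bimonad on `Z` is forced by the universal property of `∂`
(`Structure.eq`, `nonempty_structure`), and its laws follow from those of `T`
(`Structure.isBimonad`). For a `T`-module `N` with action `s`, put
`Z.cross X N = (s ⊗ id) ∂_{X,N} : X ⊗ N ⟶ N ⊗ Z(X)`. On these morphisms the defining relations of
`m`, `u`, `Z₂` and `Z₀` become the axioms of a braiding, with `Z(X)` in the place of `X` on the right
(`Structure.cross_mul`, `Structure.cross_comul`).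

There is one action of `T` on `Z(M)`, for a `T`-module `M`, such that all `Z.cross M N` are linear
(`exists_liftAct`). This lifts `Z` to `T`-modules, and `m`, `u`, `Z₂`, `Z₀` are linear for the lift,
since they are after composition with `Z.cross`. As always, the lift amounts to a distributive law
(`isComonoidalDistributiveLaw_law`), which satisfies the canonical defining relation because the
left antipode translates between the linear extension of `∂` and `T` of its transpose
(`isCanonicalLaw_law`). It is the only one which does, by joint epimorphy (`eq_law`).

A module over the double is then a `T`-module `M` with a `T`-linear action `z : Z(M) ⟶ M` of `Z`
(`Structure.IsLiftAction`, `isLiftAction_doubleZ`, `doubleMod`). By the universal property of `∂`,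
morphisms `z : Z(M) ⟶ M` correspond to natural families `M ⊗ N ⟶ N ⊗ M` indexed by the `T`-modules
`N`, through `z ↦ (id_N ⊗ z) Z.cross M N`. Unitality, associativity and linearity of `z` correspond
to the axioms of a half braiding (`isLiftAction_of_halfBraiding`, `exists_halfBraiding_eq`), where
invertibility is automatic because `T`-modules have duals (`exists_inverse_halfBraiding`). This is
the isomorphism between the modules over the double and the center of the category of `T`-modules.
It does not change underlying objects and morphisms, so it is strict monoidal, and the braiding of
the center transports to the one which the R-matrix defines (`braiding_eq_doubleR`).
-/

/-! ### Dual modules over a Hopf monad -/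

section OplaxUniqueness

variable {C : Type u} [Category.{v} C] [MonoidalCategory C]

/-- An "antipode" of an oplax functor on the dual `K` of an object `N` is unique: `ρ` compatible
with the evaluation agrees with `ρ'` compatible with the coevaluation, just as a left inverse
agrees with a right inverse. -/
lemma dual_action_unique (F : C ⥤ C) [F.OplaxMonoidal] {N K : C} [ExactPairing N K]
    (r : F.obj N ⟶ N) (ρ ρ' : F.obj K ⟶ K)
    (hev : F.map (ε_ N K) ≫ η F = δ F K N ≫ (ρ ⊗ₘ r) ≫ ε_ N K)
    (hcoev : η F ≫ η_ N K = F.map (η_ N K) ≫ δ F N K ≫ (r ⊗ₘ ρ')) : ρ = ρ' := by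
  have h₁ : F.map ((ρ_ K).inv ≫ K ◁ η_ N K ≫ (α_ _ _ _).inv) ≫ δ F (K ⊗ N) K ≫
      δ F K N ▷ F.obj K ≫ ((ρ ⊗ₘ r) ⊗ₘ ρ') ≫ ε_ N K ▷ K ≫ (λ_ K).hom = ρ' := by
    have e : δ F K N ▷ F.obj K ≫ ((ρ ⊗ₘ r) ⊗ₘ ρ') ≫ ε_ N K ▷ K =
        F.map (ε_ N K) ▷ F.obj K ≫ η F ▷ F.obj K ≫ 𝟙_ C ◁ ρ' := by
      have e₁ := congrArg (· ▷ F.obj K) hev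
      simp only [comp_whiskerRight] at e₁
      rw [reassoc_of% e₁, MonoidalCategory.tensorHom_def, Category.assoc, whisker_exchange]
    rw [reassoc_of% e, δ_natural_left_assoc, ← F.map_comp_assoc]
    simp only [Category.assoc, ExactPairing.coevaluation_evaluation]
    simp
  have h₂ : F.map ((ρ_ K).inv ≫ K ◁ η_ N K ≫ (α_ _ _ _).inv) ≫ δ F (K ⊗ N) K ≫
      δ F K N ▷ F.obj K ≫ ((ρ ⊗ₘ r) ⊗ₘ ρ') ≫ ε_ N K ▷ K ≫ (λ_ K).hom = ρ := by
    have e : F.map (α_ K N K).inv ≫ δ F (K ⊗ N) K ≫ δ F K N ▷ F.obj K =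
        δ F K (N ⊗ K) ≫ F.obj K ◁ δ F N K ≫ (α_ _ _ _).inv := by
      rw [← cancel_mono (α_ _ _ _).hom, ← cancel_epi (F.map (α_ K N K).hom)]
      simp
    have e' : F.obj K ◁ F.map (η_ N K) ≫ F.obj K ◁ δ F N K ≫ (ρ ⊗ₘ (r ⊗ₘ ρ')) =
        F.obj K ◁ η F ≫ ρ ▷ 𝟙_ C ≫ K ◁ η_ N K := by
      rw [tensorHom_def', ← whiskerLeft_comp_assoc, ← whiskerLeft_comp_assoc, Category.assoc,
        ← hcoev, MonoidalCategory.whiskerLeft_comp, Category.assoc, whisker_exchange]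
    simp only [Functor.map_comp, Category.assoc]
    rw [reassoc_of% e, ← δ_natural_right_assoc, ← associator_inv_naturality_assoc, reassoc_of% e']
    have := ExactPairing.coevaluation_evaluation_assoc N K (λ_ K).hom
    rw [this]
    simp
  exact h₂.symm.trans h₁

/-- The mirror image of `dual_action_unique`. -/
lemma dual_action_unique' (F : C ⥤ C) [F.OplaxMonoidal] {N K : C} [ExactPairing K N]
    (r : F.obj N ⟶ N) (ρ ρ' : F.obj K ⟶ K)
    (hev : F.map (ε_ K N) ≫ η F = δ F N K ≫ (r ⊗ₘ ρ) ≫ ε_ K N)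
    (hcoev : η F ≫ η_ K N = F.map (η_ K N) ≫ δ F K N ≫ (ρ' ⊗ₘ r)) : ρ = ρ' := by
  have h₁ : F.map ((λ_ K).inv ≫ η_ K N ▷ K ≫ (α_ _ _ _).hom) ≫ δ F K (N ⊗ K) ≫
      F.obj K ◁ δ F N K ≫ (ρ' ⊗ₘ (r ⊗ₘ ρ)) ≫ K ◁ ε_ K N ≫ (ρ_ K).hom = ρ' := by
    have e : F.obj K ◁ δ F N K ≫ (ρ' ⊗ₘ (r ⊗ₘ ρ)) ≫ K ◁ ε_ K N =
        F.obj K ◁ F.map (ε_ K N) ≫ F.obj K ◁ η F ≫ ρ' ▷ 𝟙_ C := by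
      have e₁ := congrArg (F.obj K ◁ ·) hev
      simp only [MonoidalCategory.whiskerLeft_comp] at e₁
      rw [reassoc_of% e₁, MonoidalCategory.tensorHom_def', Category.assoc, whisker_exchange]
    rw [reassoc_of% e, δ_natural_right_assoc, ← F.map_comp_assoc]
    simp only [Category.assoc, ExactPairing.evaluation_coevaluation]
    simp
  have h₂ : F.map ((λ_ K).inv ≫ η_ K N ▷ K ≫ (α_ _ _ _).hom) ≫ δ F K (N ⊗ K) ≫
      F.obj K ◁ δ F N K ≫ (ρ' ⊗ₘ (r ⊗ₘ ρ)) ≫ K ◁ ε_ K N ≫ (ρ_ K).hom = ρ := by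
    have e : F.map (α_ K N K).hom ≫ δ F K (N ⊗ K) ≫ F.obj K ◁ δ F N K =
        δ F (K ⊗ N) K ≫ δ F K N ▷ F.obj K ≫ (α_ _ _ _).hom := by
      simp
    have e' : F.map (η_ K N) ▷ F.obj K ≫ δ F K N ▷ F.obj K ≫ ((ρ' ⊗ₘ r) ⊗ₘ ρ) =
        η F ▷ F.obj K ≫ 𝟙_ C ◁ ρ ≫ η_ K N ▷ K := by
      rw [MonoidalCategory.tensorHom_def, ← comp_whiskerRight_assoc, ← comp_whiskerRight_assoc,
        Category.assoc, ← hcoev, comp_whiskerRight, Category.assoc, whisker_exchange]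
    simp only [Functor.map_comp, Category.assoc]
    rw [reassoc_of% e, ← δ_natural_left_assoc, ← associator_naturality_assoc, reassoc_of% e']
    have := ExactPairing.evaluation_coevaluation_assoc K N (ρ_ K).hom
    rw [this]
    simp
  exact h₂.symm.trans h₁

end OplaxUniqueness

namespace Bimonad

variable {C : Type u} [Category.{v} C] [MonoidalCategory C] (T : Bimonad C)

/-- A form which is linear for `ρ` and `r` is preserved by `η ≫ ρ` and `η ≫ r`. For an evaluation,
this is the compatibility from which `dual_action_unique` deduces the unit law of `ρ`. -/
lemma ev_unit {N K : C} (p : K ⊗ N ⟶ 𝟙_ C) (r : T.obj N ⟶ N) (ρ : T.obj K ⟶ K)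
    (h : T.map p ≫ η T.toFunctor = δ T.toFunctor K N ≫ (ρ ⊗ₘ r) ≫ p) :
    p = ((T.η.app K ≫ ρ) ⊗ₘ (T.η.app N ≫ r)) ≫ p := by
  have h₁ := T.unit_comul K N
  have h₂ := T.η.naturality p
  have h₃ := T.unit_counit
  dsimp at h₂
  rw [← tensorHom_comp_tensorHom, Category.assoc, ← h₁, Category.assoc, ← h, ← reassoc_of% h₂, h₃,
    Category.comp_id]

/-- A linear form is linear, over the comonoidal functor `T²`, for the actions `μ ≫ ρ` and
`μ ≫ r`. -/
lemma ev_mul {N K : C} (p : K ⊗ N ⟶ 𝟙_ C) (r : T.obj N ⟶ N) (ρ : T.obj K ⟶ K)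
    (h : T.map p ≫ η T.toFunctor = δ T.toFunctor K N ≫ (ρ ⊗ₘ r) ≫ p) :
    (T.toFunctor ⋙ T.toFunctor).map p ≫ η (T.toFunctor ⋙ T.toFunctor) =
      δ (T.toFunctor ⋙ T.toFunctor) K N ≫ ((T.μ.app K ≫ ρ) ⊗ₘ (T.μ.app N ≫ r)) ≫ p := by
  have h₁ := T.mul_comul K N
  have h₂ := T.μ.naturality p
  have h₃ := T.mul_counit
  dsimp at h₂
  rw [← tensorHom_comp_tensorHom, Functor.OplaxMonoidal.comp_η, Functor.OplaxMonoidal.comp_δ]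
  dsimp
  simp only [Category.assoc]
  rw [← reassoc_of% h₁, ← h, ← reassoc_of% h₂, h₃]

/-- A linear copairing is linear, over the comonoidal functor `T²`, for the iterated actions. -/
lemma coev_map {N K : C} (p : 𝟙_ C ⟶ N ⊗ K) (r : T.obj N ⟶ N) (ρ : T.obj K ⟶ K)
    (h : η T.toFunctor ≫ p = T.map p ≫ δ T.toFunctor N K ≫ (r ⊗ₘ ρ)) :
    η (T.toFunctor ⋙ T.toFunctor) ≫ p = (T.toFunctor ⋙ T.toFunctor).map p ≫
      δ (T.toFunctor ⋙ T.toFunctor) N K ≫ ((T.map r ≫ r) ⊗ₘ (T.map ρ ≫ ρ)) := by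
  have h₁ := δ_natural T.toFunctor r ρ
  rw [← tensorHom_comp_tensorHom, Functor.OplaxMonoidal.comp_η, Functor.OplaxMonoidal.comp_δ]
  dsimp
  simp only [Category.assoc]
  rw [reassoc_of% h₁, h, ← T.map_comp_assoc, h]
  simp

/-- The dual of a `T`-module, for an action on the dual object which makes evaluation and
coevaluation `T`-linear: such an action is automatically unital and multiplicative. -/
@[simps]
def rightDualMod (N : T.Mod) (K : C) [ExactPairing N.A K] (ρ : T.obj K ⟶ K)
    (hev : T.map (ε_ N.A K) ≫ η T.toFunctor = δ T.toFunctor K N.A ≫ (ρ ⊗ₘ N.a) ≫ ε_ N.A K)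
    (hcoev : η T.toFunctor ≫ η_ N.A K =
      T.map (η_ N.A K) ≫ δ T.toFunctor N.A K ≫ (N.a ⊗ₘ ρ)) : T.Mod where
  A := K
  a := ρ
  unit := by
    -- both `η ≫ ρ` and `𝟙` are antipodes for the identity functor and the action `𝟙` on `N`
    have h := T.ev_unit _ _ _ hev
    rw [N.unit] at h
    exact dual_action_unique (𝟭 C) (N := N.A) (𝟙 _) _ (𝟙 K)
      (by simpa using h) (by simp)
  assoc :=
    -- both sides are antipodes for `T²`, since the two actions of `T²` on `N` agree
    dual_action_unique (T.toFunctor ⋙ T.toFunctor) (N := N.A) (T.μ.app N.A ≫ N.a) _ _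
      (T.ev_mul _ _ _ hev) (by rw [N.assoc]; exact T.coev_map _ _ _ hcoev)

/-- The mirror image of `rightDualMod`. -/
@[simps]
def leftDualMod (N : T.Mod) (K : C) [ExactPairing K N.A] (ρ : T.obj K ⟶ K)
    (hev : T.map (ε_ K N.A) ≫ η T.toFunctor = δ T.toFunctor N.A K ≫ (N.a ⊗ₘ ρ) ≫ ε_ K N.A)
    (hcoev : η T.toFunctor ≫ η_ K N.A =
      T.map (η_ K N.A) ≫ δ T.toFunctor K N.A ≫ (ρ ⊗ₘ N.a)) : T.Mod where
  A := K
  a := ρ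
  unit := by
    have h := T.ev_unit _ _ _ hev
    rw [N.unit] at h
    exact dual_action_unique' (𝟭 C) (N := N.A) (𝟙 _) _ (𝟙 K)
      (by simpa using h) (by simp)
  assoc :=
    dual_action_unique' (T.toFunctor ⋙ T.toFunctor) (N := N.A) (T.μ.app N.A ≫ N.a) _ _
      (T.ev_mul _ _ _ hev) (by rw [N.assoc]; exact T.coev_map _ _ _ hcoev)

/-- Modules whose underlying objects are dual, by `T`-linear evaluation and coevaluation, are
dual. -/
abbrev exactPairingMod (N K : T.Mod) [ExactPairing N.A K.A]
    (hev : T.map (ε_ N.A K.A) ≫ η T.toFunctor =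
      δ T.toFunctor K.A N.A ≫ (K.a ⊗ₘ N.a) ≫ ε_ N.A K.A)
    (hcoev : η T.toFunctor ≫ η_ N.A K.A =
      T.map (η_ N.A K.A) ≫ δ T.toFunctor N.A K.A ≫ (N.a ⊗ₘ K.a)) : ExactPairing N K where
  evaluation' :=
    { f := ε_ N.A K.A
      h := hev.trans (Category.assoc _ _ _).symm }
  coevaluation' :=
    { f := η_ N.A K.A
      h := hcoev.symm }
  coevaluation_evaluation' :=
    Monad.Algebra.Hom.ext' _ _ _ _ (ExactPairing.coevaluation_evaluation N.A K.A)
  evaluation_coevaluation' :=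
    Monad.Algebra.Hom.ext' _ _ _ _ (ExactPairing.evaluation_coevaluation N.A K.A)

end Bimonad

namespace Bimonad

variable {C : Type u} [Category.{v} C] [MonoidalCategory C] [RigidCategory C] {T : Bimonad C}

namespace LeftAntipode

variable (L : T.LeftAntipode)

/-- Dualizing turns a retraction into a section. Applied to the unit law of a module, this removes
the dual of the unit of `T` from the evaluation axiom of the antipode. -/
lemma map_mate_section {X Y : C} (f : X ⟶ Y) (g : Y ⟶ X) (h : f ≫ g = 𝟙 X) :
    T.map ((gᘁ) ▷ X) ≫ T.map ((fᘁ) ▷ X) = 𝟙 (T.obj ((Xᘁ : C) ⊗ X)) := by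
  rw [← T.map_comp, ← comp_whiskerRight, ← comp_rightAdjointMate, h, rightAdjointMate_id,
    id_whiskerRight, T.map_id]

/-- The action of `T` on the left dual of the module `N`. -/
def act (N : T.Mod) : T.obj (N.Aᘁ : C) ⟶ (N.Aᘁ : C) := T.map (N.aᘁ) ≫ L.s N.A

lemma ev_linear (N : T.Mod) : T.map (ε_ N.A (N.Aᘁ)) ≫ η T.toFunctor =
    δ T.toFunctor (N.Aᘁ : C) N.A ≫ (L.act N ⊗ₘ N.a) ≫ ε_ N.A (N.Aᘁ) := by
  have h₁ := L.ev_eq N.A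
  have h₃ : T.map ((N.aᘁ) ▷ N.A) ≫ T.map ((T.η.app N.A)ᘁ ▷ N.A) = 𝟙 _ :=
    map_mate_section (T := T) (T.η.app N.A) N.a N.unit
  have h₄ : T.map (N.aᘁ) ≫ T.map ((T.μ.app N.A)ᘁ) ≫ L.s (T.obj N.A) = L.act N ≫ (N.aᘁ) := by
    have := L.naturality N.a
    rw [act, Category.assoc, ← this, ← T.map_comp_assoc, ← T.map_comp_assoc,
      ← comp_rightAdjointMate, N.assoc, ← comp_rightAdjointMate]
  have h₂ := (reassoc_of% h₃) (T.map (ε_ N.A (N.Aᘁ)) ≫ η T.toFunctor) |>.symm.trans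
    (congrArg (T.map ((N.aᘁ) ▷ N.A) ≫ ·) h₁)
  dsimp at h₂
  rw [h₂, ← δ_natural_left_assoc, ← comp_whiskerRight_assoc, h₄, comp_whiskerRight,
    Category.assoc, rightAdjointMate_comp_evaluation, MonoidalCategory.tensorHom_def, Category.assoc]

lemma coev_linear (N : T.Mod) : η T.toFunctor ≫ η_ N.A (N.Aᘁ) =
    T.map (η_ N.A (N.Aᘁ)) ≫ δ T.toFunctor N.A (N.Aᘁ : C) ≫ (N.a ⊗ₘ L.act N) := by
  have h₁ := L.coev_eq N.A
  have h₂ := congrArg (· ≫ N.a ▷ (N.Aᘁ : C)) h₁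
  have h₃ := coevaluation_comp_rightAdjointMate N.a
  dsimp at h₂
  simp only [Category.assoc, ← comp_whiskerRight, N.unit, id_whiskerRight, Category.comp_id] at h₂
  rw [h₂, tensorHom_comp_whiskerRight, N.assoc, ← whiskerRight_comp_tensorHom,
    δ_natural_left_assoc, ← T.map_comp_assoc, ← h₃, T.map_comp_assoc, ← δ_natural_right_assoc,
    whiskerLeft_comp_tensorHom, act]

/-- The left dual of a module over a bimonad with a left antipode. -/
abbrev dualMod (N : T.Mod) : T.Mod :=
  T.rightDualMod N (N.Aᘁ) (L.act N) (L.ev_linear N) (L.coev_linear N)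

end LeftAntipode

namespace RightAntipode

variable (R : T.RightAntipode)

/-- The mirror image of `LeftAntipode.map_mate_section`. -/
lemma map_mate_section {X Y : C} (f : X ⟶ Y) (g : Y ⟶ X) (h : f ≫ g = 𝟙 X) :
    T.map (X ◁ (ᘁg)) ≫ T.map (X ◁ (ᘁf)) = 𝟙 (T.obj (X ⊗ (ᘁX : C))) := by
  rw [← T.map_comp, ← MonoidalCategory.whiskerLeft_comp, ← comp_leftAdjointMate, h,
    leftAdjointMate_id, MonoidalCategory.whiskerLeft_id, T.map_id]

/-- The action of `T` on the right dual of the module `N`. -/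
def act (N : T.Mod) : T.obj (ᘁ(N.A) : C) ⟶ (ᘁ(N.A) : C) := T.map (ᘁ(N.a)) ≫ R.s N.A

lemma ev_linear (N : T.Mod) : T.map (ε_ (ᘁ(N.A)) N.A) ≫ η T.toFunctor =
    δ T.toFunctor N.A (ᘁ(N.A) : C) ≫ (N.a ⊗ₘ R.act N) ≫ ε_ (ᘁ(N.A)) N.A := by
  have h₁ := R.ev_eq N.A
  have h₃ : T.map (N.A ◁ (ᘁ(N.a))) ≫ T.map (N.A ◁ (ᘁ(T.η.app N.A))) = 𝟙 _ :=
    map_mate_section (T := T) (T.η.app N.A) N.a N.unit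
  have h₄ : T.map (ᘁ(N.a)) ≫ T.map (ᘁ(T.μ.app N.A)) ≫ R.s (T.obj N.A) = R.act N ≫ (ᘁ(N.a)) := by
    have := R.naturality N.a
    rw [act, Category.assoc, ← this, ← T.map_comp_assoc, ← T.map_comp_assoc,
      ← comp_leftAdjointMate, N.assoc, ← comp_leftAdjointMate]
  have h₂ := (reassoc_of% h₃) (T.map (ε_ (ᘁ(N.A)) N.A) ≫ η T.toFunctor) |>.symm.trans
    (congrArg (T.map (N.A ◁ (ᘁ(N.a))) ≫ ·) h₁)
  dsimp at h₂
  rw [h₂, ← δ_natural_right_assoc, ← MonoidalCategory.whiskerLeft_comp_assoc, h₄,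
    MonoidalCategory.whiskerLeft_comp, Category.assoc, leftAdjointMate_comp_evaluation,
    MonoidalCategory.tensorHom_def', Category.assoc]

lemma coev_linear (N : T.Mod) : η T.toFunctor ≫ η_ (ᘁ(N.A)) N.A =
    T.map (η_ (ᘁ(N.A)) N.A) ≫ δ T.toFunctor (ᘁ(N.A) : C) N.A ≫ (R.act N ⊗ₘ N.a) := by
  have h₁ := R.coev_eq N.A
  have h₂ := congrArg (· ≫ (ᘁ(N.A) : C) ◁ N.a) h₁
  have h₃ := coevaluation_comp_leftAdjointMate N.a
  simp only [Category.assoc, ← MonoidalCategory.whiskerLeft_comp, N.unit,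
    MonoidalCategory.whiskerLeft_id, Category.comp_id] at h₂
  rw [h₂, tensorHom_comp_whiskerLeft, N.assoc, ← whiskerLeft_comp_tensorHom,
    δ_natural_right_assoc, ← T.map_comp_assoc, ← h₃, T.map_comp_assoc, ← δ_natural_left_assoc,
    whiskerRight_comp_tensorHom, act]

/-- The right dual of a module over a bimonad with a right antipode. -/
abbrev dualMod (N : T.Mod) : T.Mod :=
  T.leftDualMod N (ᘁ(N.A)) (R.act N) (R.ev_linear N) (R.coev_linear N)

end RightAntipode

end Bimonad

namespace HopfMonad

variable {C : Type u} [Category.{v} C] [MonoidalCategory C] [RigidCategory C] (T : HopfMonad C)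

/-- Every `T`-module has a left dual. -/
instance exactPairingDualMod (N : T.Mod) : ExactPairing N (T.leftAntipode.dualMod N) :=
  letI : ExactPairing N.A (T.leftAntipode.dualMod N).A :=
    HasRightDual.exact (X := N.A)
  T.exactPairingMod N (T.leftAntipode.dualMod N)
    (T.leftAntipode.ev_linear N) (T.leftAntipode.coev_linear N)

/-- Every `T`-module has a right dual. -/
instance exactPairingDualMod' (N : T.Mod) : ExactPairing (T.rightAntipode.dualMod N) N :=
  letI : ExactPairing (T.rightAntipode.dualMod N).A N.A :=
    HasLeftDual.exact (Y := N.A)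
  T.exactPairingMod (T.rightAntipode.dualMod N) N
    (T.rightAntipode.ev_linear N) (T.rightAntipode.coev_linear N)

/-- `T`-linear forms on `N ⊗ T(V)` are forms on `N ⊗ V`: duality is compatible with the free
module functor. -/
lemma bijective_form (N : T.Mod) (V : C) :
    Function.Bijective fun χ : (N ⊗ T.toMonad.free.obj V ⟶ 𝟙_ T.Mod) =>
      ((N.A ◁ T.η.app V ≫ χ.f : N.A ⊗ V ⟶ 𝟙_ C)) := by
  let e₁ := tensorLeftHomEquiv (T.toMonad.free.obj V) (T.rightAntipode.dualMod N) N (𝟙_ T.Mod)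
  let e₂ := T.toMonad.adj.homEquiv V (T.rightAntipode.dualMod N ⊗ 𝟙_ T.Mod)
  let e₃ := (tensorLeftHomEquiv V (ᘁ(N.A) : C) N.A (𝟙_ C)).symm
  refine (congrArg Function.Bijective (funext fun χ => ?_)).mp ((e₁.trans e₂).trans e₃).bijective
  let f : N.A ⊗ T.obj V ⟶ 𝟙_ C := χ.f
  have h : e₂ (e₁ χ) = T.η.app V ≫ tensorLeftHomEquiv (T.obj V) (ᘁ(N.A) : C) N.A (𝟙_ C) f := by
    dsimp only [e₂]
    rw [Adjunction.homEquiv_unit]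
    have h₁ : T.toMonad.adj.unit.app V = T.η.app V := by
      rw [Monad.adj_unit]
    have hη : (η_ (T.rightAntipode.dualMod N) N).f = η_ (ᘁ(N.A) : C) N.A := rfl
    have h₂ : (e₁ χ).f = tensorLeftHomEquiv (T.obj V) (ᘁ(N.A) : C) N.A (𝟙_ C) f := by
      change (λ_ (T.obj V)).inv ≫ (η_ (T.rightAntipode.dualMod N) N).f ▷ T.obj V ≫
        (α_ (ᘁ(N.A) : C) N.A (T.obj V)).hom ≫ (ᘁ(N.A) : C) ◁ f = _
      rfl
    rw [h₁]
    exact congrArg (T.η.app V ≫ ·) h₂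
  change e₃ (e₂ (e₁ χ)) = N.A ◁ T.η.app V ≫ f
  rw [h]
  dsimp only [e₃]
  have := tensorLeftHomEquiv_symm_naturality (Y := (ᘁ(N.A) : C)) (Y' := N.A) (T.η.app V)
    (tensorLeftHomEquiv (T.obj V) (ᘁ(N.A) : C) N.A (𝟙_ C) f)
  rw [Equiv.symm_apply_apply] at this
  exact this

/-- Morphisms of `C` from a `T`-module to `W` are morphisms of modules to a dual of the free module
on a dual of `W`. -/
noncomputable def forgetHomEquiv (N : T.Mod) (W : C) : (N.A ⟶ W) ≃
    (N ⟶ 𝟙_ T.Mod ⊗ T.leftAntipode.dualMod (T.toMonad.free.obj (ᘁW : C))) :=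
  (((Iso.refl N.A).homCongr (λ_ W).symm).trans (tensorRightHomEquiv N.A (ᘁW : C) W (𝟙_ C)).symm).trans
    ((Equiv.ofBijective _ (T.bijective_form N (ᘁW : C))).symm.trans
      (tensorRightHomEquiv N (T.toMonad.free.obj (ᘁW : C)) _ (𝟙_ T.Mod)))

lemma forgetHomEquiv_naturality (N' N : T.Mod) (W : C) (f : N' ⟶ N) (g : N.A ⟶ W) :
    T.forgetHomEquiv N' W (f.f ≫ g) = f ≫ T.forgetHomEquiv N W g := by
  rw [← Equiv.eq_symm_apply]
  obtain ⟨h, rfl⟩ := (T.forgetHomEquiv N W).symm.surjective g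
  obtain ⟨χ, rfl⟩ := (tensorRightHomEquiv N (T.toMonad.free.obj (ᘁW : C)) _ (𝟙_ T.Mod)).surjective h
  rw [Equiv.apply_symm_apply]
  dsimp only [forgetHomEquiv, Equiv.symm_trans_apply, Equiv.symm_symm]
  rw [tensorRightHomEquiv_symm_naturality, Equiv.symm_apply_apply]
  let V : C := ᘁW
  let χ' : N.A ⊗ T.obj V ⟶ 𝟙_ C := χ.f
  change f.f ≫ 𝟙 _ ≫ tensorRightHomEquiv N.A V W (𝟙_ C) (N.A ◁ T.η.app V ≫ χ') ≫ (λ_ W).hom =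
    𝟙 _ ≫ tensorRightHomEquiv N'.A V W (𝟙_ C) (N'.A ◁ T.η.app V ≫ f.f ▷ T.obj V ≫ χ') ≫ (λ_ W).hom
  simp only [Category.id_comp, ← Category.assoc]
  congr 1
  rw [← Equiv.symm_apply_eq, tensorRightHomEquiv_symm_naturality, Equiv.symm_apply_apply,
    ← whisker_exchange_assoc]
  exact (Category.assoc _ _ _).symm

/-- The forgetful functor has a right adjoint, which sends `W` to `∨T(W∨)`, tensored with the unit
object, with the action dual to that of the free module. -/
instance isLeftAdjoint_forget : T.toMonad.forget.IsLeftAdjoint :=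
  ⟨_, ⟨Adjunction.adjunctionOfEquivRight (F := T.toMonad.forget) T.forgetHomEquiv
    (fun N' N W f g => T.forgetHomEquiv_naturality N' N W f g)⟩⟩

/-- A Hopf monad has a right adjoint, since the free module functor and the forgetful functor are
both left adjoints. -/
instance isLeftAdjoint_toFunctor : T.toFunctor.IsLeftAdjoint :=
  have : T.toMonad.free.IsLeftAdjoint := T.toMonad.adj.isLeftAdjoint
  Functor.isLeftAdjoint_comp (F := T.toMonad.free) (G := T.toMonad.forget)

end HopfMonad

/-! ### Detecting families -/

section Detecting

variable {C : Type u} [Category.{v} C] [MonoidalCategory C]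

/-- A family `k i : A i ⟶ N i ⊗ B` is detecting if morphisms out of `B` are determined by what they
do after the `k i`. When the `N i` have duals this says that the transposes of the `k i` are jointly
epimorphic. -/
def IsDetecting {I : Type*} {A N : I → C} {B : C} (k : ∀ i, A i ⟶ N i ⊗ B) : Prop :=
  ∀ ⦃W : C⦄ (f g : B ⟶ W), (∀ i, k i ≫ N i ◁ f = k i ≫ N i ◁ g) → f = g

lemma tensorLeftHomEquiv_symm_comp_whiskerLeft {X Y Y' W W' : C} [ExactPairing Y Y']
    (k : X ⟶ Y ⊗ W) (g : W ⟶ W') :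
    (tensorLeftHomEquiv X Y Y' W').symm (k ≫ Y ◁ g) =
      (tensorLeftHomEquiv X Y Y' W).symm k ≫ g := by
  rw [Equiv.symm_apply_eq, tensorLeftHomEquiv_naturality, Equiv.apply_symm_apply]

/-- Transposition is dinatural in the object which is dualized. -/
lemma tensorLeftHomEquiv_symm_comp_whiskerRight {X Y Y' W : C} [HasRightDual Y] [HasRightDual Y']
    (k : X ⟶ Y ⊗ W) (f : Y ⟶ Y') :
    (tensorLeftHomEquiv X Y' (Y'ᘁ) W).symm (k ≫ f ▷ W) =
      (fᘁ) ▷ X ≫ (tensorLeftHomEquiv X Y (Yᘁ) W).symm k := by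
  have h := rightAdjointMate_comp_evaluation f
  dsimp [tensorLeftHomEquiv]
  calc _ = (Y'ᘁ : C) ◁ k ⊗≫ ((Y'ᘁ : C) ◁ f ≫ ε_ Y' (Y'ᘁ)) ▷ W ⊗≫ 𝟙 _ := by monoidal
    _ = ((Y'ᘁ : C) ◁ k ≫ (fᘁ) ▷ (Y ⊗ W)) ⊗≫ ε_ Y (Yᘁ) ▷ W ⊗≫ 𝟙 _ := by rw [← h]; monoidal
    _ = _ := by rw [whisker_exchange]; monoidal

lemma comp_whiskerLeft_tensorRightHomEquiv {A N B X W : C} [HasRightDual X]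
    (k : A ⟶ N ⊗ B) (f : B ⊗ X ⟶ W) :
    k ≫ N ◁ tensorRightHomEquiv B X (Xᘁ) W f =
      tensorRightHomEquiv A X (Xᘁ) (N ⊗ W) (k ▷ X ≫ (α_ _ _ _).hom ≫ N ◁ f) ≫
        (α_ _ _ _).hom := by
  dsimp [tensorRightHomEquiv]
  calc _ = 𝟙 _ ⊗≫ (k ▷ 𝟙_ C ≫ (N ⊗ B) ◁ η_ X (Xᘁ)) ⊗≫ N ◁ f ▷ (Xᘁ : C) := by monoidal
    _ = _ := by rw [← whisker_exchange]; monoidal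

/-- Detecting families stay detecting after tensoring with an object which has a dual. -/
lemma IsDetecting.whiskerRight {I : Type*} {A N : I → C} {B : C} {k : ∀ i, A i ⟶ N i ⊗ B}
    (hk : IsDetecting k) (X : C) [HasRightDual X] :
    IsDetecting (fun i => k i ▷ X ≫ (α_ (N i) B X).hom) := by
  intro W f g h
  apply (tensorRightHomEquiv B X (Xᘁ) W).injective
  apply hk
  intro i
  have h' := h i
  simp only [Category.assoc] at h'
  rw [comp_whiskerLeft_tensorRightHomEquiv, comp_whiskerLeft_tensorRightHomEquiv, h']

end Detecting

namespace Bimonad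

variable {C : Type u} [Category.{v} C] [MonoidalCategory C] (T : Bimonad C)

/-- The `T`-linear extension `T(A) ⟶ N ⊗ T(B)` of `k : A ⟶ N ⊗ B` along the action of `T` on the
module `N`. -/
def extend (N : T.Mod) {A B : C} (k : A ⟶ N.A ⊗ B) : T.obj A ⟶ N.A ⊗ T.obj B :=
  T.map k ≫ δ T.toFunctor N.A B ≫ N.a ▷ T.obj B

variable {T}

lemma extend_comp_whiskerLeft_map (N : T.Mod) {A B B' : C} (k : A ⟶ N.A ⊗ B) (f : B ⟶ B') :
    T.extend N k ≫ N.A ◁ T.map f = T.extend N (k ≫ N.A ◁ f) := by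
  have h := δ_natural_right T.toFunctor N.A f
  simp only [extend, Functor.map_comp, Category.assoc]
  rw [← whisker_exchange, reassoc_of% h]

lemma map_comp_extend (N : T.Mod) {A A' B : C} (f : A ⟶ A') (k : A' ⟶ N.A ⊗ B) :
    T.map f ≫ T.extend N k = T.extend N (f ≫ k) := by
  simp [extend]

lemma unit_extend (N : T.Mod) {A B : C} (k : A ⟶ N.A ⊗ B) :
    T.η.app A ≫ T.extend N k = k ≫ N.A ◁ T.η.app B := by
  have h₁ := T.η.naturality k
  have h₂ := T.unit_comul N.A B
  have h₃ : (T.η.app N.A ≫ N.a) ▷ T.obj B = 𝟙 (N.A ⊗ T.obj B) := by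
    rw [N.unit]; exact id_whiskerRight _ _
  dsimp at h₁
  rw [extend, ← reassoc_of% h₁, reassoc_of% h₂, tensorHom_comp_whiskerRight,
    MonoidalCategory.tensorHom_def', h₃]
  exact congrArg (k ≫ ·) (Category.comp_id _)

lemma mul_extend (N : T.Mod) {A B : C} (k : A ⟶ N.A ⊗ B) :
    T.μ.app A ≫ T.extend N k = T.extend N (T.extend N k) ≫ N.A ◁ T.μ.app B := by
  have h₁ := T.μ.naturality k
  have h₂ := T.mul_comul N.A B
  have h₃ := N.assoc
  have h₄ := δ_natural_left T.toFunctor N.a (T.obj B)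
  dsimp at h₁
  simp only [extend, Functor.map_comp, Category.assoc]
  rw [← reassoc_of% h₁, reassoc_of% h₂, tensorHom_comp_whiskerRight, h₃, ← reassoc_of% h₄,
    MonoidalCategory.tensorHom_def, comp_whiskerRight, Category.assoc]

variable [RigidCategory C]

/-- Linearity of evaluation lets `T` pass the transposition of `k`. -/
lemma LeftAntipode.map_transpose (L : T.LeftAntipode) (N : T.Mod) {A B : C} (k : A ⟶ N.A ⊗ B) :
    T.map ((tensorLeftHomEquiv A N.A (N.Aᘁ) B).symm k) =
      δ T.toFunctor (N.Aᘁ : C) A ≫ L.act N ▷ T.obj A ≫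
        (tensorLeftHomEquiv (T.obj A) N.A (N.Aᘁ) (T.obj B)).symm (T.extend N k) := by
  have h₁ := congrArg (· ▷ T.obj B) (L.ev_linear N)
  simp only [comp_whiskerRight] at h₁
  have h₂ := left_unitality_hom T.toFunctor B
  have h₃ : T.map (α_ (N.Aᘁ : C) N.A B).inv ≫ δ T.toFunctor ((N.Aᘁ : C) ⊗ N.A) B ≫
      δ T.toFunctor (N.Aᘁ : C) N.A ▷ T.obj B =
        δ T.toFunctor (N.Aᘁ : C) (N.A ⊗ B) ≫ T.obj (N.Aᘁ : C) ◁ δ T.toFunctor N.A B ≫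
          (α_ _ _ _).inv := by
    rw [← cancel_mono (α_ _ _ _).hom, ← cancel_epi (T.map (α_ (N.Aᘁ : C) N.A B).hom)]
    simp
  dsimp [tensorLeftHomEquiv]
  simp only [Functor.map_comp]
  rw [← h₂, ← δ_natural_left_assoc, reassoc_of% h₁, reassoc_of% h₃, ← δ_natural_right_assoc]
  congr 1
  calc _ = T.obj (N.Aᘁ : C) ◁ (T.map k ≫ δ T.toFunctor N.A B) ⊗≫
        (L.act N ⊗ₘ N.a) ▷ T.obj B ≫ ε_ N.A (N.Aᘁ) ▷ T.obj B ⊗≫ 𝟙 _ := by monoidal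
    _ = (T.obj (N.Aᘁ : C) ◁ (T.map k ≫ δ T.toFunctor N.A B) ≫
          L.act N ▷ (T.obj N.A ⊗ T.obj B)) ⊗≫
        (N.Aᘁ : C) ◁ N.a ▷ T.obj B ⊗≫ ε_ N.A (N.Aᘁ) ▷ T.obj B ⊗≫ 𝟙 _ := by
      rw [MonoidalCategory.tensorHom_def]; monoidal
    _ = _ := by rw [whisker_exchange, extend]; monoidal

/-- Linearity of coevaluation recovers `x` from its `T`-linear transpose. -/
lemma LeftAntipode.transpose_linear_injective (L : T.LeftAntipode) (N : T.Mod) {A W : C}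
    (x : T.obj A ⟶ N.A ⊗ W) :
    T.map ((λ_ A).inv ≫ η_ N.A (N.Aᘁ) ▷ A ≫ (α_ _ _ _).hom) ≫
      δ T.toFunctor N.A ((N.Aᘁ : C) ⊗ A) ≫
      (N.a ⊗ₘ (δ T.toFunctor (N.Aᘁ : C) A ≫ L.act N ▷ T.obj A ≫
        (tensorLeftHomEquiv (T.obj A) N.A (N.Aᘁ) W).symm x)) = x := by
  have h₁ := congrArg (· ▷ T.obj A) (L.coev_linear N)
  simp only [comp_whiskerRight] at h₁
  have h₃ := oplax_associativity T.toFunctor N.A (N.Aᘁ : C) A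
  have h₄ := oplax_left_unitality T.toFunctor A
  rw [← whiskerLeft_comp_tensorHom]
  simp only [Functor.map_comp, Category.assoc]
  rw [← reassoc_of% h₃, ← δ_natural_left_assoc]
  have h₅ : T.map (η_ N.A (N.Aᘁ)) ▷ T.obj A ≫ δ T.toFunctor N.A (N.Aᘁ : C) ▷ T.obj A ≫
      (α_ _ _ _).hom ≫ (N.a ⊗ₘ (L.act N ▷ T.obj A ≫
        (tensorLeftHomEquiv (T.obj A) N.A (N.Aᘁ) W).symm x)) =
      η T.toFunctor ▷ T.obj A ≫ η_ N.A (N.Aᘁ) ▷ T.obj A ≫ (α_ _ _ _).hom ≫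
        N.A ◁ (tensorLeftHomEquiv (T.obj A) N.A (N.Aᘁ) W).symm x := by
    rw [reassoc_of% h₁]
    congr 2
    rw [MonoidalCategory.tensorHom_def, MonoidalCategory.tensorHom_def]
    monoidal
  rw [h₅, ← reassoc_of% h₄]
  exact (tensorLeftHomEquiv (T.obj A) N.A (N.Aᘁ) W).apply_symm_apply x

end Bimonad

namespace Bimonad

variable {C : Type u} [Category.{v} C] [MonoidalCategory C] [RigidCategory C] {T : Bimonad C}

lemma LeftAntipode.act_naturality (L : T.LeftAntipode) {N N' : T.Mod} (f : N ⟶ N') :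
    T.map ((f.f)ᘁ) ≫ L.act N = L.act N' ≫ ((f.f)ᘁ) := by
  rw [LeftAntipode.act, LeftAntipode.act, Category.assoc, ← L.naturality, ← T.map_comp_assoc,
    ← T.map_comp_assoc, ← comp_rightAdjointMate, ← comp_rightAdjointMate, f.h]

end Bimonad

namespace HopfMonad

variable {C : Type u} [Category.{v} C] [MonoidalCategory C] [RigidCategory C] (T : HopfMonad C)

/-- A Hopf monad preserves detecting families: up to the transposition, `T.extend` is `T` of the
transposed family, and `T` has a right adjoint. -/
lemma isDetecting_extend {I : Type*} {A : I → C} {N : I → T.Mod} {B : C}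
    {k : ∀ i, A i ⟶ (N i).A ⊗ B} (hk : IsDetecting (N := fun i => (N i).A) k) :
    IsDetecting (N := fun i => (N i).A) (fun i => T.extend (N i) (k i)) := by
  intro W f g h
  let adj := Adjunction.ofIsLeftAdjoint T.toFunctor
  apply (adj.homEquiv B W).injective
  apply hk
  intro i
  apply (tensorLeftHomEquiv (A i) (N i).A ((N i).Aᘁ) _).symm.injective
  have h' := h i
  dsimp only at h' ⊢
  rw [tensorLeftHomEquiv_symm_comp_whiskerLeft, tensorLeftHomEquiv_symm_comp_whiskerLeft,
    ← adj.homEquiv_naturality_left, ← adj.homEquiv_naturality_left,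
    T.leftAntipode.map_transpose]
  simp only [Category.assoc]
  rw [← tensorLeftHomEquiv_symm_comp_whiskerLeft, ← tensorLeftHomEquiv_symm_comp_whiskerLeft, h']

end HopfMonad

namespace Centralizer

variable {C : Type u} [Category.{v} C] [MonoidalCategory C]

section

variable {T : C ⥤ C} (Z : Centralizer T)

lemma naturality_left {X X' : C} (f : X ⟶ X') (Y : C) :
    f ▷ Y ≫ Z.del X' Y = Z.del X Y ≫ T.obj Y ◁ Z.Z.map f := by
  simpa using Z.naturality f (𝟙 Y)

lemma naturality_right (X : C) {Y Y' : C} (g : Y ⟶ Y') :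
    X ◁ g ≫ Z.del X Y' = Z.del X Y ≫ T.map g ▷ Z.Z.obj X := by
  simpa using Z.naturality (𝟙 X) g

/-- Uniqueness of factorizations through `∂`. -/
lemma isDetecting (X : C) : IsDetecting (Z.del X) := by
  intro W f g h
  obtain ⟨r, -, hr⟩ := Z.existsUnique_factor X W
    { app := fun Y => Z.del X Y ≫ T.obj Y ◁ f
      naturality := fun Y Y' k => by
        simp [reassoc_of% naturality_right, whisker_exchange] }
  exact (hr f fun Y => rfl).trans (hr g fun Y => h Y).symm

lemma exists_factor (X W : C) (ξ : ∀ Y, X ⊗ Y ⟶ T.obj Y ⊗ W)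
    (hξ : ∀ {Y Y' : C} (g : Y ⟶ Y'), X ◁ g ≫ ξ Y' = ξ Y ≫ T.map g ▷ W) :
    ∃ r : Z.Z.obj X ⟶ W, ∀ Y, Z.del X Y ≫ T.obj Y ◁ r = ξ Y := by
  obtain ⟨r, h, -⟩ := Z.existsUnique_factor X W
    { app := ξ
      naturality := fun Y Y' g => hξ g }
  exact ⟨r, fun Y => (h Y).symm⟩

/-- The universal property of `∂` persists after tensoring with an object which has a dual. -/
lemma exists_factor_whiskerRight (X B W : C) [HasRightDual B] (ξ : ∀ Y, (X ⊗ Y) ⊗ B ⟶ T.obj Y ⊗ W)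
    (hξ : ∀ {Y Y' : C} (g : Y ⟶ Y'), (X ◁ g) ▷ B ≫ ξ Y' = ξ Y ≫ T.map g ▷ W) :
    ∃ r : Z.Z.obj X ⊗ B ⟶ W, ∀ Y,
      Z.del X Y ▷ B ≫ (α_ _ _ _).hom ≫ T.obj Y ◁ r = ξ Y := by
  obtain ⟨r, hr⟩ := Z.exists_factor X (W ⊗ (Bᘁ : C))
    (fun Y => tensorRightHomEquiv (X ⊗ Y) B (Bᘁ) (T.obj Y ⊗ W) (ξ Y) ≫ (α_ _ _ _).hom) (by
      intro Y Y' g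
      have h := tensorRightHomEquiv_naturality (Y' := (Bᘁ : C)) (ξ Y) (T.map g ▷ W)
      have h' := tensorRightHomEquiv_symm_naturality (Y := B) (Y' := (Bᘁ : C)) (X ◁ g)
        (tensorRightHomEquiv (X ⊗ Y') B (Bᘁ) (T.obj Y' ⊗ W) (ξ Y'))
      rw [Equiv.symm_apply_apply, Equiv.symm_apply_eq] at h'
      rw [reassoc_of% h', hξ, h]
      simp)
  refine ⟨(tensorRightHomEquiv _ B (Bᘁ) W).symm r, fun Y => ?_⟩
  apply (tensorRightHomEquiv (X ⊗ Y) B (Bᘁ) (T.obj Y ⊗ W)).injective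
  rw [← cancel_mono (α_ _ _ _).hom, ← comp_whiskerLeft_tensorRightHomEquiv,
    Equiv.apply_symm_apply, hr]

end

end Centralizer

namespace HopfMonad

variable {C : Type u} [Category.{v} C] [MonoidalCategory C] [RigidCategory C] (T : HopfMonad C)

/-- A family `k j : S(j) ⟶ F(j) ⊗ B` through which all natural families `S(j) ⟶ F(j) ⊗ W` factor,
where the `F(j)` are `T`-modules, extends to such a family `T(S(j)) ⟶ F(j) ⊗ T(B)`. -/
lemma exists_factor_extend {J : Type*} [Category* J] (S : J ⥤ C) (F : J ⥤ T.Mod) {B : C}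
    (k : ∀ j, S.obj j ⟶ (F.obj j).A ⊗ B)
    (hk : ∀ (W : C) (ξ : ∀ j, S.obj j ⟶ (F.obj j).A ⊗ W),
      (∀ {j j' : J} (g : j ⟶ j'), S.map g ≫ ξ j' = ξ j ≫ (F.map g).f ▷ W) →
        ∃ r : B ⟶ W, ∀ j, k j ≫ (F.obj j).A ◁ r = ξ j)
    (W : C) (ξ : ∀ j, T.obj (S.obj j) ⟶ (F.obj j).A ⊗ W)
    (hξ : ∀ {j j' : J} (g : j ⟶ j'), T.map (S.map g) ≫ ξ j' = ξ j ≫ (F.map g).f ▷ W) :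
    ∃ r : T.obj B ⟶ W, ∀ j, T.extend (F.obj j) (k j) ≫ (F.obj j).A ◁ r = ξ j := by
  let adj := Adjunction.ofIsLeftAdjoint T.toFunctor
  let L := T.leftAntipode
  let ξ' (j : J) : T.obj (((F.obj j).Aᘁ : C) ⊗ S.obj j) ⟶ W :=
    δ T.toFunctor ((F.obj j).Aᘁ : C) (S.obj j) ≫ L.act (F.obj j) ▷ T.obj (S.obj j) ≫
      (tensorLeftHomEquiv (T.obj (S.obj j)) (F.obj j).A ((F.obj j).Aᘁ) W).symm (ξ j)
  have hξ' {j j' : J} (g : j ⟶ j') : T.map (((F.obj j').Aᘁ : C) ◁ S.map g) ≫ ξ' j' =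
      T.map ((((F.map g).f)ᘁ) ▷ S.obj j) ≫ ξ' j := by
    have h₁ := L.act_naturality (F.map g)
    dsimp only [ξ']
    rw [← δ_natural_right_assoc, ← δ_natural_left_assoc, ← comp_whiskerRight_assoc, h₁,
      whisker_exchange_assoc, ← tensorLeftHomEquiv_symm_naturality, hξ,
      tensorLeftHomEquiv_symm_comp_whiskerRight, comp_whiskerRight_assoc]
  obtain ⟨r, hr⟩ := hk (T.toFunctor.rightAdjoint.obj W)
    (fun j => tensorLeftHomEquiv _ (F.obj j).A ((F.obj j).Aᘁ) _ (adj.homEquiv _ _ (ξ' j))) (by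
      intro j j' g
      apply (tensorLeftHomEquiv _ (F.obj j').A ((F.obj j').Aᘁ) _).symm.injective
      rw [tensorLeftHomEquiv_symm_naturality, tensorLeftHomEquiv_symm_comp_whiskerRight,
        Equiv.symm_apply_apply, Equiv.symm_apply_apply, ← adj.homEquiv_naturality_left,
        ← adj.homEquiv_naturality_left, hξ'])
  refine ⟨(adj.homEquiv _ _).symm r, fun j => ?_⟩
  have h₁ := hr j
  rw [← Equiv.symm_apply_eq, tensorLeftHomEquiv_symm_comp_whiskerLeft, ← Equiv.symm_apply_eq,
    adj.homEquiv_naturality_left_symm, L.map_transpose, Category.assoc, Category.assoc,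
    ← tensorLeftHomEquiv_symm_comp_whiskerLeft] at h₁
  rw [← L.transpose_linear_injective (F.obj j) (_ ≫ (F.obj j).A ◁ _), h₁]
  exact L.transpose_linear_injective (F.obj j) (ξ j)

end HopfMonad

/-! ### The centralizer of a bimonad is a bimonad -/

namespace Bimonad

variable {C : Type u} [Category.{v} C] [MonoidalCategory C] (T : Bimonad C)

/-- The product of `T` at `X`, with source `T(T(X))` on the nose. -/
def mu (X : C) : T.obj (T.obj X) ⟶ T.obj X := T.μ.app X

/-- The unit of `T` at `X`, with source `X` on the nose. -/
def eta (X : C) : X ⟶ T.obj X := T.η.app X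

lemma mu_naturality {X Y : C} (f : X ⟶ Y) : T.map (T.map f) ≫ T.mu Y = T.mu X ≫ T.map f :=
  T.μ.naturality f

lemma eta_naturality {X Y : C} (f : X ⟶ Y) : f ≫ T.eta Y = T.eta X ≫ T.map f := T.η.naturality f

lemma mu_assoc (X : C) : T.map (T.mu X) ≫ T.mu X = T.mu (T.obj X) ≫ T.mu X := T.assoc X

lemma eta_mu (X : C) : T.eta (T.obj X) ≫ T.mu X = 𝟙 (T.obj X) := T.left_unit X

lemma map_eta_mu (X : C) : T.map (T.eta X) ≫ T.mu X = 𝟙 (T.obj X) := T.right_unit X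

lemma mu_comul (X Y : C) : T.mu (X ⊗ Y) ≫ δ T.toFunctor X Y =
    T.map (δ T.toFunctor X Y) ≫ δ T.toFunctor (T.obj X) (T.obj Y) ≫ (T.mu X ⊗ₘ T.mu Y) :=
  T.mul_comul X Y

lemma mu_counit : T.mu (𝟙_ C) ≫ η T.toFunctor = T.map (η T.toFunctor) ≫ η T.toFunctor :=
  T.mul_counit

lemma eta_comul (X Y : C) : T.eta (X ⊗ Y) ≫ δ T.toFunctor X Y = (T.eta X ⊗ₘ T.eta Y) :=
  T.unit_comul X Y

lemma eta_counit : T.eta (𝟙_ C) ≫ η T.toFunctor = 𝟙 (𝟙_ C) := T.unit_counit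

end Bimonad

namespace Centralizer

variable {C : Type u} [Category.{v} C] [MonoidalCategory C] [RigidCategory C]

section

variable {T : C ⥤ C} (Z : Centralizer T)

omit [RigidCategory C] in
lemma hom_ext {X W : C} {f g : Z.Z.obj X ⟶ W}
    (h : ∀ Y, Z.del X Y ≫ T.obj Y ◁ f = Z.del X Y ≫ T.obj Y ◁ g) : f = g :=
  Z.isDetecting X f g h

lemma hom_ext₂ {X W : C} {f g : Z.Z.obj (Z.Z.obj X) ⟶ W}
    (h : ∀ Y₁ Y₂, Z.del X Y₁ ▷ Y₂ ⊗≫ T.obj Y₁ ◁ Z.del (Z.Z.obj X) Y₂ ≫ T.obj Y₁ ◁ T.obj Y₂ ◁ f =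
      Z.del X Y₁ ▷ Y₂ ⊗≫ T.obj Y₁ ◁ Z.del (Z.Z.obj X) Y₂ ≫ T.obj Y₁ ◁ T.obj Y₂ ◁ g) : f = g := by
  refine Z.hom_ext fun Y₂ => (Z.isDetecting X).whiskerRight Y₂ _ _ fun Y₁ => ?_
  have h' := h Y₁ Y₂
  dsimp only
  calc _ = _ := ?_
    _ = _ := h'
    _ = _ := ?_
  all_goals monoidal

lemma hom_ext₃ {X W : C} {f g : Z.Z.obj (Z.Z.obj (Z.Z.obj X)) ⟶ W}
    (h : ∀ Y₁ Y₂ Y₃, Z.del X Y₁ ▷ Y₂ ▷ Y₃ ⊗≫ T.obj Y₁ ◁ Z.del (Z.Z.obj X) Y₂ ▷ Y₃ ⊗≫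
        T.obj Y₁ ◁ T.obj Y₂ ◁ (Z.del (Z.Z.obj (Z.Z.obj X)) Y₃ ≫ T.obj Y₃ ◁ f) =
      Z.del X Y₁ ▷ Y₂ ▷ Y₃ ⊗≫ T.obj Y₁ ◁ Z.del (Z.Z.obj X) Y₂ ▷ Y₃ ⊗≫
        T.obj Y₁ ◁ T.obj Y₂ ◁ (Z.del (Z.Z.obj (Z.Z.obj X)) Y₃ ≫ T.obj Y₃ ◁ g)) : f = g := by
  refine Z.hom_ext₂ fun Y₂ Y₃ =>
    ((Z.isDetecting X).whiskerRight Y₂).whiskerRight Y₃ _ _ fun Y₁ => ?_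
  have h' := h Y₁ Y₂ Y₃
  dsimp only
  calc _ = _ := ?_
    _ = _ := h'
    _ = _ := ?_
  all_goals monoidal

end

variable {T : Bimonad C} (Z : Centralizer T.toFunctor)

/-- Existence of the product: the universal property is used once for each of the two variables. -/
lemma exists_mul (X : C) : ∃ m : Z.Z.obj (Z.Z.obj X) ⟶ Z.Z.obj X, ∀ Y₁ Y₂ : C,
    Z.del X Y₁ ▷ Y₂ ≫ (α_ (T.obj Y₁) (Z.Z.obj X) Y₂).hom ≫
        T.obj Y₁ ◁ Z.del (Z.Z.obj X) Y₂ ≫ T.obj Y₁ ◁ T.obj Y₂ ◁ m =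
      (α_ X Y₁ Y₂).hom ≫ Z.del X (Y₁ ⊗ Y₂) ≫ δ T.toFunctor Y₁ Y₂ ▷ Z.Z.obj X ≫
        (α_ (T.obj Y₁) (T.obj Y₂) (Z.Z.obj X)).hom := by
  have h₁ (Y₂ : C) := Z.exists_factor_whiskerRight X Y₂ (T.obj Y₂ ⊗ Z.Z.obj X)
    (fun Y₁ => (α_ X Y₁ Y₂).hom ≫ Z.del X (Y₁ ⊗ Y₂) ≫ δ T.toFunctor Y₁ Y₂ ▷ Z.Z.obj X ≫
        (α_ (T.obj Y₁) (T.obj Y₂) (Z.Z.obj X)).hom) (by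
      intro Y Y' g
      have h := congrArg (· ▷ Z.Z.obj X) (δ_natural_left T.toFunctor g Y₂)
      simp only [comp_whiskerRight] at h
      simp only [Category.assoc]
      rw [associator_naturality_middle_assoc, reassoc_of% naturality_right, ← reassoc_of% h]
      simp)
  choose r hr using h₁
  obtain ⟨m, hm⟩ := Z.exists_factor (Z.Z.obj X) (Z.Z.obj X) r (by
    intro Y Y' g
    refine (Z.isDetecting X).whiskerRight Y _ _ fun Y₁ => ?_
    have h := congrArg (· ▷ Z.Z.obj X) (δ_natural_right T.toFunctor Y₁ g)
    simp only [comp_whiskerRight] at h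
    have e₁ := hr Y Y₁
    have e₂ := hr Y' Y₁
    simp only [Category.assoc, MonoidalCategory.whiskerLeft_comp]
    rw [reassoc_of% e₁, ← associator_naturality_right_assoc, ← whisker_exchange_assoc, e₂,
      associator_naturality_right_assoc, reassoc_of% naturality_right, ← reassoc_of% h]
    simp)
  refine ⟨m, fun Y₁ Y₂ => ?_⟩
  rw [← hr, ← hm, MonoidalCategory.whiskerLeft_comp]

lemma mul_naturality (m : ∀ X, Z.Z.obj (Z.Z.obj X) ⟶ Z.Z.obj X)
    (hm : ∀ X Y₁ Y₂, Z.del X Y₁ ▷ Y₂ ≫ (α_ (T.obj Y₁) (Z.Z.obj X) Y₂).hom ≫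
        T.obj Y₁ ◁ Z.del (Z.Z.obj X) Y₂ ≫ T.obj Y₁ ◁ T.obj Y₂ ◁ m X =
      (α_ X Y₁ Y₂).hom ≫ Z.del X (Y₁ ⊗ Y₂) ≫ δ T.toFunctor Y₁ Y₂ ▷ Z.Z.obj X ≫
        (α_ (T.obj Y₁) (T.obj Y₂) (Z.Z.obj X)).hom) {X X' : C} (f : X ⟶ X') :
    Z.Z.map (Z.Z.map f) ≫ m X' = m X ≫ Z.Z.map f := by
  refine Z.hom_ext₂ fun Y₁ Y₂ => ?_
  calc _ = Z.del X Y₁ ▷ Y₂ ⊗≫ T.obj Y₁ ◁ (Z.del (Z.Z.obj X) Y₂ ≫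
          T.obj Y₂ ◁ Z.Z.map (Z.Z.map f)) ⊗≫ T.obj Y₁ ◁ T.obj Y₂ ◁ m X' := by monoidal
    _ = (Z.del X Y₁ ≫ T.obj Y₁ ◁ Z.Z.map f) ▷ Y₂ ⊗≫ T.obj Y₁ ◁ Z.del (Z.Z.obj X') Y₂ ⊗≫
          T.obj Y₁ ◁ T.obj Y₂ ◁ m X' := by rw [← naturality_left]; monoidal
    _ = (f ▷ Y₁) ▷ Y₂ ≫ (Z.del X' Y₁ ▷ Y₂ ≫ (α_ (T.obj Y₁) (Z.Z.obj X') Y₂).hom ≫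
          T.obj Y₁ ◁ Z.del (Z.Z.obj X') Y₂ ≫ T.obj Y₁ ◁ T.obj Y₂ ◁ m X') := by
      rw [← naturality_left]; monoidal
    _ = 𝟙 _ ⊗≫ (f ▷ (Y₁ ⊗ Y₂) ≫ Z.del X' (Y₁ ⊗ Y₂)) ≫ δ T.toFunctor Y₁ Y₂ ▷ Z.Z.obj X' ⊗≫ 𝟙 _ := by
      rw [hm]; monoidal
    _ = 𝟙 _ ⊗≫ Z.del X (Y₁ ⊗ Y₂) ≫ (T.obj (Y₁ ⊗ Y₂) ◁ Z.Z.map f ≫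
          δ T.toFunctor Y₁ Y₂ ▷ Z.Z.obj X') ⊗≫ 𝟙 _ := by
      rw [naturality_left]; monoidal
    _ = ((α_ X Y₁ Y₂).hom ≫ Z.del X (Y₁ ⊗ Y₂) ≫ δ T.toFunctor Y₁ Y₂ ▷ Z.Z.obj X ≫
        (α_ (T.obj Y₁) (T.obj Y₂) (Z.Z.obj X)).hom) ≫ T.obj Y₁ ◁ T.obj Y₂ ◁ Z.Z.map f := by
      rw [whisker_exchange]; monoidal
    _ = _ := by rw [← hm]; monoidal

omit [RigidCategory C] in
lemma exists_comul (X₁ X₂ : C) : ∃ c : Z.Z.obj (X₁ ⊗ X₂) ⟶ Z.Z.obj X₁ ⊗ Z.Z.obj X₂, ∀ Y : C,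
    Z.del (X₁ ⊗ X₂) Y ≫ T.obj Y ◁ c =
      (α_ X₁ X₂ Y).hom ≫ X₁ ◁ Z.del X₂ Y ≫ (α_ X₁ (T.obj Y) (Z.Z.obj X₂)).inv ≫
        Z.del X₁ (T.obj Y) ▷ Z.Z.obj X₂ ≫
          (α_ (T.obj (T.obj Y)) (Z.Z.obj X₁) (Z.Z.obj X₂)).hom ≫
            T.mu Y ▷ (Z.Z.obj X₁ ⊗ Z.Z.obj X₂) := by
  refine Z.exists_factor (X₁ ⊗ X₂) _ _ ?_
  intro Y Y' g
  have h : T.map (T.map g) ≫ T.mu Y' = T.mu Y ≫ T.map g := T.mu_naturality g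
  calc _ = 𝟙 _ ⊗≫ X₁ ◁ (X₂ ◁ g ≫ Z.del X₂ Y') ⊗≫ Z.del X₁ (T.obj Y') ▷ Z.Z.obj X₂ ⊗≫
            T.mu Y' ▷ (Z.Z.obj X₁ ⊗ Z.Z.obj X₂) := by monoidal
    _ = 𝟙 _ ⊗≫ X₁ ◁ Z.del X₂ Y ⊗≫ (X₁ ◁ T.map g ≫ Z.del X₁ (T.obj Y')) ▷ Z.Z.obj X₂ ⊗≫
            T.mu Y' ▷ (Z.Z.obj X₁ ⊗ Z.Z.obj X₂) := by rw [naturality_right]; monoidal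
    _ = 𝟙 _ ⊗≫ X₁ ◁ Z.del X₂ Y ⊗≫ Z.del X₁ (T.obj Y) ▷ Z.Z.obj X₂ ⊗≫
            (T.map (T.map g) ≫ T.mu Y') ▷ (Z.Z.obj X₁ ⊗ Z.Z.obj X₂) := by
      rw [naturality_right]; monoidal
    _ = _ := by rw [h]; monoidal

omit [RigidCategory C] in
lemma exists_counit : ∃ c : Z.Z.obj (𝟙_ C) ⟶ 𝟙_ C, ∀ Y : C,
    Z.del (𝟙_ C) Y ≫ T.obj Y ◁ c = (λ_ Y).hom ≫ T.eta Y ≫ (ρ_ (T.obj Y)).inv := by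
  refine Z.exists_factor (𝟙_ C) _ (fun Y => (λ_ Y).hom ≫ T.eta Y ≫ (ρ_ (T.obj Y)).inv) ?_
  intro Y Y' g
  have h := T.eta_naturality g
  rw [leftUnitor_naturality_assoc, reassoc_of% h]
  simp

variable {Z}

/-- The defining relations determine the structural morphisms. -/
theorem Structure.eq (S S' : Z.Structure) : S = S' := by
  have h₁ : S.mul = S'.mul := by
    ext X
    refine Z.hom_ext₂ fun Y₁ Y₂ => ?_
    simpa [monoidalComp] using (S.mul_spec X Y₁ Y₂).trans (S'.mul_spec X Y₁ Y₂).symm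
  have h₂ : S.unit = S'.unit := by
    ext X
    exact (S.unit_spec X).trans (S'.unit_spec X).symm
  have h₃ : S.comul = S'.comul := by
    funext X₁ X₂
    exact Z.hom_ext fun Y => (S.comul_spec X₁ X₂ Y).trans (S'.comul_spec X₁ X₂ Y).symm
  have h₄ : S.counit = S'.counit :=
    Z.hom_ext fun Y => (S.counit_spec Y).trans (S'.counit_spec Y).symm
  cases S
  cases S'
  cases h₁
  cases h₂
  cases h₃
  cases h₄
  rfl

variable (Z) in
/-- The defining relations have a solution. -/
theorem nonempty_structure : Nonempty Z.Structure := by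
  choose m hm using Z.exists_mul
  choose c hc using Z.exists_comul
  obtain ⟨e, he⟩ := Z.exists_counit
  exact ⟨{
    mul :=
      { app := m
        naturality := fun X X' f => Z.mul_naturality m hm f }
    unit :=
      { app := fun X =>
          (ρ_ X).inv ≫ Z.del X (𝟙_ C) ≫ η T.toFunctor ▷ Z.Z.obj X ≫ (λ_ (Z.Z.obj X)).hom
        naturality := fun X X' f => by
          change f ≫ _ = _
          rw [rightUnitor_inv_naturality_assoc, reassoc_of% naturality_left, whisker_exchange_assoc]
          simp }
    comul := c
    counit := e
    mul_spec := hm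
    unit_spec := fun X => rfl
    comul_spec := hc
    counit_spec := he }⟩

end Centralizer

namespace Centralizer.Structure

variable {C : Type u} [Category.{v} C] [MonoidalCategory C]
  {T : Bimonad C} {Z : Centralizer T.toFunctor} (S : Z.Structure)

/-- The product of `Z` at `X`, with source `Z(Z(X))` on the nose. -/
def m (X : C) : Z.Z.obj (Z.Z.obj X) ⟶ Z.Z.obj X := S.mul.app X

/-- The unit of `Z` at `X`, with source `X` on the nose. -/
def u (X : C) : X ⟶ Z.Z.obj X := S.unit.app X

lemma m_naturality {X X' : C} (f : X ⟶ X') :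
    Z.Z.map (Z.Z.map f) ≫ S.m X' = S.m X ≫ Z.Z.map f :=
  S.mul.naturality f

lemma u_naturality {X X' : C} (f : X ⟶ X') : f ≫ S.u X' = S.u X ≫ Z.Z.map f :=
  S.unit.naturality f

lemma m_spec (X Y₁ Y₂ : C) : Z.del X Y₁ ▷ Y₂ ≫ (α_ (T.obj Y₁) (Z.Z.obj X) Y₂).hom ≫
        T.obj Y₁ ◁ Z.del (Z.Z.obj X) Y₂ ≫ T.obj Y₁ ◁ T.obj Y₂ ◁ S.m X =
      (α_ X Y₁ Y₂).hom ≫ Z.del X (Y₁ ⊗ Y₂) ≫ δ T.toFunctor Y₁ Y₂ ▷ Z.Z.obj X ≫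
        (α_ (T.obj Y₁) (T.obj Y₂) (Z.Z.obj X)).hom :=
  S.mul_spec X Y₁ Y₂

lemma u_spec (X : C) : S.u X =
    (ρ_ X).inv ≫ Z.del X (𝟙_ C) ≫ η T.toFunctor ▷ Z.Z.obj X ≫ (λ_ (Z.Z.obj X)).hom :=
  S.unit_spec X

lemma comul_spec' (X₁ X₂ Y : C) : Z.del (X₁ ⊗ X₂) Y ≫ T.obj Y ◁ S.comul X₁ X₂ =
      (α_ X₁ X₂ Y).hom ≫ X₁ ◁ Z.del X₂ Y ≫ (α_ X₁ (T.obj Y) (Z.Z.obj X₂)).inv ≫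
        Z.del X₁ (T.obj Y) ▷ Z.Z.obj X₂ ≫
          (α_ (T.obj (T.obj Y)) (Z.Z.obj X₁) (Z.Z.obj X₂)).hom ≫
            T.mu Y ▷ (Z.Z.obj X₁ ⊗ Z.Z.obj X₂) :=
  S.comul_spec X₁ X₂ Y

lemma counit_spec' (Y : C) :
    Z.del (𝟙_ C) Y ≫ T.obj Y ◁ S.counit = (λ_ Y).hom ≫ T.eta Y ≫ (ρ_ (T.obj Y)).inv :=
  S.counit_spec Y

lemma left_unit (X : C) : S.u (Z.Z.obj X) ≫ S.m X = 𝟙 (Z.Z.obj X) := by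
  refine Z.hom_ext fun Y => ?_
  have h := congrArg (· ▷ Z.Z.obj X) (right_unitality_hom T.toFunctor Y)
  simp only [comp_whiskerRight] at h
  calc _ = 𝟙 _ ⊗≫ (Z.del X Y ▷ 𝟙_ C) ⊗≫ T.obj Y ◁ Z.del (Z.Z.obj X) (𝟙_ C) ⊗≫
          T.obj Y ◁ (η T.toFunctor ▷ Z.Z.obj (Z.Z.obj X) ≫ 𝟙_ C ◁ S.m X) ⊗≫ 𝟙 _ := by
        rw [u_spec]; monoidal
    _ = 𝟙 _ ⊗≫ (Z.del X Y ▷ 𝟙_ C ≫ (α_ (T.obj Y) (Z.Z.obj X) (𝟙_ C)).hom ≫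
          T.obj Y ◁ Z.del (Z.Z.obj X) (𝟙_ C) ≫ T.obj Y ◁ T.obj (𝟙_ C) ◁ S.m X) ⊗≫
          T.obj Y ◁ η T.toFunctor ▷ Z.Z.obj X ⊗≫ 𝟙 _ := by
        rw [← whisker_exchange]; monoidal
    _ = 𝟙 _ ⊗≫ Z.del X (Y ⊗ 𝟙_ C) ≫ δ T.toFunctor Y (𝟙_ C) ▷ Z.Z.obj X ≫
          (T.obj Y ◁ η T.toFunctor) ▷ Z.Z.obj X ≫ (ρ_ (T.obj Y)).hom ▷ Z.Z.obj X := by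
        rw [m_spec]; monoidal
    _ = 𝟙 _ ⊗≫ (X ◁ (ρ_ Y).hom ≫ Z.del X Y) := by rw [h, naturality_right]
    _ = _ := by monoidal

lemma right_unit (X : C) : Z.Z.map (S.u X) ≫ S.m X = 𝟙 (Z.Z.obj X) := by
  refine Z.hom_ext fun Y => ?_
  have h := congrArg (· ▷ Z.Z.obj X) (left_unitality_hom T.toFunctor Y)
  simp only [comp_whiskerRight] at h
  calc _ = (Z.del X Y ≫ T.obj Y ◁ Z.Z.map (S.u X)) ≫ T.obj Y ◁ S.m X := by monoidal
    _ = 𝟙 _ ⊗≫ Z.del X (𝟙_ C) ▷ Y ⊗≫ (η T.toFunctor ▷ (Z.Z.obj X ⊗ Y) ≫ 𝟙_ C ◁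
          (Z.del (Z.Z.obj X) Y ≫ T.obj Y ◁ S.m X)) ⊗≫ 𝟙 _ := by
        rw [← naturality_left, u_spec]; monoidal
    _ = 𝟙 _ ⊗≫ (Z.del X (𝟙_ C) ▷ Y ≫ (α_ (T.obj (𝟙_ C)) (Z.Z.obj X) Y).hom ≫
          T.obj (𝟙_ C) ◁ Z.del (Z.Z.obj X) Y ≫ T.obj (𝟙_ C) ◁ T.obj Y ◁ S.m X) ⊗≫
          η T.toFunctor ▷ T.obj Y ▷ Z.Z.obj X ⊗≫ 𝟙 _ := by
        rw [← whisker_exchange]; monoidal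
    _ = 𝟙 _ ⊗≫ Z.del X (𝟙_ C ⊗ Y) ≫ δ T.toFunctor (𝟙_ C) Y ▷ Z.Z.obj X ≫
          (η T.toFunctor ▷ T.obj Y) ▷ Z.Z.obj X ≫ (λ_ (T.obj Y)).hom ▷ Z.Z.obj X := by
        rw [m_spec]; monoidal
    _ = 𝟙 _ ⊗≫ (X ◁ (λ_ Y).hom ≫ Z.del X Y) := by rw [h, naturality_right]
    _ = _ := by monoidal

lemma comul_naturality {X X' Y Y' : C} (f : X ⟶ X') (g : Y ⟶ Y') :
    Z.Z.map (f ⊗ₘ g) ≫ S.comul X' Y' = S.comul X Y ≫ (Z.Z.map f ⊗ₘ Z.Z.map g) := by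
  refine Z.hom_ext fun K => ?_
  calc _ = (Z.del (X ⊗ Y) K ≫ T.obj K ◁ Z.Z.map (f ⊗ₘ g)) ≫ T.obj K ◁ S.comul X' Y' := by monoidal
    _ = 𝟙 _ ⊗≫ (f ▷ (Y ⊗ K) ≫ X' ◁ (g ▷ K ≫ Z.del Y' K)) ⊗≫ Z.del X' (T.obj K) ▷ Z.Z.obj Y' ⊗≫
          T.mu K ▷ (Z.Z.obj X' ⊗ Z.Z.obj Y') := by
        rw [← naturality_left, Category.assoc, comul_spec', MonoidalCategory.tensorHom_def]
        monoidal
    _ = 𝟙 _ ⊗≫ X ◁ Z.del Y K ⊗≫ (X ◁ T.obj K ◁ Z.Z.map g ≫ f ▷ (T.obj K ⊗ Z.Z.obj Y')) ⊗≫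
          Z.del X' (T.obj K) ▷ Z.Z.obj Y' ⊗≫ T.mu K ▷ (Z.Z.obj X' ⊗ Z.Z.obj Y') := by
        rw [← whisker_exchange, naturality_left]; monoidal
    _ = 𝟙 _ ⊗≫ X ◁ Z.del Y K ⊗≫ X ◁ T.obj K ◁ Z.Z.map g ⊗≫
          (f ▷ T.obj K ≫ Z.del X' (T.obj K)) ▷ Z.Z.obj Y' ⊗≫
          T.mu K ▷ (Z.Z.obj X' ⊗ Z.Z.obj Y') := by monoidal
    _ = 𝟙 _ ⊗≫ X ◁ Z.del Y K ⊗≫ ((X ⊗ T.obj K) ◁ Z.Z.map g ≫ Z.del X (T.obj K) ▷ Z.Z.obj Y') ⊗≫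
          T.obj (T.obj K) ◁ Z.Z.map f ▷ Z.Z.obj Y' ⊗≫ T.mu K ▷ (Z.Z.obj X' ⊗ Z.Z.obj Y') := by
        rw [naturality_left]; monoidal
    _ = 𝟙 _ ⊗≫ X ◁ Z.del Y K ⊗≫ Z.del X (T.obj K) ▷ Z.Z.obj Y ⊗≫
          (T.obj (T.obj K) ◁ (Z.Z.obj X ◁ Z.Z.map g ≫ Z.Z.map f ▷ Z.Z.obj Y') ≫
          T.mu K ▷ (Z.Z.obj X' ⊗ Z.Z.obj Y')) := by
        rw [whisker_exchange]; monoidal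
    _ = (Z.del (X ⊗ Y) K ≫ T.obj K ◁ S.comul X Y) ≫
          T.obj K ◁ (Z.Z.obj X ◁ Z.Z.map g ≫ Z.Z.map f ▷ Z.Z.obj Y') := by
        rw [whisker_exchange, comul_spec']; monoidal
    _ = _ := by rw [← tensorHom_def']; monoidal

lemma coassoc (X Y W : C) : S.comul (X ⊗ Y) W ≫ S.comul X Y ▷ Z.Z.obj W ≫
        (α_ (Z.Z.obj X) (Z.Z.obj Y) (Z.Z.obj W)).hom =
      Z.Z.map (α_ X Y W).hom ≫ S.comul X (Y ⊗ W) ≫ Z.Z.obj X ◁ S.comul Y W := by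
  refine Z.hom_ext fun K => ?_
  calc _ = (Z.del ((X ⊗ Y) ⊗ W) K ≫ T.obj K ◁ S.comul (X ⊗ Y) W) ⊗≫
          T.obj K ◁ S.comul X Y ▷ Z.Z.obj W ⊗≫ 𝟙 _ := by monoidal
    _ = 𝟙 _ ⊗≫ X ◁ Y ◁ Z.del W K ⊗≫ Z.del (X ⊗ Y) (T.obj K) ▷ Z.Z.obj W ⊗≫
          (T.mu K ▷ Z.Z.obj (X ⊗ Y) ≫ T.obj K ◁ S.comul X Y) ▷ Z.Z.obj W ⊗≫ 𝟙 _ := by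
        rw [comul_spec']; monoidal
    _ = 𝟙 _ ⊗≫ X ◁ Y ◁ Z.del W K ⊗≫ (Z.del (X ⊗ Y) (T.obj K) ≫ T.obj (T.obj K) ◁ S.comul X Y) ▷
          Z.Z.obj W ⊗≫ T.mu K ▷ (Z.Z.obj X ⊗ Z.Z.obj Y ⊗ Z.Z.obj W) := by
        rw [← whisker_exchange]; monoidal
    _ = 𝟙 _ ⊗≫ X ◁ Y ◁ Z.del W K ⊗≫ X ◁ Z.del Y (T.obj K) ▷ Z.Z.obj W ⊗≫
          Z.del X (T.obj (T.obj K)) ▷ (Z.Z.obj Y ⊗ Z.Z.obj W) ⊗≫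
          (T.mu (T.obj K) ≫ T.mu K) ▷ (Z.Z.obj X ⊗ Z.Z.obj Y ⊗ Z.Z.obj W) := by
        rw [comul_spec']; monoidal
    _ = 𝟙 _ ⊗≫ X ◁ Y ◁ Z.del W K ⊗≫ X ◁ Z.del Y (T.obj K) ▷ Z.Z.obj W ⊗≫
          (Z.del X (T.obj (T.obj K)) ≫ T.map (T.mu K) ▷ Z.Z.obj X) ▷ (Z.Z.obj Y ⊗ Z.Z.obj W) ⊗≫
          T.mu K ▷ (Z.Z.obj X ⊗ Z.Z.obj Y ⊗ Z.Z.obj W) := by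
        rw [← T.mu_assoc]; monoidal
    _ = 𝟙 _ ⊗≫ X ◁ ((α_ Y W K).hom ≫ Y ◁ Z.del W K ≫ (α_ Y (T.obj K) (Z.Z.obj W)).inv ≫
          Z.del Y (T.obj K) ▷ Z.Z.obj W ≫
          (α_ (T.obj (T.obj K)) (Z.Z.obj Y) (Z.Z.obj W)).hom ≫
            T.mu K ▷ (Z.Z.obj Y ⊗ Z.Z.obj W)) ⊗≫
          Z.del X (T.obj K) ▷ (Z.Z.obj Y ⊗ Z.Z.obj W) ⊗≫
          T.mu K ▷ (Z.Z.obj X ⊗ Z.Z.obj Y ⊗ Z.Z.obj W) := by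
        rw [← naturality_right]; monoidal
    _ = 𝟙 _ ⊗≫ X ◁ Z.del (Y ⊗ W) K ⊗≫ ((X ⊗ T.obj K) ◁ S.comul Y W ≫
          Z.del X (T.obj K) ▷ (Z.Z.obj Y ⊗ Z.Z.obj W)) ⊗≫
          T.mu K ▷ (Z.Z.obj X ⊗ Z.Z.obj Y ⊗ Z.Z.obj W) := by
        rw [← S.comul_spec']; monoidal
    _ = 𝟙 _ ⊗≫ X ◁ Z.del (Y ⊗ W) K ⊗≫ Z.del X (T.obj K) ▷ Z.Z.obj (Y ⊗ W) ⊗≫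
          (T.obj (T.obj K) ◁ Z.Z.obj X ◁ S.comul Y W ≫
          T.mu K ▷ (Z.Z.obj X ⊗ Z.Z.obj Y ⊗ Z.Z.obj W)) := by
        rw [whisker_exchange]; monoidal
    _ = (α_ X Y W).hom ▷ K ≫ ((α_ X (Y ⊗ W) K).hom ≫ X ◁ Z.del (Y ⊗ W) K ≫
          (α_ X (T.obj K) (Z.Z.obj (Y ⊗ W))).inv ≫ Z.del X (T.obj K) ▷ Z.Z.obj (Y ⊗ W) ≫
          (α_ (T.obj (T.obj K)) (Z.Z.obj X) (Z.Z.obj (Y ⊗ W))).hom ≫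
            T.mu K ▷ (Z.Z.obj X ⊗ Z.Z.obj (Y ⊗ W))) ≫ T.obj K ◁ Z.Z.obj X ◁ S.comul Y W := by
        rw [whisker_exchange]; monoidal
    _ = _ := by
        rw [← S.comul_spec', Category.assoc, reassoc_of% naturality_left]; monoidal

lemma left_counit (X : C) :
    Z.Z.map (λ_ X).inv ≫ S.comul (𝟙_ C) X ≫ S.counit ▷ Z.Z.obj X = (λ_ (Z.Z.obj X)).inv := by
  refine Z.hom_ext fun K => ?_
  calc _ = (Z.del X K ≫ T.obj K ◁ Z.Z.map (λ_ X).inv) ≫ T.obj K ◁ S.comul (𝟙_ C) X ≫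
          T.obj K ◁ S.counit ▷ Z.Z.obj X := by monoidal
    _ = (λ_ X).inv ▷ K ≫ (Z.del (𝟙_ C ⊗ X) K ≫ T.obj K ◁ S.comul (𝟙_ C) X) ≫
          T.obj K ◁ S.counit ▷ Z.Z.obj X := by rw [← naturality_left]; monoidal
    _ = 𝟙 _ ⊗≫ Z.del X K ⊗≫ Z.del (𝟙_ C) (T.obj K) ▷ Z.Z.obj X ⊗≫
          (T.mu K ▷ Z.Z.obj (𝟙_ C) ≫ T.obj K ◁ S.counit) ▷ Z.Z.obj X ⊗≫ 𝟙 _ := by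
        rw [comul_spec']; monoidal
    _ = 𝟙 _ ⊗≫ Z.del X K ⊗≫ (Z.del (𝟙_ C) (T.obj K) ≫ T.obj (T.obj K) ◁ S.counit) ▷ Z.Z.obj X ⊗≫
          T.mu K ▷ Z.Z.obj X ⊗≫ 𝟙 _ := by
        rw [← whisker_exchange]; monoidal
    _ = 𝟙 _ ⊗≫ Z.del X K ⊗≫ (T.eta (T.obj K) ≫ T.mu K) ▷ Z.Z.obj X ⊗≫ 𝟙 _ := by
        rw [counit_spec']; monoidal
    _ = _ := by rw [T.eta_mu]; monoidal

lemma right_counit (X : C) :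
    Z.Z.map (ρ_ X).inv ≫ S.comul X (𝟙_ C) ≫ Z.Z.obj X ◁ S.counit = (ρ_ (Z.Z.obj X)).inv := by
  refine Z.hom_ext fun K => ?_
  calc _ = (Z.del X K ≫ T.obj K ◁ Z.Z.map (ρ_ X).inv) ≫ T.obj K ◁ S.comul X (𝟙_ C) ≫
          T.obj K ◁ Z.Z.obj X ◁ S.counit := by monoidal
    _ = (ρ_ X).inv ▷ K ≫ (Z.del (X ⊗ 𝟙_ C) K ≫ T.obj K ◁ S.comul X (𝟙_ C)) ≫
          T.obj K ◁ Z.Z.obj X ◁ S.counit := by rw [← naturality_left]; monoidal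
    _ = 𝟙 _ ⊗≫ X ◁ Z.del (𝟙_ C) K ⊗≫ Z.del X (T.obj K) ▷ Z.Z.obj (𝟙_ C) ⊗≫
          (T.mu K ▷ (Z.Z.obj X ⊗ Z.Z.obj (𝟙_ C)) ≫ T.obj K ◁ Z.Z.obj X ◁ S.counit) := by
        rw [comul_spec']; monoidal
    _ = 𝟙 _ ⊗≫ X ◁ Z.del (𝟙_ C) K ⊗≫ (Z.del X (T.obj K) ▷ Z.Z.obj (𝟙_ C) ≫
          (T.obj (T.obj K) ⊗ Z.Z.obj X) ◁ S.counit) ⊗≫ T.mu K ▷ Z.Z.obj X ⊗≫ 𝟙 _ := by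
        rw [← whisker_exchange]; monoidal
    _ = 𝟙 _ ⊗≫ X ◁ (Z.del (𝟙_ C) K ≫ T.obj K ◁ S.counit) ⊗≫ Z.del X (T.obj K) ⊗≫
          T.mu K ▷ Z.Z.obj X ⊗≫ 𝟙 _ := by
        rw [← whisker_exchange]; monoidal
    _ = 𝟙 _ ⊗≫ (X ◁ T.eta K ≫ Z.del X (T.obj K)) ⊗≫ T.mu K ▷ Z.Z.obj X ⊗≫ 𝟙 _ := by
        rw [counit_spec']; monoidal
    _ = 𝟙 _ ⊗≫ Z.del X K ≫ (T.map (T.eta K) ≫ T.mu K) ▷ Z.Z.obj X ⊗≫ 𝟙 _ := by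
        rw [naturality_right]; monoidal
    _ = _ := by rw [T.map_eta_mu]; monoidal

lemma unit_comul (X Y : C) : S.u (X ⊗ Y) ≫ S.comul X Y = (S.u X ⊗ₘ S.u Y) := by
  calc _ = 𝟙 _ ⊗≫ Z.del (X ⊗ Y) (𝟙_ C) ≫ (η T.toFunctor ▷ Z.Z.obj (X ⊗ Y) ≫
          𝟙_ C ◁ S.comul X Y) ⊗≫ 𝟙 _ := by rw [u_spec]; monoidal
    _ = 𝟙 _ ⊗≫ (Z.del (X ⊗ Y) (𝟙_ C) ≫ T.obj (𝟙_ C) ◁ S.comul X Y) ≫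
          η T.toFunctor ▷ (Z.Z.obj X ⊗ Z.Z.obj Y) ⊗≫ 𝟙 _ := by
        rw [← whisker_exchange]; monoidal
    _ = 𝟙 _ ⊗≫ X ◁ Z.del Y (𝟙_ C) ⊗≫ Z.del X (T.obj (𝟙_ C)) ▷ Z.Z.obj Y ⊗≫
          (T.mu (𝟙_ C) ≫ η T.toFunctor) ▷ (Z.Z.obj X ⊗ Z.Z.obj Y) ⊗≫ 𝟙 _ := by
        rw [comul_spec']; monoidal
    _ = 𝟙 _ ⊗≫ X ◁ Z.del Y (𝟙_ C) ⊗≫ (Z.del X (T.obj (𝟙_ C)) ≫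
          T.map (η T.toFunctor) ▷ Z.Z.obj X) ▷ Z.Z.obj Y ⊗≫
          η T.toFunctor ▷ (Z.Z.obj X ⊗ Z.Z.obj Y) ⊗≫ 𝟙 _ := by
        rw [T.mu_counit]; monoidal
    _ = _ := by
        rw [← naturality_right, tensorHom_def', u_spec, u_spec]; monoidal

lemma unit_counit : S.u (𝟙_ C) ≫ S.counit = 𝟙 (𝟙_ C) := by
  calc _ = 𝟙 _ ⊗≫ Z.del (𝟙_ C) (𝟙_ C) ≫ (η T.toFunctor ▷ Z.Z.obj (𝟙_ C) ≫
          𝟙_ C ◁ S.counit) ⊗≫ 𝟙 _ := by rw [u_spec]; monoidal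
    _ = 𝟙 _ ⊗≫ (Z.del (𝟙_ C) (𝟙_ C) ≫ T.obj (𝟙_ C) ◁ S.counit) ≫ η T.toFunctor ▷ 𝟙_ C ⊗≫
          𝟙 _ := by
        rw [← whisker_exchange]; monoidal
    _ = 𝟙 _ ⊗≫ (T.eta (𝟙_ C) ≫ η T.toFunctor) ⊗≫ 𝟙 _ := by
        rw [S.counit_spec']; monoidal
    _ = _ := by rw [T.eta_counit]; monoidal

variable [RigidCategory C]

lemma assoc (X : C) : Z.Z.map (S.m X) ≫ S.m X = S.m (Z.Z.obj X) ≫ S.m X := by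
  refine Z.hom_ext₃ fun Y₁ Y₂ Y₃ => ?_
  have h := congrArg (· ▷ Z.Z.obj X) (oplax_associativity T.toFunctor Y₁ Y₂ Y₃)
  simp only [comp_whiskerRight] at h
  calc _ = Z.del X Y₁ ▷ Y₂ ▷ Y₃ ⊗≫ T.obj Y₁ ◁ Z.del (Z.Z.obj X) Y₂ ▷ Y₃ ⊗≫
          T.obj Y₁ ◁ T.obj Y₂ ◁ (Z.del (Z.Z.obj (Z.Z.obj X)) Y₃ ≫ T.obj Y₃ ◁ Z.Z.map (S.m X)) ⊗≫
          T.obj Y₁ ◁ T.obj Y₂ ◁ T.obj Y₃ ◁ S.m X := by monoidal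
    _ = (Z.del X Y₁ ▷ Y₂ ≫ (α_ (T.obj Y₁) (Z.Z.obj X) Y₂).hom ≫
        T.obj Y₁ ◁ Z.del (Z.Z.obj X) Y₂ ≫ T.obj Y₁ ◁ T.obj Y₂ ◁ S.m X) ▷ Y₃ ⊗≫
          T.obj Y₁ ◁ T.obj Y₂ ◁ (Z.del (Z.Z.obj X) Y₃ ≫ T.obj Y₃ ◁ S.m X) := by
        rw [← naturality_left]; monoidal
    _ = 𝟙 _ ⊗≫ Z.del X (Y₁ ⊗ Y₂) ▷ Y₃ ⊗≫ (δ T.toFunctor Y₁ Y₂ ▷ (Z.Z.obj X ⊗ Y₃) ≫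
          (T.obj Y₁ ⊗ T.obj Y₂) ◁ (Z.del (Z.Z.obj X) Y₃ ≫ T.obj Y₃ ◁ S.m X)) ⊗≫ 𝟙 _ := by
        rw [m_spec]; monoidal
    _ = 𝟙 _ ⊗≫ (Z.del X (Y₁ ⊗ Y₂) ▷ Y₃ ≫ (α_ (T.obj (Y₁ ⊗ Y₂)) (Z.Z.obj X) Y₃).hom ≫
        T.obj (Y₁ ⊗ Y₂) ◁ Z.del (Z.Z.obj X) Y₃ ≫ T.obj (Y₁ ⊗ Y₂) ◁ T.obj Y₃ ◁ S.m X) ⊗≫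
          δ T.toFunctor Y₁ Y₂ ▷ T.obj Y₃ ▷ Z.Z.obj X ⊗≫ 𝟙 _ := by
        rw [← whisker_exchange]; monoidal
    _ = 𝟙 _ ⊗≫ Z.del X ((Y₁ ⊗ Y₂) ⊗ Y₃) ≫ (δ T.toFunctor (Y₁ ⊗ Y₂) Y₃ ▷ Z.Z.obj X ≫
          (δ T.toFunctor Y₁ Y₂ ▷ T.obj Y₃) ▷ Z.Z.obj X ≫
          (α_ (T.obj Y₁) (T.obj Y₂) (T.obj Y₃)).hom ▷ Z.Z.obj X) ⊗≫ 𝟙 _ := by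
        rw [m_spec]; monoidal
    _ = 𝟙 _ ⊗≫ (X ◁ (α_ Y₁ Y₂ Y₃).hom ≫ Z.del X (Y₁ ⊗ Y₂ ⊗ Y₃)) ≫
          δ T.toFunctor Y₁ (Y₂ ⊗ Y₃) ▷ Z.Z.obj X ≫
          (T.obj Y₁ ◁ δ T.toFunctor Y₂ Y₃) ▷ Z.Z.obj X ⊗≫ 𝟙 _ := by
        rw [h, naturality_right]; monoidal
    _ = 𝟙 _ ⊗≫ ((α_ X Y₁ (Y₂ ⊗ Y₃)).hom ≫ Z.del X (Y₁ ⊗ Y₂ ⊗ Y₃) ≫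
          δ T.toFunctor Y₁ (Y₂ ⊗ Y₃) ▷ Z.Z.obj X ≫
            (α_ (T.obj Y₁) (T.obj (Y₂ ⊗ Y₃)) (Z.Z.obj X)).hom) ⊗≫
          T.obj Y₁ ◁ δ T.toFunctor Y₂ Y₃ ▷ Z.Z.obj X ⊗≫ 𝟙 _ := by monoidal
    _ = 𝟙 _ ⊗≫ Z.del X Y₁ ▷ (Y₂ ⊗ Y₃) ⊗≫ T.obj Y₁ ◁ Z.del (Z.Z.obj X) (Y₂ ⊗ Y₃) ⊗≫
          T.obj Y₁ ◁ (T.obj (Y₂ ⊗ Y₃) ◁ S.m X ≫ δ T.toFunctor Y₂ Y₃ ▷ Z.Z.obj X) ⊗≫ 𝟙 _ := by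
        rw [← S.m_spec]; monoidal
    _ = Z.del X Y₁ ▷ Y₂ ▷ Y₃ ⊗≫ T.obj Y₁ ◁ ((α_ (Z.Z.obj X) Y₂ Y₃).hom ≫
          Z.del (Z.Z.obj X) (Y₂ ⊗ Y₃) ≫ δ T.toFunctor Y₂ Y₃ ▷ Z.Z.obj (Z.Z.obj X) ≫
          (α_ (T.obj Y₂) (T.obj Y₃) (Z.Z.obj (Z.Z.obj X))).hom) ⊗≫
          T.obj Y₁ ◁ T.obj Y₂ ◁ T.obj Y₃ ◁ S.m X := by
        rw [whisker_exchange]; monoidal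
    _ = _ := by rw [← S.m_spec]; monoidal

lemma mul_counit : S.m (𝟙_ C) ≫ S.counit = Z.Z.map S.counit ≫ S.counit := by
  refine Z.hom_ext₂ fun Y₁ Y₂ => ?_
  calc _ = 𝟙 _ ⊗≫ (Z.del (𝟙_ C) Y₁ ▷ Y₂ ≫ (α_ (T.obj Y₁) (Z.Z.obj (𝟙_ C)) Y₂).hom ≫
        T.obj Y₁ ◁ Z.del (Z.Z.obj (𝟙_ C)) Y₂ ≫ T.obj Y₁ ◁ T.obj Y₂ ◁ S.m (𝟙_ C)) ⊗≫
          T.obj Y₁ ◁ T.obj Y₂ ◁ S.counit := by monoidal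
    _ = 𝟙 _ ⊗≫ Z.del (𝟙_ C) (Y₁ ⊗ Y₂) ≫ (δ T.toFunctor Y₁ Y₂ ▷ Z.Z.obj (𝟙_ C) ≫
          (T.obj Y₁ ⊗ T.obj Y₂) ◁ S.counit) ⊗≫ 𝟙 _ := by rw [m_spec]; monoidal
    _ = 𝟙 _ ⊗≫ (Z.del (𝟙_ C) (Y₁ ⊗ Y₂) ≫ T.obj (Y₁ ⊗ Y₂) ◁ S.counit) ≫
          δ T.toFunctor Y₁ Y₂ ▷ 𝟙_ C ⊗≫ 𝟙 _ := by
        rw [← whisker_exchange]; monoidal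
    _ = 𝟙 _ ⊗≫ (T.eta (Y₁ ⊗ Y₂) ≫ δ T.toFunctor Y₁ Y₂) ⊗≫ 𝟙 _ := by
        rw [S.counit_spec']; monoidal
    _ = 𝟙 _ ⊗≫ T.eta Y₁ ▷ Y₂ ⊗≫ T.obj Y₁ ◁ ((λ_ Y₂).hom ≫ T.eta Y₂ ≫ (ρ_ (T.obj Y₂)).inv) := by
        rw [T.eta_comul, MonoidalCategory.tensorHom_def]; monoidal
    _ = ((λ_ Y₁).hom ≫ T.eta Y₁ ≫ (ρ_ (T.obj Y₁)).inv) ▷ Y₂ ⊗≫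
          T.obj Y₁ ◁ (Z.del (𝟙_ C) Y₂ ≫ T.obj Y₂ ◁ S.counit) := by
        rw [counit_spec']; monoidal
    _ = Z.del (𝟙_ C) Y₁ ▷ Y₂ ⊗≫ T.obj Y₁ ◁ (S.counit ▷ Y₂ ≫ Z.del (𝟙_ C) Y₂) ⊗≫
          T.obj Y₁ ◁ T.obj Y₂ ◁ S.counit := by
        rw [← S.counit_spec']; monoidal
    _ = _ := by rw [naturality_left]; monoidal

lemma mul_comul (X Y : C) : S.m (X ⊗ Y) ≫ S.comul X Y =
    Z.Z.map (S.comul X Y) ≫ S.comul (Z.Z.obj X) (Z.Z.obj Y) ≫ (S.m X ⊗ₘ S.m Y) := by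
  refine Z.hom_ext₂ fun Y₁ Y₂ => ?_
  have middle : Z.del (X ⊗ Y) Y₁ ▷ Y₂ ⊗≫ T.obj Y₁ ◁ Z.del (Z.Z.obj (X ⊗ Y)) Y₂ ≫
        T.obj Y₁ ◁ T.obj Y₂ ◁ (S.m (X ⊗ Y) ≫ S.comul X Y) =
      𝟙 _ ⊗≫ X ◁ (Z.del Y (Y₁ ⊗ Y₂) ≫ δ T.toFunctor Y₁ Y₂ ▷ Z.Z.obj Y) ⊗≫
        (Z.del X (T.obj Y₁ ⊗ T.obj Y₂) ≫
          δ T.toFunctor (T.obj Y₁) (T.obj Y₂) ▷ Z.Z.obj X) ▷ Z.Z.obj Y ⊗≫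
        (T.mu Y₁ ⊗ₘ T.mu Y₂) ▷ (Z.Z.obj X ⊗ Z.Z.obj Y) ⊗≫ 𝟙 _ := by
    calc _ = (Z.del (X ⊗ Y) Y₁ ▷ Y₂ ≫ (α_ (T.obj Y₁) (Z.Z.obj (X ⊗ Y)) Y₂).hom ≫
          T.obj Y₁ ◁ Z.del (Z.Z.obj (X ⊗ Y)) Y₂ ≫ T.obj Y₁ ◁ T.obj Y₂ ◁ S.m (X ⊗ Y)) ≫
            T.obj Y₁ ◁ T.obj Y₂ ◁ S.comul X Y := by monoidal
      _ = 𝟙 _ ⊗≫ Z.del (X ⊗ Y) (Y₁ ⊗ Y₂) ≫ (δ T.toFunctor Y₁ Y₂ ▷ Z.Z.obj (X ⊗ Y) ≫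
            (T.obj Y₁ ⊗ T.obj Y₂) ◁ S.comul X Y) ⊗≫ 𝟙 _ := by rw [m_spec]; monoidal
      _ = 𝟙 _ ⊗≫ (Z.del (X ⊗ Y) (Y₁ ⊗ Y₂) ≫ T.obj (Y₁ ⊗ Y₂) ◁ S.comul X Y) ≫
            δ T.toFunctor Y₁ Y₂ ▷ (Z.Z.obj X ⊗ Z.Z.obj Y) ⊗≫ 𝟙 _ := by
          rw [← whisker_exchange]; monoidal
      _ = 𝟙 _ ⊗≫ X ◁ Z.del Y (Y₁ ⊗ Y₂) ⊗≫ Z.del X (T.obj (Y₁ ⊗ Y₂)) ▷ Z.Z.obj Y ⊗≫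
            (T.mu (Y₁ ⊗ Y₂) ≫ δ T.toFunctor Y₁ Y₂) ▷ (Z.Z.obj X ⊗ Z.Z.obj Y) ⊗≫ 𝟙 _ := by
          rw [comul_spec']; monoidal
      _ = 𝟙 _ ⊗≫ X ◁ Z.del Y (Y₁ ⊗ Y₂) ⊗≫ (Z.del X (T.obj (Y₁ ⊗ Y₂)) ≫
            T.map (δ T.toFunctor Y₁ Y₂) ▷ Z.Z.obj X) ▷ Z.Z.obj Y ⊗≫
            (δ T.toFunctor (T.obj Y₁) (T.obj Y₂) ≫ (T.mu Y₁ ⊗ₘ T.mu Y₂)) ▷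
              (Z.Z.obj X ⊗ Z.Z.obj Y) ⊗≫ 𝟙 _ := by
          rw [T.mu_comul]; monoidal
      _ = _ := by rw [← naturality_right]; monoidal
  rw [middle]
  symm
  calc _ = 𝟙 _ ⊗≫ Z.del (X ⊗ Y) Y₁ ▷ Y₂ ⊗≫ T.obj Y₁ ◁ (Z.del (Z.Z.obj (X ⊗ Y)) Y₂ ≫
          T.obj Y₂ ◁ Z.Z.map (S.comul X Y)) ⊗≫
          T.obj Y₁ ◁ T.obj Y₂ ◁ (S.comul (Z.Z.obj X) (Z.Z.obj Y) ≫ (S.m X ⊗ₘ S.m Y)) := by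
        monoidal
    _ = 𝟙 _ ⊗≫ (Z.del (X ⊗ Y) Y₁ ≫ T.obj Y₁ ◁ S.comul X Y) ▷ Y₂ ⊗≫
          T.obj Y₁ ◁ ((Z.del (Z.Z.obj X ⊗ Z.Z.obj Y) Y₂ ≫
            T.obj Y₂ ◁ S.comul (Z.Z.obj X) (Z.Z.obj Y)) ≫ T.obj Y₂ ◁ (S.m X ⊗ₘ S.m Y)) := by
        rw [← naturality_left]; monoidal
    _ = 𝟙 _ ⊗≫ X ◁ Z.del Y Y₁ ▷ Y₂ ⊗≫ Z.del X (T.obj Y₁) ▷ (Z.Z.obj Y ⊗ Y₂) ⊗≫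
          (T.mu Y₁ ▷ (Z.Z.obj X ⊗ Z.Z.obj Y ⊗ Y₂) ≫ T.obj Y₁ ◁
          (Z.Z.obj X ◁ Z.del (Z.Z.obj Y) Y₂ ⊗≫
            Z.del (Z.Z.obj X) (T.obj Y₂) ▷ Z.Z.obj (Z.Z.obj Y) ⊗≫
            (T.mu Y₂ ▷ (Z.Z.obj (Z.Z.obj X) ⊗ Z.Z.obj (Z.Z.obj Y)) ≫
              T.obj Y₂ ◁ (S.m X ⊗ₘ S.m Y)))) := by
        rw [comul_spec', comul_spec']; monoidal
    _ = 𝟙 _ ⊗≫ X ◁ Z.del Y Y₁ ▷ Y₂ ⊗≫ Z.del X (T.obj Y₁) ▷ (Z.Z.obj Y ⊗ Y₂) ⊗≫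
          T.obj (T.obj Y₁) ◁ (Z.Z.obj X ◁ Z.del (Z.Z.obj Y) Y₂ ⊗≫
            (Z.del (Z.Z.obj X) (T.obj Y₂) ▷ Z.Z.obj (Z.Z.obj Y) ≫
              (T.obj (T.obj Y₂) ⊗ Z.Z.obj (Z.Z.obj X)) ◁ S.m Y) ⊗≫
              T.obj (T.obj Y₂) ◁ S.m X ▷ Z.Z.obj Y ⊗≫
              T.mu Y₂ ▷ (Z.Z.obj X ⊗ Z.Z.obj Y)) ≫ T.mu Y₁ ▷ (T.obj Y₂ ⊗ Z.Z.obj X ⊗ Z.Z.obj Y) := by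
        rw [← whisker_exchange, ← whisker_exchange, tensorHom_def']; monoidal
    _ = 𝟙 _ ⊗≫ X ◁ Z.del Y Y₁ ▷ Y₂ ⊗≫ (Z.del X (T.obj Y₁) ▷ (Z.Z.obj Y ⊗ Y₂) ≫
          (T.obj (T.obj Y₁) ⊗ Z.Z.obj X) ◁ (Z.del (Z.Z.obj Y) Y₂ ≫ T.obj Y₂ ◁ S.m Y)) ⊗≫
          T.obj (T.obj Y₁) ◁ (Z.del (Z.Z.obj X) (T.obj Y₂) ▷ Z.Z.obj Y ⊗≫
              T.obj (T.obj Y₂) ◁ S.m X ▷ Z.Z.obj Y ⊗≫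
              T.mu Y₂ ▷ (Z.Z.obj X ⊗ Z.Z.obj Y)) ≫ T.mu Y₁ ▷ (T.obj Y₂ ⊗ Z.Z.obj X ⊗ Z.Z.obj Y) := by
        rw [← whisker_exchange]; monoidal
    _ = 𝟙 _ ⊗≫ X ◁ (Z.del Y Y₁ ▷ Y₂ ≫ (α_ (T.obj Y₁) (Z.Z.obj Y) Y₂).hom ≫
          T.obj Y₁ ◁ Z.del (Z.Z.obj Y) Y₂ ≫ T.obj Y₁ ◁ T.obj Y₂ ◁ S.m Y) ⊗≫
          (Z.del X (T.obj Y₁) ▷ T.obj Y₂ ≫ (α_ (T.obj (T.obj Y₁)) (Z.Z.obj X) (T.obj Y₂)).hom ≫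
            T.obj (T.obj Y₁) ◁ Z.del (Z.Z.obj X) (T.obj Y₂) ≫
            T.obj (T.obj Y₁) ◁ T.obj (T.obj Y₂) ◁ S.m X) ▷ Z.Z.obj Y ⊗≫
          (T.obj (T.obj Y₁) ◁ T.mu Y₂ ≫ T.mu Y₁ ▷ T.obj Y₂) ▷ (Z.Z.obj X ⊗ Z.Z.obj Y) ⊗≫ 𝟙 _ := by
        rw [← whisker_exchange]; monoidal
    _ = _ := by rw [m_spec, m_spec, tensorHom_def']; monoidal

/-- The centralizer of a bimonad is a bimonad. -/
theorem isBimonad : S.IsBimonad where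
  assoc := S.assoc
  left_unit := S.left_unit
  right_unit := S.right_unit
  comul_naturality := S.comul_naturality
  coassoc := S.coassoc
  left_counit := S.left_counit
  right_counit := S.right_counit
  mul_comul := S.mul_comul
  mul_counit := S.mul_counit
  unit_comul := S.unit_comul
  unit_counit := S.unit_counit

end Centralizer.Structure

/-! ### The partial braiding of a centralizer with modules -/

section DetectingComp

variable {C : Type u} [Category.{v} C] [MonoidalCategory C]

/-- Detecting families compose. -/
lemma IsDetecting.comp {I J : Type*} {A N : I → C} {B : C} {k : ∀ i, A i ⟶ N i ⊗ B}
    (hk : IsDetecting k) {Q P : J → C} [∀ j, HasRightDual (Q j)] {B' : C}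
    {l : ∀ j, B ⊗ Q j ⟶ P j ⊗ B'} (hl : IsDetecting l) :
    IsDetecting (fun p : I × J => k p.1 ▷ Q p.2 ≫ (α_ (N p.1) B (Q p.2)).hom ≫ N p.1 ◁ l p.2 ≫
      (α_ (N p.1) (P p.2) B').inv) := by
  intro W f g h
  refine hl f g fun j => hk.whiskerRight (Q j) _ _ fun i => ?_
  have h' := h (i, j)
  dsimp only at h' ⊢
  rw [← cancel_mono (α_ _ _ _).inv]
  calc _ = _ := ?_
    _ = _ := h'
    _ = _ := ?_
  all_goals monoidal

end DetectingComp

namespace Bimonad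

variable {C : Type u} [Category.{v} C] [MonoidalCategory C] {T : Bimonad C}

lemma extend_comp_whiskerRight {N N' : T.Mod} (f : N ⟶ N') {A B : C} (k : A ⟶ N.A ⊗ B) :
    T.extend N k ≫ f.f ▷ T.obj B = T.extend N' (k ≫ f.f ▷ B) := by
  have h := δ_natural_left T.toFunctor f.f B
  simp only [extend, Functor.map_comp, Category.assoc]
  rw [← reassoc_of% h, ← comp_whiskerRight, ← comp_whiskerRight, f.h]

/-- The free `T`-module on `X`, with carrier `T(X)` on the nose. -/
abbrev freeMod (T : Bimonad C) (X : C) : T.Mod where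
  A := T.obj X
  a := T.mu X
  unit := T.eta_mu X
  assoc := (T.mu_assoc X).symm

/-- The monoidal product of modules, with carrier `M ⊗ N` on the nose. -/
abbrev prodMod (M N : T.Mod) : T.Mod where
  A := M.A ⊗ N.A
  a := δ T.toFunctor M.A N.A ≫ (M.a ⊗ₘ N.a)
  unit := (T.tensorMod M N).unit
  assoc := (T.tensorMod M N).assoc

/-- The unit module, with carrier `𝟙` on the nose. -/
abbrev oneMod (T : Bimonad C) : T.Mod where
  A := 𝟙_ C
  a := η T.toFunctor
  unit := T.unitMod.unit
  assoc := T.unitMod.assoc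

/-- The action of a module, as a morphism of modules. -/
@[simps]
def actHom (N : T.Mod) : T.freeMod N.A ⟶ N where
  f := N.a
  h := N.assoc.symm

/-- The free `T`-linear morphism on a morphism of `C`. -/
@[simps]
def freeHom (T : Bimonad C) {X Y : C} (f : X ⟶ Y) : T.freeMod X ⟶ T.freeMod Y where
  f := T.map f
  h := T.mu_naturality f

lemma eta_act (N : T.Mod) : T.eta N.A ≫ N.a = 𝟙 N.A := N.unit

end Bimonad

namespace HopfMonad

variable {C : Type u} [Category.{v} C] [MonoidalCategory C] [RigidCategory C] (T : HopfMonad C)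

/-- A morphism `a : T(B) ⟶ B` for which a detecting family of morphisms `A i ⟶ N i ⊗ B` is
`T`-linear is an action. -/
abbrev modOfDetecting {I : Type*} {A N : I → T.Mod} {B : C} (k : ∀ i, (A i).A ⟶ (N i).A ⊗ B)
    (hk : IsDetecting (N := fun i => (N i).A) k) (a : T.obj B ⟶ B)
    (ha : ∀ i, T.extend (N i) (k i) ≫ (N i).A ◁ a = (A i).a ≫ k i) : T.Mod where
  A := B
  a := a
  unit := by
    refine hk _ _ fun i => ?_
    have h := Bimonad.unit_extend (N i) (k i)
    rw [MonoidalCategory.whiskerLeft_comp, ← reassoc_of% h, ha, reassoc_of% (A i).unit]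
    exact ((congrArg (k i ≫ ·) (MonoidalCategory.whiskerLeft_id _ _)).trans
      (Category.comp_id _)).symm
  assoc := by
    refine T.isDetecting_extend (T.isDetecting_extend hk) _ _ fun i => ?_
    have h := Bimonad.mul_extend (N i) (k i)
    dsimp only
    rw [MonoidalCategory.whiskerLeft_comp, MonoidalCategory.whiskerLeft_comp, ← reassoc_of% h, ha,
      reassoc_of% Bimonad.extend_comp_whiskerLeft_map, ha, ← Bimonad.map_comp_extend,
      Category.assoc, ha, reassoc_of% (A i).assoc]

/-- A morphism is `T`-linear as soon as its composites with a detecting family of linear morphisms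
are. -/
lemma linear_of_detecting {I : Type*} {A N : I → T.Mod} {B B' : T.Mod}
    (k : ∀ i, A i ⟶ N i ⊗ B) (hk : IsDetecting (N := fun i => (N i).A) fun i => (k i).f)
    (f : B.A ⟶ B'.A) (l : ∀ i, A i ⟶ N i ⊗ B') (hl : ∀ i, (k i).f ≫ (N i).A ◁ f = (l i).f) :
    T.map f ≫ B'.a = B.a ≫ f := by
  have h {i : I} {B : T.Mod} (k : A i ⟶ N i ⊗ B) :
      T.extend (N i) (A := (A i).A) k.f ≫ (N i).A ◁ B.a = (A i).a ≫ k.f := by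
    have h : T.map k.f ≫ δ T.toFunctor (N i).A B.A ≫ ((N i).a ⊗ₘ B.a) = (A i).a ≫ k.f := k.h
    rw [← h, MonoidalCategory.tensorHom_def]
    exact (Category.assoc _ _ _).trans (congrArg (_ ≫ ·) (Category.assoc _ _ _))
  refine T.isDetecting_extend hk _ _ fun i => ?_
  have h₁ : T.extend (N i) (A := (A i).A) (k i).f ≫ (N i).A ◁ T.map f =
      T.extend (N i) (A := (A i).A) (l i).f :=
    (Bimonad.extend_comp_whiskerLeft_map (A := (A i).A) (N i) (k i).f f).trans
      (congrArg (T.extend (N i)) (hl i))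
  have h₂ := h (k i)
  have h₃ := h (l i)
  calc _ = (T.extend (N i) (A := (A i).A) (k i).f ≫ (N i).A ◁ T.map f) ≫ (N i).A ◁ B'.a := by
        rw [MonoidalCategory.whiskerLeft_comp, Category.assoc]
    _ = (A i).a ≫ (k i).f ≫ (N i).A ◁ f := by rw [h₁, h₃, ← hl]; rfl
    _ = (T.extend (N i) (A := (A i).A) (k i).f ≫ (N i).A ◁ B.a) ≫ (N i).A ◁ f :=
        (Category.assoc _ _ _).symm.trans (congrArg (· ≫ (N i).A ◁ f) h₂.symm)
    _ = _ := by rw [MonoidalCategory.whiskerLeft_comp, Category.assoc]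

end HopfMonad

namespace Centralizer

variable {C : Type u} [Category.{v} C] [MonoidalCategory C]

section Bimonad

variable {T : Bimonad C} (Z : Centralizer T.toFunctor)

/-- The morphism `X ⊗ N ⟶ N ⊗ Z(X)` which a module `N` gives: `∂` followed by the action. It is a
half braiding of `X` with `T`-modules, up to the replacement of `X` by `Z(X)`. -/
def cross (X : C) (N : T.Mod) : X ⊗ N.A ⟶ N.A ⊗ Z.Z.obj X :=
  Z.del X N.A ≫ N.a ▷ Z.Z.obj X

lemma cross_naturality_left {X X' : C} (f : X ⟶ X') (N : T.Mod) :
    f ▷ N.A ≫ Z.cross X' N = Z.cross X N ≫ N.A ◁ Z.Z.map f := by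
  rw [cross, cross, reassoc_of% naturality_left, whisker_exchange, Category.assoc]

lemma cross_naturality_right (X : C) {N N' : T.Mod} (f : N ⟶ N') :
    X ◁ f.f ≫ Z.cross X N' = Z.cross X N ≫ f.f ▷ Z.Z.obj X := by
  rw [cross, cross, reassoc_of% naturality_right, Category.assoc, ← comp_whiskerRight,
    ← comp_whiskerRight, f.h]

lemma cross_act (X : C) (N : T.Mod) :
    X ◁ N.a ≫ Z.cross X N = Z.cross X (T.freeMod N.A) ≫ N.a ▷ Z.Z.obj X :=
  Z.cross_naturality_right X (Bimonad.actHom N)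

/-- The morphism `∂` is recovered from its values on free modules. -/
lemma eta_cross (X Y : C) : X ◁ T.eta Y ≫ Z.cross X (T.freeMod Y) = Z.del X Y := by
  change X ◁ T.eta Y ≫ Z.del X (T.obj Y) ≫ T.mu Y ▷ Z.Z.obj X = Z.del X Y
  rw [reassoc_of% naturality_right, ← comp_whiskerRight, T.map_eta_mu, id_whiskerRight,
    Category.comp_id]

lemma isDetecting_cross (X : C) : IsDetecting (N := Monad.Algebra.A) (Z.cross X) := by
  intro W f g h
  refine Z.hom_ext fun Y => ?_
  have h' : Z.cross X (T.freeMod Y) ≫ T.obj Y ◁ f = Z.cross X (T.freeMod Y) ≫ T.obj Y ◁ g :=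
    h (T.freeMod Y)
  rw [← eta_cross]
  exact (Category.assoc _ _ _).trans
    ((congrArg (X ◁ T.eta Y ≫ ·) h').trans (Category.assoc _ _ _).symm)

variable {Z} (S : Z.Structure)

/-- The defining relation of the product of `Z`, on modules: the hexagon axiom for `Z.cross`. -/
lemma Structure.cross_mul (X : C) (N₁ N₂ : T.Mod) :
    Z.cross X N₁ ▷ N₂.A ⊗≫ N₁.A ◁ Z.cross (Z.Z.obj X) N₂ ≫ N₁.A ◁ N₂.A ◁ S.m X =
      (α_ X N₁.A N₂.A).hom ≫ Z.cross X (Bimonad.prodMod N₁ N₂) ≫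
        (α_ N₁.A N₂.A (Z.Z.obj X)).hom := by
  change _ = (α_ X N₁.A N₂.A).hom ≫ (Z.del X (N₁.A ⊗ N₂.A) ≫
    (δ T.toFunctor N₁.A N₂.A ≫ (N₁.a ⊗ₘ N₂.a)) ▷ Z.Z.obj X) ≫ (α_ N₁.A N₂.A (Z.Z.obj X)).hom
  rw [cross, cross]
  calc _ = Z.del X N₁.A ▷ N₂.A ⊗≫ (N₁.a ▷ (Z.Z.obj X ⊗ N₂.A) ≫
          N₁.A ◁ (Z.del (Z.Z.obj X) N₂.A ⊗≫ (N₂.a ▷ Z.Z.obj (Z.Z.obj X) ≫ N₂.A ◁ S.m X))) := by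
        monoidal
    _ = (Z.del X N₁.A ▷ N₂.A ≫ (α_ (T.obj N₁.A) (Z.Z.obj X) N₂.A).hom ≫
        T.obj N₁.A ◁ Z.del (Z.Z.obj X) N₂.A ≫ T.obj N₁.A ◁ T.obj N₂.A ◁ S.m X) ⊗≫
          (T.obj N₁.A ◁ N₂.a ≫ N₁.a ▷ N₂.A) ▷ Z.Z.obj X ⊗≫ 𝟙 _ := by
        rw [← whisker_exchange, ← whisker_exchange]; monoidal
    _ = _ := by rw [S.m_spec, ← tensorHom_def']; monoidal

lemma Structure.u_eq_cross (X : C) :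
    S.u X = (ρ_ X).inv ≫ Z.cross X T.oneMod ≫ (λ_ (Z.Z.obj X)).hom := by
  rw [u_spec]
  exact congrArg ((ρ_ X).inv ≫ ·) (Category.assoc _ _ _).symm

/-- The defining relation of the coproduct of `Z`, on modules: the other hexagon axiom for
`Z.cross`. -/
lemma Structure.cross_comul (X₁ X₂ : C) (N : T.Mod) :
    Z.cross (X₁ ⊗ X₂) N ≫ N.A ◁ S.comul X₁ X₂ =
      (α_ X₁ X₂ N.A).hom ≫ X₁ ◁ Z.cross X₂ N ≫ (α_ X₁ N.A (Z.Z.obj X₂)).inv ≫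
        Z.cross X₁ N ▷ Z.Z.obj X₂ ≫ (α_ N.A (Z.Z.obj X₁) (Z.Z.obj X₂)).hom := by
  have h : T.mu N.A ≫ N.a = T.map N.a ≫ N.a := N.assoc
  rw [cross, cross, cross]
  calc _ = Z.del (X₁ ⊗ X₂) N.A ≫ (N.a ▷ Z.Z.obj (X₁ ⊗ X₂) ≫ N.A ◁ S.comul X₁ X₂) := by simp
    _ = (Z.del (X₁ ⊗ X₂) N.A ≫ T.obj N.A ◁ S.comul X₁ X₂) ≫
        N.a ▷ (Z.Z.obj X₁ ⊗ Z.Z.obj X₂) := by rw [← whisker_exchange]; simp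
    _ = 𝟙 _ ⊗≫ X₁ ◁ Z.del X₂ N.A ⊗≫ Z.del X₁ (T.obj N.A) ▷ Z.Z.obj X₂ ⊗≫
        (T.mu N.A ≫ N.a) ▷ (Z.Z.obj X₁ ⊗ Z.Z.obj X₂) := by rw [S.comul_spec']; monoidal
    _ = 𝟙 _ ⊗≫ X₁ ◁ Z.del X₂ N.A ⊗≫ (Z.del X₁ (T.obj N.A) ≫ T.map N.a ▷ Z.Z.obj X₁) ▷
        Z.Z.obj X₂ ⊗≫ N.a ▷ (Z.Z.obj X₁ ⊗ Z.Z.obj X₂) := by rw [h]; monoidal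
    _ = _ := by rw [← naturality_right]; monoidal

lemma Structure.cross_counit (N : T.Mod) :
    Z.cross (𝟙_ C) N ≫ N.A ◁ S.counit = (λ_ N.A).hom ≫ (ρ_ N.A).inv := by
  calc _ = Z.del (𝟙_ C) N.A ≫ (N.a ▷ Z.Z.obj (𝟙_ C) ≫ N.A ◁ S.counit) := by simp [cross]
    _ = (Z.del (𝟙_ C) N.A ≫ T.obj N.A ◁ S.counit) ≫ N.a ▷ 𝟙_ C := by
      rw [← whisker_exchange]; simp
    _ = (λ_ N.A).hom ≫ (T.eta N.A ≫ N.a) ≫ (ρ_ N.A).inv := by rw [S.counit_spec']; simp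
    _ = _ := by rw [Bimonad.eta_act, Category.id_comp]

end Bimonad

end Centralizer

/-! ### The lift of the centralizer to modules -/

namespace Centralizer

variable {C : Type u} [Category.{v} C] [MonoidalCategory C] [RigidCategory C]

section

variable {T : HopfMonad C} (Z : Centralizer T.toFunctor)

/-- Since `T` preserves the universal property of `∂`, there is a morphism `a` for which the relation
holds after restriction along the units `Y ⟶ T(Y)` of free modules; the general relation follows by
naturality along the action of `N`. -/
lemma exists_liftAct (M : T.Mod) : ∃ a : T.obj (Z.Z.obj M.A) ⟶ Z.Z.obj M.A, ∀ N : T.Mod,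
    T.extend N (Z.cross M.A N) ≫ N.A ◁ a = (Bimonad.prodMod M N).a ≫ Z.cross M.A N := by
  have key := T.exists_factor_extend (tensorLeft M.A) T.toMonad.free (B := Z.Z.obj M.A)
    (fun Y => Z.del M.A Y) (fun W ξ hξ => Z.exists_factor M.A W ξ (fun g => hξ g))
    (Z.Z.obj M.A) (fun Y => T.map (M.A ◁ T.eta Y) ≫ (Bimonad.prodMod M (T.freeMod Y)).a ≫
      Z.cross M.A (T.freeMod Y)) (by
      intro Y Y' g
      have h₁ : T.map (M.A ◁ T.map g) ≫ (Bimonad.prodMod M (T.freeMod Y')).a =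
          (Bimonad.prodMod M (T.freeMod Y)).a ≫ M.A ◁ T.map g := (M ◁ T.freeHom g).h
      have h₂ : M.A ◁ T.map g ≫ Z.cross M.A (T.freeMod Y') =
          Z.cross M.A (T.freeMod Y) ≫ T.map g ▷ Z.Z.obj M.A :=
        Z.cross_naturality_right M.A (T.freeHom g)
      have h₃ : T.map (M.A ◁ g) ≫ T.map (M.A ◁ T.eta Y') ≫
          (Bimonad.prodMod M (T.freeMod Y')).a ≫ Z.cross M.A (T.freeMod Y') =
          (T.map (M.A ◁ T.eta Y) ≫ (Bimonad.prodMod M (T.freeMod Y)).a ≫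
            Z.cross M.A (T.freeMod Y)) ≫ T.map g ▷ Z.Z.obj M.A := by
        rw [← T.map_comp_assoc, ← MonoidalCategory.whiskerLeft_comp, T.eta_naturality,
          MonoidalCategory.whiskerLeft_comp, T.map_comp_assoc, Category.assoc, Category.assoc,
          reassoc_of% h₁, h₂]
        simp only [Category.assoc]
      exact h₃)
  obtain ⟨a, ha⟩ := key
  refine ⟨a, fun N => ?_⟩
  have ha' : T.extend (T.freeMod N.A) (Z.del M.A N.A) ≫ T.obj N.A ◁ a =
      T.map (M.A ◁ T.eta N.A) ≫ (Bimonad.prodMod M (T.freeMod N.A)).a ≫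
        Z.cross M.A (T.freeMod N.A) := ha N.A
  have h₁ : T.extend N (Z.cross M.A N) =
      T.extend (T.freeMod N.A) (Z.del M.A N.A) ≫ N.a ▷ T.obj (Z.Z.obj M.A) :=
    (Bimonad.extend_comp_whiskerRight (Bimonad.actHom N) (Z.del M.A N.A)).symm
  have h₂ : T.map (M.A ◁ N.a) ≫ (Bimonad.prodMod M N).a =
      (Bimonad.prodMod M (T.freeMod N.A)).a ≫ M.A ◁ N.a := (M ◁ Bimonad.actHom N).h
  have h₃ := Z.cross_act M.A N
  calc _ = (T.extend (T.freeMod N.A) (Z.del M.A N.A) ≫ T.obj N.A ◁ a) ≫ N.a ▷ Z.Z.obj M.A := by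
        rw [h₁, Category.assoc, ← whisker_exchange]
        exact (Category.assoc _ _ _).symm
    _ = T.map (M.A ◁ T.eta N.A) ≫ ((Bimonad.prodMod M (T.freeMod N.A)).a ≫ M.A ◁ N.a) ≫
          Z.cross M.A N := by
        rw [ha', Category.assoc, Category.assoc]
        exact congrArg (_ ≫ ·) ((congrArg (_ ≫ ·) h₃.symm).trans (Category.assoc _ _ _).symm)
    _ = _ := by
        rw [← h₂, Category.assoc, ← T.map_comp_assoc, ← MonoidalCategory.whiskerLeft_comp,
          Bimonad.eta_act, MonoidalCategory.whiskerLeft_id]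
        exact (congrArg (· ≫ _) (T.map_id _)).trans (Category.id_comp _)

/-- The action of `T` on `Z(M)` for which all the morphisms `M ⊗ N ⟶ N ⊗ Z(M)` are linear. -/
noncomputable def liftAct (M : T.Mod) : T.obj (Z.Z.obj M.A) ⟶ Z.Z.obj M.A :=
  (Z.exists_liftAct M).choose

lemma extend_cross_liftAct (M N : T.Mod) :
    T.extend N (Z.cross M.A N) ≫ N.A ◁ Z.liftAct M = (Bimonad.prodMod M N).a ≫ Z.cross M.A N :=
  (Z.exists_liftAct M).choose_spec N

/-- The lift of `Z` to `T`-modules. The laws of the action hold because they hold after composition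
with the detecting morphisms `Z.cross`. -/
noncomputable abbrev liftMod (M : T.Mod) : T.Mod :=
  T.modOfDetecting (A := fun N => Bimonad.prodMod M N) (N := id) (Z.cross M.A)
    (Z.isDetecting_cross M.A)
    (Z.liftAct M) (Z.extend_cross_liftAct M)

/-- The morphism `M ⊗ N ⟶ N ⊗ Z(M)`, as a morphism of modules. -/
@[simps]
noncomputable def crossHom (M N : T.Mod) : M ⊗ N ⟶ N ⊗ Z.liftMod M where
  f := Z.cross M.A N
  h := by
    have h := Z.extend_cross_liftAct M N
    change T.map (Z.cross M.A N) ≫ δ T.toFunctor N.A (Z.Z.obj M.A) ≫ (N.a ⊗ₘ Z.liftAct M) =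
      (Bimonad.prodMod M N).a ≫ Z.cross M.A N
    rw [MonoidalCategory.tensorHom_def, ← h, Bimonad.extend]
    simp only [Category.assoc]

/-- A criterion for linearity of morphisms out of `Z(M)`. -/
lemma liftMod_linear {M B : T.Mod} (f : Z.Z.obj M.A ⟶ B.A) (l : ∀ N : T.Mod, M ⊗ N ⟶ N ⊗ B)
    (hl : ∀ N, Z.cross M.A N ≫ N.A ◁ f = (l N).f) : T.map f ≫ B.a = Z.liftAct M ≫ f :=
  T.linear_of_detecting (fun N => Z.crossHom M N) (Z.isDetecting_cross M.A) f l hl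

lemma map_linear {M M' : T.Mod} (f : M ⟶ M') :
    T.map (Z.Z.map f.f) ≫ Z.liftAct M' = Z.liftAct M ≫ Z.Z.map f.f :=
  Z.liftMod_linear (B := Z.liftMod M') (Z.Z.map f.f) (fun N => f ▷ N ≫ Z.crossHom M' N)
    (fun N => (Z.cross_naturality_left f.f N).symm)

variable {Z} (S : Z.Structure)

lemma Structure.m_linear (M : T.Mod) :
    T.map (S.m M.A) ≫ Z.liftAct M = Z.liftAct (Z.liftMod M) ≫ S.m M.A := by
  refine T.linear_of_detecting (B := Z.liftMod (Z.liftMod M)) (B' := Z.liftMod M)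
    (I := T.Mod × T.Mod) (A := fun p => (M ⊗ p.1) ⊗ p.2) (N := fun p => p.1 ⊗ p.2)
    (fun p => Z.crossHom M p.1 ▷ p.2 ≫ (α_ _ _ _).hom ≫ p.1 ◁ Z.crossHom (Z.liftMod M) p.2 ≫
      (α_ _ _ _).inv) ?_ _ (fun p => (α_ M p.1 p.2).hom ≫ Z.crossHom M (p.1 ⊗ p.2)) ?_
  · exact (Z.isDetecting_cross M.A).comp (Z.isDetecting_cross (Z.Z.obj M.A))
  · intro p
    have h := S.cross_mul M.A p.1 p.2
    change (Z.cross M.A p.1 ▷ p.2.A ≫ (α_ _ _ _).hom ≫ p.1.A ◁ Z.cross (Z.Z.obj M.A) p.2 ≫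
      (α_ _ _ _).inv) ≫ (p.1.A ⊗ p.2.A) ◁ S.m M.A =
        (α_ M.A p.1.A p.2.A).hom ≫ Z.cross M.A (Bimonad.prodMod p.1 p.2)
    rw [← cancel_mono (α_ p.1.A p.2.A (Z.Z.obj M.A)).hom]
    refine Eq.trans ?_ (h.trans (Category.assoc _ _ _).symm)
    monoidal

lemma Structure.u_linear (M : T.Mod) : T.map (S.u M.A) ≫ Z.liftAct M = M.a ≫ S.u M.A := by
  rw [S.u_eq_cross]
  exact ((ρ_ M).inv ≫ Z.crossHom M (𝟙_ _) ≫ (λ_ (Z.liftMod M)).hom).h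

lemma Structure.comul_linear (M₁ M₂ : T.Mod) :
    T.map (S.comul M₁.A M₂.A) ≫ δ T.toFunctor (Z.Z.obj M₁.A) (Z.Z.obj M₂.A) ≫
        (Z.liftAct M₁ ⊗ₘ Z.liftAct M₂) =
      Z.liftAct (Bimonad.prodMod M₁ M₂) ≫ S.comul M₁.A M₂.A :=
  Z.liftMod_linear (M := M₁ ⊗ M₂) (B := Z.liftMod M₁ ⊗ Z.liftMod M₂) (S.comul M₁.A M₂.A)
    (fun N => (α_ M₁ M₂ N).hom ≫ M₁ ◁ Z.crossHom M₂ N ≫ (α_ _ _ _).inv ≫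
      Z.crossHom M₁ N ▷ Z.liftMod M₂ ≫ (α_ _ _ _).hom) (fun N => S.cross_comul M₁.A M₂.A N)

lemma Structure.counit_linear :
    T.map S.counit ≫ η T.toFunctor = Z.liftAct T.oneMod ≫ S.counit :=
  Z.liftMod_linear (M := 𝟙_ T.Mod) (B := 𝟙_ T.Mod) S.counit
    (fun N => (λ_ N).hom ≫ (ρ_ N).inv) (fun N => S.cross_counit N)

variable (Z) in
/-- The canonical distributive law of `T` over its centralizer: on `T(Z(X))` it is `T(Z(η_X))`
followed by the action of `T` on `Z` of the free module on `X`. -/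
noncomputable def law : Z.Z ⋙ T.toFunctor ⟶ T.toFunctor ⋙ Z.Z where
  app X := T.map (Z.Z.map (T.eta X)) ≫ Z.liftAct (T.freeMod X)
  naturality X Y f := by
    have h := Z.map_linear (T.freeHom f)
    change T.map (Z.Z.map f) ≫ T.map (Z.Z.map (T.eta Y)) ≫ Z.liftAct (T.freeMod Y) =
      (T.map (Z.Z.map (T.eta X)) ≫ Z.liftAct (T.freeMod X)) ≫ Z.Z.map (T.map f)
    rw [Category.assoc]
    refine Eq.trans ?_ (congrArg (_ ≫ ·) h)
    simp only [Bimonad.freeHom_f]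
    rw [← T.map_comp_assoc, ← T.map_comp_assoc, ← Z.Z.map_comp, ← Z.Z.map_comp, T.eta_naturality]

variable (Z) in
/-- The canonical law at `X`, with source and target on the nose. -/
noncomputable def lawApp (X : C) : T.obj (Z.Z.obj X) ⟶ Z.Z.obj (T.obj X) :=
  T.map (Z.Z.map (T.eta X)) ≫ Z.liftAct (T.freeMod X)

lemma lawApp_naturality {X Y : C} (f : X ⟶ Y) :
    T.map (Z.Z.map f) ≫ Z.lawApp Y = Z.lawApp X ≫ Z.Z.map (T.map f) :=
  Z.law.naturality f

variable (Z) in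
/-- The law determines the lift of `Z`, as for any distributive law. -/
lemma lawApp_act (M : T.Mod) : Z.lawApp M.A ≫ Z.Z.map M.a = Z.liftAct M := by
  have h := Z.map_linear (Bimonad.actHom M)
  have h' : T.map (Z.Z.map M.a) ≫ Z.liftAct M = Z.liftAct (T.freeMod M.A) ≫ Z.Z.map M.a := h
  rw [lawApp, Category.assoc]
  refine (congrArg (_ ≫ ·) h'.symm).trans ?_
  rw [← T.map_comp_assoc, ← Z.Z.map_comp, Bimonad.eta_act, Z.Z.map_id, T.map_id, Category.id_comp]

variable (Z) in
lemma lawApp_mu (X : C) : Z.lawApp (T.obj X) ≫ Z.Z.map (T.mu X) = Z.liftAct (T.freeMod X) :=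
  Z.lawApp_act (T.freeMod X)

lemma liftAct_assoc (M : T.Mod) :
    T.mu (Z.Z.obj M.A) ≫ Z.liftAct M = T.map (Z.liftAct M) ≫ Z.liftAct M :=
  (Z.liftMod M).assoc

lemma liftAct_unit (M : T.Mod) : T.eta (Z.Z.obj M.A) ≫ Z.liftAct M = 𝟙 _ :=
  (Z.liftMod M).unit

/-- The axioms of a comonoidal distributive law say that `m`, `u`, `Z₂` and `Z₀` are `T`-linear for
the lift of `Z`, and that the lift of a module is a module. -/
theorem isComonoidalDistributiveLaw_law (hS : S.IsBimonad) :
    IsComonoidalDistributiveLaw T.toBimonad (S.bimonad hS) Z.law where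
  mul_right X := by
    change T.map (S.m X) ≫ Z.lawApp X =
      Z.lawApp (Z.Z.obj X) ≫ Z.Z.map (Z.lawApp X) ≫ S.m (T.obj X)
    have h₁ : T.map (S.m (T.obj X)) ≫ Z.liftAct (T.freeMod X) =
      Z.liftAct (Z.liftMod (T.freeMod X)) ≫ S.m (T.obj X) := S.m_linear (T.freeMod X)
    have h₂ : Z.lawApp (Z.Z.obj (T.obj X)) ≫ Z.Z.map (Z.liftAct (T.freeMod X)) =
      Z.liftAct (Z.liftMod (T.freeMod X)) := Z.lawApp_act (Z.liftMod (T.freeMod X))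
    calc _ = T.map (S.m X ≫ Z.Z.map (T.eta X)) ≫ Z.liftAct (T.freeMod X) := by
          rw [lawApp, T.map_comp_assoc]
      _ = T.map (Z.Z.map (Z.Z.map (T.eta X))) ≫ Z.liftAct (Z.liftMod (T.freeMod X)) ≫
          S.m (T.obj X) := by
        rw [← S.m_naturality, T.map_comp_assoc]
        exact congrArg (_ ≫ ·) h₁
      _ = T.map (Z.Z.map (Z.Z.map (T.eta X))) ≫ Z.lawApp (Z.Z.obj (T.obj X)) ≫
          Z.Z.map (Z.liftAct (T.freeMod X)) ≫ S.m (T.obj X) :=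
        congrArg (_ ≫ ·) ((congrArg (· ≫ _) h₂.symm).trans (Category.assoc _ _ _))
      _ = Z.lawApp (Z.Z.obj X) ≫ Z.Z.map (T.map (Z.Z.map (T.eta X))) ≫
          Z.Z.map (Z.liftAct (T.freeMod X)) ≫ S.m (T.obj X) := by
        rw [reassoc_of% lawApp_naturality]
      _ = _ := congrArg (_ ≫ ·) ((Category.assoc _ _ _).symm.trans
          (congrArg (· ≫ _) (Z.Z.map_comp _ _).symm))
  unit_right X := by
    change T.map (S.u X) ≫ Z.lawApp X = S.u (T.obj X)
    have h : T.map (S.u (T.obj X)) ≫ Z.liftAct (T.freeMod X) = T.mu X ≫ S.u (T.obj X) :=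
      S.u_linear (T.freeMod X)
    rw [lawApp, ← T.map_comp_assoc, ← S.u_naturality, T.map_comp_assoc]
    refine (congrArg (_ ≫ ·) h).trans ?_
    rw [reassoc_of% T.map_eta_mu]
  mul_left X := by
    change T.mu (Z.Z.obj X) ≫ Z.lawApp X =
      T.map (Z.lawApp X) ≫ Z.lawApp (T.obj X) ≫ Z.Z.map (T.mu X)
    have h : T.mu (Z.Z.obj (T.obj X)) ≫ Z.liftAct (T.freeMod X) =
      T.map (Z.liftAct (T.freeMod X)) ≫ Z.liftAct (T.freeMod X) := liftAct_assoc (T.freeMod X)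
    rw [lawApp_mu, lawApp, ← reassoc_of% T.mu_naturality, T.map_comp, Category.assoc]
    exact congrArg (_ ≫ ·) h
  unit_left X := by
    change T.eta (Z.Z.obj X) ≫ Z.lawApp X = Z.Z.map (T.eta X)
    have h : T.eta (Z.Z.obj (T.obj X)) ≫ Z.liftAct (T.freeMod X) = 𝟙 _ :=
      liftAct_unit (T.freeMod X)
    rw [lawApp, ← reassoc_of% T.eta_naturality]
    exact (congrArg (_ ≫ ·) h).trans (Category.comp_id _)
  comul X Y := by
    change Z.lawApp (X ⊗ Y) ≫ Z.Z.map (δ T.toFunctor X Y) ≫ S.comul (T.obj X) (T.obj Y) =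
      (T.map (S.comul X Y) ≫ δ T.toFunctor (Z.Z.obj X) (Z.Z.obj Y)) ≫ (Z.lawApp X ⊗ₘ Z.lawApp Y)
    let d : T.freeMod (X ⊗ Y) ⟶ Bimonad.prodMod (T.freeMod X) (T.freeMod Y) :=
      { f := δ T.toFunctor X Y
        h := (T.mu_comul X Y).symm }
    have h₁ : T.map (Z.Z.map (δ T.toFunctor X Y)) ≫
        Z.liftAct (Bimonad.prodMod (T.freeMod X) (T.freeMod Y)) =
      Z.liftAct (T.freeMod (X ⊗ Y)) ≫ Z.Z.map (δ T.toFunctor X Y) := Z.map_linear d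
    have h₂ : T.map (S.comul (T.obj X) (T.obj Y)) ≫
        δ T.toFunctor (Z.Z.obj (T.obj X)) (Z.Z.obj (T.obj Y)) ≫
        (Z.liftAct (T.freeMod X) ⊗ₘ Z.liftAct (T.freeMod Y)) =
      Z.liftAct (Bimonad.prodMod (T.freeMod X) (T.freeMod Y)) ≫ S.comul (T.obj X) (T.obj Y) :=
        S.comul_linear (T.freeMod X) (T.freeMod Y)
    calc _ = T.map (Z.Z.map (T.eta (X ⊗ Y))) ≫
          (Z.liftAct (T.freeMod (X ⊗ Y)) ≫ Z.Z.map (δ T.toFunctor X Y)) ≫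
            S.comul (T.obj X) (T.obj Y) :=
          (Category.assoc _ _ _).trans (congrArg (_ ≫ ·) (Category.assoc _ _ _).symm)
      _ = T.map (Z.Z.map (T.eta (X ⊗ Y))) ≫ T.map (Z.Z.map (δ T.toFunctor X Y)) ≫
          Z.liftAct (Bimonad.prodMod (T.freeMod X) (T.freeMod Y)) ≫ S.comul (T.obj X) (T.obj Y) := by
        rw [← h₁]
        exact congrArg (_ ≫ ·) (Category.assoc _ _ _)
      _ = T.map (Z.Z.map (T.eta (X ⊗ Y))) ≫ T.map (Z.Z.map (δ T.toFunctor X Y)) ≫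
          T.map (S.comul (T.obj X) (T.obj Y)) ≫
        δ T.toFunctor (Z.Z.obj (T.obj X)) (Z.Z.obj (T.obj Y)) ≫
        (Z.liftAct (T.freeMod X) ⊗ₘ Z.liftAct (T.freeMod Y)) :=
        congrArg (_ ≫ ·) (congrArg (_ ≫ ·) h₂.symm)
      _ = T.map (Z.Z.map (T.eta X ⊗ₘ T.eta Y) ≫ S.comul (T.obj X) (T.obj Y)) ≫
        δ T.toFunctor (Z.Z.obj (T.obj X)) (Z.Z.obj (T.obj Y)) ≫
        (Z.liftAct (T.freeMod X) ⊗ₘ Z.liftAct (T.freeMod Y)) := by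
        rw [← T.eta_comul, Z.Z.map_comp, T.map_comp, T.map_comp, Category.assoc, Category.assoc]
      _ = _ := by
        have h₃ := δ_natural T.toFunctor (Z.Z.map (T.eta X)) (Z.Z.map (T.eta Y))
        rw [S.comul_naturality, T.map_comp, Category.assoc, ← reassoc_of% h₃, Category.assoc]
        exact congrArg (_ ≫ ·) (congrArg (_ ≫ ·) (tensorHom_comp_tensorHom _ _ _ _))
  counit := by
    change Z.lawApp (𝟙_ C) ≫ Z.Z.map (η T.toFunctor) ≫ S.counit =
      T.map S.counit ≫ η T.toFunctor
    let d : T.freeMod (𝟙_ C) ⟶ T.oneMod :=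
      { f := η T.toFunctor
        h := T.mu_counit.symm }
    have h₁ : T.map (Z.Z.map (η T.toFunctor)) ≫ Z.liftAct T.oneMod =
      Z.liftAct (T.freeMod (𝟙_ C)) ≫ Z.Z.map (η T.toFunctor) := Z.map_linear d
    rw [S.counit_linear]
    rw [lawApp, Category.assoc, ← reassoc_of% h₁, ← T.map_comp_assoc, ← Z.Z.map_comp,
      T.eta_counit, Z.Z.map_id, T.map_id, Category.id_comp]

variable (Z) in
/-- The linearity of `Z.cross` on free modules, stated for the law. -/
lemma extend_del_lawApp (X Y : C) :
    T.extend (T.freeMod Y) (Z.del X Y) ≫ T.obj Y ◁ Z.lawApp X =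
      δ T.toFunctor X Y ≫ Z.del (T.obj X) (T.obj Y) ≫ T.mu Y ▷ Z.Z.obj (T.obj X) := by
  have h₁ : T.extend (T.freeMod Y) (Z.del X Y) ≫ T.obj Y ◁ T.map (Z.Z.map (T.eta X)) =
      T.extend (T.freeMod Y) (Z.del X Y ≫ T.obj Y ◁ Z.Z.map (T.eta X)) :=
    Bimonad.extend_comp_whiskerLeft_map (T.freeMod Y) (Z.del X Y) (Z.Z.map (T.eta X))
  have h₂ : T.extend (T.freeMod Y) (Z.cross (T.obj X) (T.freeMod Y)) ≫
      T.obj Y ◁ Z.liftAct (T.freeMod X) =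
      (δ T.toFunctor (T.obj X) (T.obj Y) ≫ (T.mu X ⊗ₘ T.mu Y)) ≫
        Z.del (T.obj X) (T.obj Y) ≫ T.mu Y ▷ Z.Z.obj (T.obj X) :=
    Z.extend_cross_liftAct (T.freeMod X) (T.freeMod Y)
  have h₃ : Z.del X Y ≫ T.obj Y ◁ Z.Z.map (T.eta X) =
      (T.eta X ⊗ₘ T.eta Y) ≫ Z.cross (T.obj X) (T.freeMod Y) := by
    rw [← naturality_left, ← eta_cross, MonoidalCategory.tensorHom_def, Category.assoc]
  have h₄ : T.extend (T.freeMod Y) ((T.eta X ⊗ₘ T.eta Y) ≫ Z.cross (T.obj X) (T.freeMod Y)) =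
      T.map (T.eta X ⊗ₘ T.eta Y) ≫
        T.extend (T.freeMod Y) (Z.cross (T.obj X) (T.freeMod Y)) :=
    (Bimonad.map_comp_extend (T.freeMod Y) _ _).symm
  have h₅ := δ_natural T.toFunctor (T.eta X) (T.eta Y)
  rw [lawApp, MonoidalCategory.whiskerLeft_comp, reassoc_of% h₁, h₃, h₄, Category.assoc, h₂,
    Category.assoc, ← reassoc_of% h₅, tensorHom_comp_tensorHom_assoc, T.map_eta_mu, T.map_eta_mu, id_tensorHom_id, Category.id_comp]

/-- The dinatural transformation `ι` is the transpose of `∂`. -/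
lemma ι_eq (X Y : C) : Z.ι X Y =
    (tensorLeftHomEquiv (X ⊗ Y) (T.obj Y) ((T.obj Y)ᘁ) (Z.Z.obj X)).symm (Z.del X Y) := by
  simp [ι, tensorLeftHomEquiv]

/-- The defining relation of the law is the transpose of `extend_del_lawApp`: the left antipode turns
the extension of `∂` along the free action into `T` of its transpose `ι`. -/
theorem isCanonicalLaw_law : IsCanonicalLaw T Z Z.law := by
  intro X Y
  have h : T.map (Z.ι X Y) = δ T.toFunctor ((T.obj Y)ᘁ : C) (X ⊗ Y) ≫
      (T.map ((T.mu Y)ᘁ) ≫ T.leftAntipode.s (T.obj Y)) ▷ T.obj (X ⊗ Y) ≫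
        (tensorLeftHomEquiv (T.obj (X ⊗ Y)) (T.obj Y) ((T.obj Y)ᘁ) (T.obj (Z.Z.obj X))).symm
          (T.extend (T.freeMod Y) (Z.del X Y)) := by
    rw [ι_eq]
    exact T.leftAntipode.map_transpose (T.freeMod Y) (Z.del X Y)
  change T.map (Z.ι X Y) ≫ Z.lawApp X =
    δ T.toFunctor ((T.obj Y)ᘁ : C) (X ⊗ Y) ≫ T.obj ((T.obj Y)ᘁ : C) ◁ δ T.toFunctor X Y ≫
      (T.map ((T.mu Y)ᘁ) ≫ T.leftAntipode.s (T.obj Y) ≫ ((T.mu Y)ᘁ)) ▷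
          (T.obj X ⊗ T.obj Y) ≫ Z.ι (T.obj X) (T.obj Y)
  rw [h, Category.assoc, Category.assoc, ← tensorLeftHomEquiv_symm_comp_whiskerLeft,
    extend_del_lawApp, tensorLeftHomEquiv_symm_naturality,
    tensorLeftHomEquiv_symm_comp_whiskerRight, ← ι_eq, ← Category.assoc (T.map _),
    comp_whiskerRight_assoc, ← whisker_exchange_assoc, ← whisker_exchange_assoc]
  simp only [comp_whiskerRight, Category.assoc]

/-- The defining relation determines the law, because `T` preserves the jointly epimorphic family
`ι`. -/
theorem eq_law {Ω : Z.Z ⋙ T.toFunctor ⟶ T.toFunctor ⋙ Z.Z} (hΩ : IsCanonicalLaw T Z Ω) :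
    Ω = Z.law := by
  ext X
  let adj := Adjunction.ofIsLeftAdjoint T.toFunctor
  apply (adj.homEquiv _ _).injective
  refine Z.hom_ext fun Y => ?_
  apply (tensorLeftHomEquiv (X ⊗ Y) (T.obj Y) ((T.obj Y)ᘁ) _).symm.injective
  rw [tensorLeftHomEquiv_symm_comp_whiskerLeft, tensorLeftHomEquiv_symm_comp_whiskerLeft, ← ι_eq,
    ← adj.homEquiv_naturality_left, ← adj.homEquiv_naturality_left]
  exact congrArg _ ((hΩ X Y).trans (isCanonicalLaw_law X Y).symm)

end

end Centralizer

/-! ### Half braidings on objects of a category with duals -/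

section HalfBraiding

variable {D : Type u} [Category.{v} D] [MonoidalCategory D]

/-- A half braiding of which invertibility is not required is invertible at every object with a
dual `K`: an inverse at `N` is a transpose of the component at `K`. -/
lemma exists_inverse_halfBraiding {M : D} (b : ∀ N, M ⊗ N ⟶ N ⊗ M)
    (hb : ∀ {N N' : D} (f : N ⟶ N'), M ◁ f ≫ b N' = b N ≫ f ▷ M)
    (h_one : b (𝟙_ D) = (ρ_ M).hom ≫ (λ_ M).inv)
    (h_tensor : ∀ N N', b (N ⊗ N') = (α_ M N N').inv ≫ b N ▷ N' ≫ (α_ N M N').hom ≫ N ◁ b N' ≫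
      (α_ N N' M).inv) (K N : D) [ExactPairing K N] :
    ∃ c : N ⊗ M ⟶ M ⊗ N, b N ≫ c = 𝟙 _ ∧ c ≫ b N = 𝟙 _ := by
  refine ⟨𝟙 _ ⊗≫ N ◁ M ◁ η_ K N ⊗≫ N ◁ b K ▷ N ⊗≫ ε_ K N ▷ (M ⊗ N) ⊗≫ 𝟙 _, ?_, ?_⟩
  · calc _ = 𝟙 _ ⊗≫ (b N ▷ 𝟙_ D ≫ (N ⊗ M) ◁ η_ K N) ⊗≫ N ◁ b K ▷ N ⊗≫
            ε_ K N ▷ (M ⊗ N) ⊗≫ 𝟙 _ := by monoidal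
      _ = 𝟙 _ ⊗≫ M ◁ N ◁ η_ K N ⊗≫ ((α_ M N K).inv ≫ b N ▷ K ≫ (α_ N M K).hom ≫ N ◁ b K ≫
            (α_ N K M).inv) ▷ N ⊗≫ ε_ K N ▷ (M ⊗ N) ⊗≫ 𝟙 _ := by
          rw [← whisker_exchange]; monoidal
      _ = 𝟙 _ ⊗≫ M ◁ N ◁ η_ K N ⊗≫ (b (N ⊗ K) ≫ ε_ K N ▷ M) ▷ N ⊗≫ 𝟙 _ := by
          rw [← h_tensor]; monoidal
      _ = 𝟙 _ ⊗≫ M ◁ (N ◁ η_ K N ≫ (α_ N K N).inv ≫ ε_ K N ▷ N) ⊗≫ 𝟙 _ := by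
          rw [← hb, h_one]; monoidal
      _ = _ := by rw [ExactPairing.coevaluation_evaluation]; monoidal
  · calc _ = 𝟙 _ ⊗≫ N ◁ M ◁ η_ K N ⊗≫ N ◁ b K ▷ N ⊗≫ (ε_ K N ▷ (M ⊗ N) ≫ 𝟙_ D ◁ b N) ⊗≫
            𝟙 _ := by monoidal
      _ = 𝟙 _ ⊗≫ N ◁ M ◁ η_ K N ⊗≫ N ◁ ((α_ M K N).inv ≫ b K ▷ N ≫ (α_ K M N).hom ≫ K ◁ b N ≫
            (α_ K N M).inv) ⊗≫ ε_ K N ▷ (N ⊗ M) ⊗≫ 𝟙 _ := by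
          rw [← whisker_exchange]; monoidal
      _ = 𝟙 _ ⊗≫ N ◁ (M ◁ η_ K N ≫ b (K ⊗ N)) ⊗≫ ε_ K N ▷ (N ⊗ M) ⊗≫ 𝟙 _ := by
          rw [← h_tensor]; monoidal
      _ = 𝟙 _ ⊗≫ (N ◁ η_ K N ≫ (α_ N K N).inv ≫ ε_ K N ▷ N) ▷ M ⊗≫ 𝟙 _ := by
          rw [hb, h_one]; monoidal
      _ = _ := by rw [ExactPairing.coevaluation_evaluation]; monoidal

/-- The hexagon axiom and invertibility determine a half braiding at the unit object. -/
lemma CategoryTheory.HalfBraiding.unit_eq {M : D} (σ : HalfBraiding M) :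
    (σ.β (𝟙_ D)).hom = (ρ_ M).hom ≫ (λ_ M).inv := by
  have h : M ◁ (λ_ (𝟙_ D)).hom =
      (α_ M (𝟙_ D) (𝟙_ D)).inv ≫ (σ.β (𝟙_ D)).hom ▷ 𝟙_ D ≫ (α_ (𝟙_ D) M (𝟙_ D)).hom ≫
        (λ_ (M ⊗ 𝟙_ D)).hom := by
    rw [← cancel_mono (σ.β (𝟙_ D)).hom, σ.naturality, σ.monoidal]
    simp
  calc _ = (ρ_ (M ⊗ 𝟙_ D)).inv ≫ (α_ M (𝟙_ D) (𝟙_ D)).hom ≫ ((α_ M (𝟙_ D) (𝟙_ D)).inv ≫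
        (σ.β (𝟙_ D)).hom ▷ 𝟙_ D ≫ (α_ (𝟙_ D) M (𝟙_ D)).hom ≫ (λ_ (M ⊗ 𝟙_ D)).hom) ≫
          (λ_ (M ⊗ 𝟙_ D)).inv ≫ (𝟙_ D) ◁ (ρ_ M).hom := by simp
    _ = _ := by rw [← h]; monoidal

end HalfBraiding

namespace Centralizer

variable {C : Type u} [Category.{v} C] [MonoidalCategory C] [RigidCategory C]
  {T : HopfMonad C} {Z : Centralizer T.toFunctor}

/-- A `T`-linear action `z : Z(M) ⟶ M` of the monad `Z` on a `T`-module `M`, that is, an action of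
the lift of `Z` to `T`-modules. -/
structure Structure.IsLiftAction (S : Z.Structure) (M : T.Mod) (z : Z.Z.obj M.A ⟶ M.A) : Prop where
  unit : S.u M.A ≫ z = 𝟙 M.A
  assoc : S.m M.A ≫ z = Z.Z.map z ≫ z
  linear : T.map z ≫ M.a = Z.liftAct M ≫ z

variable {S : Z.Structure}

namespace Structure.IsLiftAction

variable {M : T.Mod} {z : Z.Z.obj M.A ⟶ M.A} (hz : S.IsLiftAction M z)

include hz

/-- The hexagon axiom of the half braiding is the associativity of the action of `Z`. -/
lemma cross_tensor (N₁ N₂ : T.Mod) :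
    Z.cross M.A (Bimonad.prodMod N₁ N₂) ≫ (N₁.A ⊗ N₂.A) ◁ z =
      (α_ M.A N₁.A N₂.A).inv ≫ (Z.cross M.A N₁ ≫ N₁.A ◁ z) ▷ N₂.A ≫ (α_ N₁.A M.A N₂.A).hom ≫
        N₁.A ◁ (Z.cross M.A N₂ ≫ N₂.A ◁ z) ≫ (α_ N₁.A N₂.A M.A).inv := by
  calc _ = (α_ M.A N₁.A N₂.A).inv ≫ ((α_ M.A N₁.A N₂.A).hom ≫
          Z.cross M.A (Bimonad.prodMod N₁ N₂) ≫ (α_ N₁.A N₂.A (Z.Z.obj M.A)).hom) ≫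
            N₁.A ◁ N₂.A ◁ z ≫ (α_ N₁.A N₂.A M.A).inv := by simp
    _ = (α_ M.A N₁.A N₂.A).inv ≫ (Z.cross M.A N₁ ▷ N₂.A ⊗≫ N₁.A ◁ Z.cross (Z.Z.obj M.A) N₂ ≫
          N₁.A ◁ N₂.A ◁ (S.m M.A ≫ z)) ≫ (α_ N₁.A N₂.A M.A).inv := by
        rw [← S.cross_mul]; monoidal
    _ = (α_ M.A N₁.A N₂.A).inv ≫ (Z.cross M.A N₁ ▷ N₂.A ⊗≫ N₁.A ◁ (Z.cross (Z.Z.obj M.A) N₂ ≫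
          N₂.A ◁ Z.Z.map z) ≫ N₁.A ◁ N₂.A ◁ z) ≫ (α_ N₁.A N₂.A M.A).inv := by
        rw [hz.assoc]; monoidal
    _ = _ := by rw [← cross_naturality_left]; monoidal

/-- The value of the half braiding at the unit object is the unitality of the action of `Z`. -/
lemma cross_one : Z.cross M.A T.oneMod ≫ (𝟙_ C) ◁ z = (ρ_ M.A).hom ≫ (λ_ M.A).inv := by
  have h := hz.unit
  rw [S.u_eq_cross, Category.assoc, Category.assoc, ← leftUnitor_naturality,
    Iso.inv_comp_eq] at h
  rw [Category.comp_id] at h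
  rw [← h]
  simp

/-- The half braiding at `N` which an action of the lift of `Z` defines. -/
noncomputable def braid (N : T.Mod) : M ⊗ N ⟶ N ⊗ M :=
  Z.crossHom M N ≫ N ◁ ({ f := z, h := hz.linear } : Z.liftMod M ⟶ M)

lemma exists_inverse_braid (N : T.Mod) :
    ∃ c : N ⊗ M ⟶ M ⊗ N, hz.braid N ≫ c = 𝟙 _ ∧ c ≫ hz.braid N = 𝟙 _ := by
  refine exists_inverse_halfBraiding hz.braid ?_ ?_ ?_ (T.rightAntipode.dualMod N) N
  · intro N N' f
    apply Monad.Algebra.Hom.ext'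
    change M.A ◁ f.f ≫ Z.cross M.A N' ≫ N'.A ◁ z = (Z.cross M.A N ≫ N.A ◁ z) ≫ f.f ▷ M.A
    rw [reassoc_of% cross_naturality_right, Category.assoc, whisker_exchange]
  · apply Monad.Algebra.Hom.ext'
    exact hz.cross_one
  · intro N N'
    apply Monad.Algebra.Hom.ext'
    exact hz.cross_tensor N N'

/-- The half braiding which an action of the lift of `Z` defines. -/
noncomputable def halfBraiding : HalfBraiding M where
  β N :=
    { hom := hz.braid N
      inv := (hz.exists_inverse_braid N).choose
      hom_inv_id := (hz.exists_inverse_braid N).choose_spec.1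
      inv_hom_id := (hz.exists_inverse_braid N).choose_spec.2 }
  monoidal N N' := by
    apply Monad.Algebra.Hom.ext'
    exact hz.cross_tensor N N'
  naturality {N N'} f := by
    apply Monad.Algebra.Hom.ext'
    change M.A ◁ f.f ≫ Z.cross M.A N' ≫ N'.A ◁ z = (Z.cross M.A N ≫ N.A ◁ z) ≫ f.f ▷ M.A
    rw [reassoc_of% cross_naturality_right, Category.assoc, whisker_exchange]

lemma halfBraiding_hom (N : T.Mod) :
    (hz.halfBraiding.β N).hom.f = Z.cross M.A N ≫ N.A ◁ z := rfl

end Structure.IsLiftAction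

/-- A half braiding comes from a morphism `Z(M) ⟶ M`, by the universal property of `∂` applied to
its restriction to free modules. -/
lemma exists_halfBraiding_eq {M : T.Mod} (σ : HalfBraiding M) :
    ∃ z : Z.Z.obj M.A ⟶ M.A, ∀ N : T.Mod, Z.cross M.A N ≫ N.A ◁ z = (σ.β N).hom.f := by
  have nat {N N' : T.Mod} (f : N ⟶ N') :
      M.A ◁ f.f ≫ (σ.β N').hom.f = (σ.β N).hom.f ≫ f.f ▷ M.A :=
    congrArg Monad.Algebra.Hom.f (σ.naturality f)
  let ξ (Y : C) : M.A ⊗ T.obj Y ⟶ T.obj Y ⊗ M.A := (σ.β (T.freeMod Y)).hom.f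
  obtain ⟨z, hz⟩ := Z.exists_factor M.A M.A
    (fun Y => M.A ◁ T.eta Y ≫ ξ Y) (by
      intro Y Y' g
      have h : M.A ◁ T.map g ≫ ξ Y' = ξ Y ≫ T.map g ▷ M.A := nat (T.freeHom g)
      rw [← MonoidalCategory.whiskerLeft_comp_assoc, T.eta_naturality,
        MonoidalCategory.whiskerLeft_comp_assoc, h, Category.assoc])
  refine ⟨z, fun N => ?_⟩
  let σN : M.A ⊗ N.A ⟶ N.A ⊗ M.A := (σ.β N).hom.f
  have h : M.A ◁ N.a ≫ σN = ξ N.A ≫ N.a ▷ M.A := nat (Bimonad.actHom N)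
  change Z.cross M.A N ≫ N.A ◁ z = σN
  rw [cross, Category.assoc, ← whisker_exchange, reassoc_of% hz, ← h,
    ← MonoidalCategory.whiskerLeft_comp_assoc, Bimonad.eta_act, MonoidalCategory.whiskerLeft_id,
    Category.id_comp]

/-- The morphism `Z(M) ⟶ M` which gives a half braiding is a `T`-linear action: each law is tested on
the detecting morphisms `Z.cross`, where it becomes a property of the half braiding. -/
lemma isLiftAction_of_halfBraiding {M : T.Mod} (σ : HalfBraiding M) {z : Z.Z.obj M.A ⟶ M.A}
    (hz : ∀ N : T.Mod, Z.cross M.A N ≫ N.A ◁ z = (σ.β N).hom.f) : S.IsLiftAction M z where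
  unit := by
    have h : Z.cross M.A T.oneMod ≫ (𝟙_ C) ◁ z = (ρ_ M.A).hom ≫ (λ_ M.A).inv :=
      (hz (𝟙_ T.Mod)).trans (congrArg Monad.Algebra.Hom.f σ.unit_eq)
    rw [S.u_eq_cross, Category.assoc, Category.assoc, ← leftUnitor_naturality, reassoc_of% h]
    simp
  assoc := by
    refine ((Z.isDetecting_cross M.A).comp (Z.isDetecting_cross (Z.Z.obj M.A))) _ _ ?_
    rintro ⟨N₁, N₂⟩
    have h : Z.cross M.A (Bimonad.prodMod N₁ N₂) ≫ (N₁.A ⊗ N₂.A) ◁ z =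
        (α_ M.A N₁.A N₂.A).inv ≫ (Z.cross M.A N₁ ≫ N₁.A ◁ z) ▷ N₂.A ≫ (α_ N₁.A M.A N₂.A).hom ≫
        N₁.A ◁ (Z.cross M.A N₂ ≫ N₂.A ◁ z) ≫ (α_ N₁.A N₂.A M.A).inv := by
      rw [hz N₁, hz N₂]
      exact (hz (N₁ ⊗ N₂)).trans (congrArg Monad.Algebra.Hom.f (σ.monoidal N₁ N₂))
    dsimp only
    calc _ = (Z.cross M.A N₁ ▷ N₂.A ⊗≫ N₁.A ◁ Z.cross (Z.Z.obj M.A) N₂ ≫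
          N₁.A ◁ N₂.A ◁ S.m M.A) ≫ (α_ N₁.A N₂.A (Z.Z.obj M.A)).inv ≫ (N₁.A ⊗ N₂.A) ◁ z := by
          monoidal
      _ = (α_ M.A N₁.A N₂.A).hom ≫ Z.cross M.A (Bimonad.prodMod N₁ N₂) ≫
          (N₁.A ⊗ N₂.A) ◁ z := by rw [S.cross_mul]; simp
      _ = Z.cross M.A N₁ ▷ N₂.A ⊗≫ N₁.A ◁ (z ▷ N₂.A ≫ Z.cross M.A N₂) ≫ N₁.A ◁ N₂.A ◁ z ≫
          (α_ N₁.A N₂.A M.A).inv := by rw [h]; monoidal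
      _ = _ := by rw [cross_naturality_left]; monoidal
  linear := Z.liftMod_linear z (fun N => (σ.β N).hom) hz

/-! ### Modules over the double -/

section Double

variable {hS : S.IsBimonad}
  {hΩ : IsComonoidalDistributiveLaw T.toBimonad (S.bimonad hS) Z.law}

/-- The action of `Z` on the module underlying a module over the double. -/
noncomputable def doubleZ (M : (double T Z S hS Z.law hΩ).Mod) : Z.Z.obj M.A ⟶ M.A :=
  Z.Z.map (T.eta M.A) ≫ doubleAct T Z S hS Z.law hΩ M

/-- Associativity of a module over the double, in terms of the lift of `Z`. -/
lemma doubleAct_assoc' (M : (double T Z S hS Z.law hΩ).Mod) :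
    Z.Z.map (Z.liftAct (T.freeMod M.A)) ≫ S.m (T.obj M.A) ≫ doubleAct T Z S hS Z.law hΩ M =
      Z.Z.map (T.map (doubleAct T Z S hS Z.law hΩ M)) ≫ doubleAct T Z S hS Z.law hΩ M := by
  have h : Z.Z.map (Z.lawApp (T.obj M.A)) ≫ Z.Z.map (Z.Z.map (T.mu M.A)) ≫
      S.m (T.obj M.A) ≫ doubleAct T Z S hS Z.law hΩ M = _ := doubleAct_assoc T Z S hS Z.law hΩ M
  rw [← h, ← Z.Z.map_comp_assoc, lawApp_mu]

lemma u_doubleAct_linear (M : (double T Z S hS Z.law hΩ).Mod) :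
    T.map (doubleAct T Z S hS Z.law hΩ M) ≫ S.u (T.obj M.A) ≫ doubleAct T Z S hS Z.law hΩ M =
      Z.liftAct (T.freeMod M.A) ≫ doubleAct T Z S hS Z.law hΩ M := by
  rw [reassoc_of% S.u_naturality, ← doubleAct_assoc', ← reassoc_of% S.u_naturality,
    reassoc_of% S.left_unit]

/-- The action of the double is the action of `Z` after `Z` of the action of `T`. -/
lemma map_act_doubleZ (M : (double T Z S hS Z.law hΩ).Mod) :
    Z.Z.map (doubleRestrict T Z S hS Z.law hΩ M).a ≫ doubleZ M =
      doubleAct T Z S hS Z.law hΩ M := by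
  have h := liftAct_unit (Z := Z) (T.freeMod M.A)
  change Z.Z.map (S.u (T.obj M.A) ≫ doubleAct T Z S hS Z.law hΩ M) ≫
    Z.Z.map (T.eta M.A) ≫ doubleAct T Z S hS Z.law hΩ M = _
  rw [← Z.Z.map_comp_assoc, Category.assoc, T.eta_naturality, Z.Z.map_comp, Z.Z.map_comp,
    Category.assoc, Category.assoc, ← doubleAct_assoc', ← Z.Z.map_comp_assoc (T.eta _), h,
    Z.Z.map_id, Category.id_comp, reassoc_of% S.right_unit]

/-- A module over the double is a `T`-module with an action of the lift of `Z`. -/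
theorem isLiftAction_doubleZ (M : (double T Z S hS Z.law hΩ).Mod) :
    S.IsLiftAction (doubleRestrict T Z S hS Z.law hΩ M) (doubleZ M) where
  unit := by
    change S.u M.A ≫ Z.Z.map (T.eta M.A) ≫ doubleAct T Z S hS Z.law hΩ M = 𝟙 M.A
    rw [← reassoc_of% S.u_naturality]
    exact doubleAct_unit T Z S hS Z.law hΩ M
  assoc := by
    have h := liftAct_unit (Z := Z) (T.freeMod M.A)
    change S.m M.A ≫ doubleZ M = Z.Z.map (doubleZ M) ≫ doubleZ M
    rw [doubleZ, ← reassoc_of% S.m_naturality, Z.Z.map_comp, Category.assoc,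
      ← Z.Z.map_comp_assoc _ (T.eta _), T.eta_naturality, Z.Z.map_comp, Category.assoc, ← doubleAct_assoc',
      ← Z.Z.map_comp_assoc (T.eta _), h, Z.Z.map_id, Category.id_comp]
  linear := by
    have h₁ := map_act_doubleZ M
    have h₂ : Z.lawApp M.A ≫ Z.Z.map (doubleRestrict T Z S hS Z.law hΩ M).a =
      Z.liftAct (doubleRestrict T Z S hS Z.law hΩ M) :=
      Z.lawApp_act (doubleRestrict T Z S hS Z.law hΩ M)
    change T.map (doubleZ M) ≫ S.u (T.obj M.A) ≫ doubleAct T Z S hS Z.law hΩ M = _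
    calc _ = Z.lawApp M.A ≫ doubleAct T Z S hS Z.law hΩ M := by
          rw [doubleZ, T.map_comp_assoc, u_doubleAct_linear, lawApp, Category.assoc]
      _ = (Z.lawApp M.A ≫ Z.Z.map (doubleRestrict T Z S hS Z.law hΩ M).a) ≫ doubleZ M :=
          (congrArg (_ ≫ ·) h₁.symm).trans (Category.assoc _ _ _).symm
      _ = _ := congrArg (· ≫ doubleZ M) h₂

/-- The module over the double which a module with an action of the lift of `Z` defines. -/
noncomputable def doubleMod (hS : S.IsBimonad)
    (hΩ : IsComonoidalDistributiveLaw T.toBimonad (S.bimonad hS) Z.law)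
    {M : T.Mod} {z : Z.Z.obj M.A ⟶ M.A} (hz : S.IsLiftAction M z) :
    (double T Z S hS Z.law hΩ).Mod where
  A := M.A
  a := Z.Z.map M.a ≫ z
  unit := by
    change (T.eta M.A ≫ S.u (T.obj M.A)) ≫ Z.Z.map M.a ≫ z = 𝟙 M.A
    rw [Category.assoc, ← reassoc_of% S.u_naturality, reassoc_of% Bimonad.eta_act, hz.unit]
  assoc := by
    have h : T.map (Z.Z.map M.a) ≫ Z.liftAct M = Z.liftAct (T.freeMod M.A) ≫ Z.Z.map M.a :=
      Z.map_linear (Bimonad.actHom M)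
    change (Z.Z.map (Z.lawApp (T.obj M.A)) ≫ Z.Z.map (Z.Z.map (T.mu M.A)) ≫ S.m (T.obj M.A)) ≫
      Z.Z.map M.a ≫ z = Z.Z.map (T.map (Z.Z.map M.a ≫ z)) ≫ Z.Z.map M.a ≫ z
    rw [Category.assoc, Category.assoc, ← reassoc_of% S.m_naturality, hz.assoc,
      ← Z.Z.map_comp_assoc, lawApp_mu, ← Z.Z.map_comp_assoc, ← h, ← Z.Z.map_comp_assoc, ← Z.Z.map_comp_assoc,
      Category.assoc, ← hz.linear, T.map_comp, Category.assoc]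

end Double

end Centralizer

/-! ### Equality of objects of the center -/

section Center

variable {C : Type u} [Category.{v} C] [MonoidalCategory C] {T : Bimonad C}

lemma HalfBraiding.ext_f {M : T.Mod} {σ σ' : HalfBraiding M}
    (h : ∀ N, (σ.β N).hom.f = (σ'.β N).hom.f) : σ = σ' := by
  have h' : σ.β = σ'.β := by
    funext N
    exact Iso.ext (Monad.Algebra.Hom.ext' _ _ _ _ (h N))
  cases σ
  cases σ'
  cases h'
  rfl

/-- Two objects of the center with a common carrier in `C` are equal if their actions and the
carriers of their half braidings are. -/
lemma center_eq {A : C} {a a' : T.obj A ⟶ A} {h₁ h₂ h₁' h₂'}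
    {σ : HalfBraiding (C := T.Mod) { A := A, a := a, unit := h₁, assoc := h₂ }}
    {σ' : HalfBraiding (C := T.Mod) { A := A, a := a', unit := h₁', assoc := h₂' }}
    (ha : a = a') (hσ : ∀ N : T.Mod, ((σ.β N).hom.f : A ⊗ N.A ⟶ N.A ⊗ A) = (σ'.β N).hom.f) :
    (⟨_, σ⟩ : Center T.Mod) = ⟨_, σ'⟩ := by
  subst ha
  rw [HalfBraiding.ext_f (σ := σ) (σ' := σ') hσ]

omit [MonoidalCategory C] in
lemma mod_eq {T : Monad C} {A : C} {a a' : T.obj A ⟶ A} {h₁ h₂ h₁' h₂'} (ha : a = a') :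
    ({ A := A, a := a, unit := h₁, assoc := h₂ } : T.Algebra) =
      { A := A, a := a', unit := h₁', assoc := h₂' } := by
  subst ha
  rfl

lemma center_eqToHom_f_f {X Y : Center T.Mod} (h : X = Y) :
    (eqToHom h).f.f = eqToHom (congrArg (fun X : Center T.Mod => X.1.A) h) := by
  subst h
  rfl

omit [MonoidalCategory C] in
lemma mod_eqToHom_f {T : Monad C} {X Y : T.Algebra} (h : X = Y) :
    (eqToHom h).f = eqToHom (congrArg Monad.Algebra.A h) := by
  subst h
  rfl

lemma center_hom_ext {X Y : Center T.Mod} {f g : X ⟶ Y} (h : f.f.f = g.f.f) : f = g :=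
  Center.ext _ _ (Monad.Algebra.Hom.ext' _ _ _ _ h)

end Center

/-- Lax monoidal functors are equal if the underlying functors and the structural morphisms are. -/
lemma laxMonoidalFunctor_of_eq {C : Type*} [Category* C] [MonoidalCategory C] {D : Type*}
    [Category* D] [MonoidalCategory D] {F G : C ⥤ D} [hF : F.LaxMonoidal] [hG : G.LaxMonoidal]
    (h : F = G) (hε : HEq (ε F) (ε G)) (hμ : ∀ X Y, HEq (μ F X Y) (μ G X Y)) :
    LaxMonoidalFunctor.of F = LaxMonoidalFunctor.of G := by
  subst h
  have hε' := eq_of_heq hε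
  have hμ' : @μ _ _ _ _ _ _ F hF = @μ _ _ _ _ _ _ F hG := by
    funext X Y
    exact eq_of_heq (hμ X Y)
  have h : hF = hG := by
    cases hF
    cases hG
    cases hε'
    cases hμ'
    rfl
  subst h
  rfl

namespace Centralizer

variable {C : Type u} [Category.{v} C] [MonoidalCategory C] [RigidCategory C]
  {T : HopfMonad C} {Z : Centralizer T.toFunctor} {S : Z.Structure} {hS : S.IsBimonad}
  {hΩ : IsComonoidalDistributiveLaw T.toBimonad (S.bimonad hS) Z.law}

/-! ### The functor to the center -/

local notation "DMod" => Bimonad.Mod (double T Z S hS Z.law hΩ)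

lemma restrict_tensor (M N : DMod) :
    (doubleRestrict T Z S hS Z.law hΩ (M ⊗ N)).a =
      δ T.toFunctor M.A N.A ≫ ((doubleRestrict T Z S hS Z.law hΩ M).a ⊗ₘ
        (doubleRestrict T Z S hS Z.law hΩ N).a) := by
  let r := doubleAct T Z S hS Z.law hΩ M
  let s := doubleAct T Z S hS Z.law hΩ N
  change S.u (T.obj (M.A ⊗ N.A)) ≫ (Z.Z.map (δ T.toFunctor M.A N.A) ≫
    S.comul (T.obj M.A) (T.obj N.A)) ≫ (r ⊗ₘ s) =
      δ T.toFunctor M.A N.A ≫ ((S.u (T.obj M.A) ≫ r) ⊗ₘ (S.u (T.obj N.A) ≫ s))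
  rw [Category.assoc, ← reassoc_of% S.u_naturality, ← Category.assoc (S.u _), S.unit_comul,
    tensorHom_comp_tensorHom]

lemma restrict_unit :
    (doubleRestrict T Z S hS Z.law hΩ (𝟙_ DMod)).a = η T.toFunctor := by
  change S.u (T.obj (𝟙_ C)) ≫ Z.Z.map (η T.toFunctor) ≫ S.counit = η T.toFunctor
  rw [← reassoc_of% S.u_naturality, S.unit_counit, Category.comp_id]

lemma doubleZ_tensor (M N : DMod) :
    doubleZ (M ⊗ N) = S.comul M.A N.A ≫ (doubleZ M ⊗ₘ doubleZ N) := by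
  let r := doubleAct T Z S hS Z.law hΩ M
  let s := doubleAct T Z S hS Z.law hΩ N
  change Z.Z.map (T.eta (M.A ⊗ N.A)) ≫ (Z.Z.map (δ T.toFunctor M.A N.A) ≫
    S.comul (T.obj M.A) (T.obj N.A)) ≫ (r ⊗ₘ s) =
      S.comul M.A N.A ≫ ((Z.Z.map (T.eta M.A) ≫ r) ⊗ₘ (Z.Z.map (T.eta N.A) ≫ s))
  rw [Category.assoc, ← Z.Z.map_comp_assoc, T.eta_comul, ← Category.assoc (Z.Z.map _),
    S.comul_naturality, Category.assoc, tensorHom_comp_tensorHom]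

lemma doubleZ_unit : doubleZ (𝟙_ DMod) = S.counit := by
  change Z.Z.map (T.eta (𝟙_ C)) ≫ Z.Z.map (η T.toFunctor) ≫ S.counit = S.counit
  rw [← Z.Z.map_comp_assoc, T.eta_counit, Z.Z.map_id, Category.id_comp]

lemma doubleBraiding_eq (M : DMod) (N : T.Mod) :
    doubleBraiding T Z S hS Z.law hΩ M N = Z.cross M.A N ≫ N.A ◁ doubleZ M := by
  rw [cross, Category.assoc, ← MonoidalCategory.tensorHom_def]
  rfl

lemma doubleBraiding_tensor (M M' : DMod) (N : T.Mod) :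
    doubleBraiding T Z S hS Z.law hΩ (M ⊗ M') N =
      (α_ M.A M'.A N.A).hom ≫ M.A ◁ doubleBraiding T Z S hS Z.law hΩ M' N ≫
        (α_ M.A N.A M'.A).inv ≫ doubleBraiding T Z S hS Z.law hΩ M N ▷ M'.A ≫
          (α_ N.A M.A M'.A).hom := by
  rw [doubleBraiding_eq, doubleBraiding_eq, doubleBraiding_eq, doubleZ_tensor]
  change Z.cross (M.A ⊗ M'.A) N ≫ N.A ◁ (S.comul M.A M'.A ≫ (doubleZ M ⊗ₘ doubleZ M')) = _
  calc _ = (Z.cross (M.A ⊗ M'.A) N ≫ N.A ◁ S.comul M.A M'.A) ≫ N.A ◁ (doubleZ M ⊗ₘ doubleZ M') := by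
        simp
    _ = 𝟙 _ ⊗≫ M.A ◁ Z.cross M'.A N ⊗≫ (Z.cross M.A N ▷ Z.Z.obj M'.A ≫
          (N.A ⊗ Z.Z.obj M.A) ◁ doubleZ M') ⊗≫ N.A ◁ doubleZ M ▷ M'.A := by
        rw [S.cross_comul, tensorHom_def']; monoidal
    _ = _ := by rw [← whisker_exchange]; monoidal

lemma doubleBraiding_unit (N : T.Mod) :
    doubleBraiding T Z S hS Z.law hΩ (𝟙_ DMod) N = (λ_ N.A).hom ≫ (ρ_ N.A).inv := by
  rw [doubleBraiding_eq, doubleZ_unit]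
  exact S.cross_counit N

/-- The half braiding on the `T`-module underlying a module over the double. -/
noncomputable def doubleHalfBraiding (M : DMod) :
    HalfBraiding (doubleRestrict T Z S hS Z.law hΩ M) :=
  (isLiftAction_doubleZ M).halfBraiding

lemma doubleHalfBraiding_hom (M : DMod) (N : T.Mod) :
    ((doubleHalfBraiding M).β N).hom.f = doubleBraiding T Z S hS Z.law hΩ M N :=
  ((isLiftAction_doubleZ M).halfBraiding_hom N).trans (doubleBraiding_eq M N).symm

variable (T Z S hS hΩ) in
/-- The functor from modules over the double to the center. -/
noncomputable abbrev toCenter : DMod ⥤ Center T.Mod :=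
  doubleFunctor T Z S hS Z.law hΩ doubleHalfBraiding doubleHalfBraiding_hom

lemma toCenter_tensor (M N : DMod) :
    (toCenter T Z S hS hΩ).obj M ⊗ (toCenter T Z S hS hΩ).obj N =
      (toCenter T Z S hS hΩ).obj (M ⊗ N) := by
  refine center_eq (A := M.A ⊗ N.A) (restrict_tensor M N).symm fun K => ?_
  refine Eq.trans ?_ ((doubleHalfBraiding_hom (M ⊗ N) K).trans (doubleBraiding_tensor M N K)).symm
  rw [← doubleHalfBraiding_hom, ← doubleHalfBraiding_hom]
  rfl

lemma toCenter_unit :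
    𝟙_ (Center T.Mod) = (toCenter T Z S hS hΩ).obj (𝟙_ DMod) := by
  refine center_eq (A := 𝟙_ C) restrict_unit.symm fun K => ?_
  refine Eq.trans ?_ ((doubleHalfBraiding_hom (𝟙_ DMod) K).trans (doubleBraiding_unit K)).symm
  rfl

lemma eqToHom_toCenter_tensor (M N : DMod) :
    ((eqToHom (toCenter_tensor M N)).f.f : M.A ⊗ N.A ⟶ M.A ⊗ N.A) = 𝟙 (M.A ⊗ N.A) :=
  center_eqToHom_f_f _

lemma eqToHom_toCenter_unit :
    ((eqToHom (toCenter_unit (hΩ := hΩ))).f.f : 𝟙_ C ⟶ 𝟙_ C) = 𝟙 (𝟙_ C) :=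
  center_eqToHom_f_f _

/-- The functor to the center is strict monoidal. -/
noncomputable def toCenterCoreMonoidal : (toCenter T Z S hS hΩ).CoreMonoidal where
  εIso := eqToIso toCenter_unit
  μIso M N := eqToIso (toCenter_tensor M N)
  -- The structural morphisms are carried by endomorphisms `e` of objects of `C` which equal `𝟙`, but
  -- not by definition; each axiom is proved for variables `e` and applied by unification.
  μIso_hom_natural_left {M M'} f N := by
    apply center_hom_ext
    have h (φ : M.A ⟶ M'.A) (e : M.A ⊗ N.A ⟶ M.A ⊗ N.A) (he : e = 𝟙 _)
        (e' : M'.A ⊗ N.A ⟶ M'.A ⊗ N.A) (he' : e' = 𝟙 _) : φ ▷ N.A ≫ e' = e ≫ φ ▷ N.A := by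
      simp [he, he']
    exact h f.f _ (eqToHom_toCenter_tensor M N) _ (eqToHom_toCenter_tensor M' N)
  μIso_hom_natural_right {N N'} M f := by
    apply center_hom_ext
    have h (φ : N.A ⟶ N'.A) (e : M.A ⊗ N.A ⟶ M.A ⊗ N.A) (he : e = 𝟙 _)
        (e' : M.A ⊗ N'.A ⟶ M.A ⊗ N'.A) (he' : e' = 𝟙 _) : M.A ◁ φ ≫ e' = e ≫ M.A ◁ φ := by
      simp [he, he']
    exact h f.f _ (eqToHom_toCenter_tensor M N) _ (eqToHom_toCenter_tensor M N')
  associativity M N K := by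
    apply center_hom_ext
    have h (e₁ : M.A ⊗ N.A ⟶ M.A ⊗ N.A) (he₁ : e₁ = 𝟙 _)
        (e₂ : (M.A ⊗ N.A) ⊗ K.A ⟶ (M.A ⊗ N.A) ⊗ K.A) (he₂ : e₂ = 𝟙 _)
        (e₃ : N.A ⊗ K.A ⟶ N.A ⊗ K.A) (he₃ : e₃ = 𝟙 _)
        (e₄ : M.A ⊗ N.A ⊗ K.A ⟶ M.A ⊗ N.A ⊗ K.A) (he₄ : e₄ = 𝟙 _) :
        e₁ ▷ K.A ≫ e₂ ≫ (α_ M.A N.A K.A).hom = (α_ M.A N.A K.A).hom ≫ M.A ◁ e₃ ≫ e₄ := by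
      simp [he₁, he₂, he₃, he₄]
    exact h _ (eqToHom_toCenter_tensor M N) _ (eqToHom_toCenter_tensor (M ⊗ N) K)
      _ (eqToHom_toCenter_tensor N K) _ (eqToHom_toCenter_tensor M (N ⊗ K))
  left_unitality M := by
    apply center_hom_ext
    have h (e : 𝟙_ C ⟶ 𝟙_ C) (he : e = 𝟙 _) (e' : 𝟙_ C ⊗ M.A ⟶ 𝟙_ C ⊗ M.A) (he' : e' = 𝟙 _) :
        (λ_ M.A).hom = e ▷ M.A ≫ e' ≫ (λ_ M.A).hom := by
      simp [he, he']
    exact h _ (eqToHom_toCenter_unit (hΩ := hΩ)) _ (eqToHom_toCenter_tensor (𝟙_ DMod) M)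
  right_unitality M := by
    apply center_hom_ext
    have h (e : 𝟙_ C ⟶ 𝟙_ C) (he : e = 𝟙 _) (e' : M.A ⊗ 𝟙_ C ⟶ M.A ⊗ 𝟙_ C) (he' : e' = 𝟙 _) :
        (ρ_ M.A).hom = M.A ◁ e ≫ e' ≫ (ρ_ M.A).hom := by
      simp [he, he']
    exact h _ (eqToHom_toCenter_unit (hΩ := hΩ)) _ (eqToHom_toCenter_tensor M (𝟙_ DMod))

noncomputable instance toCenterMonoidal : (toCenter T Z S hS hΩ).Monoidal :=
  toCenterCoreMonoidal.toMonoidal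

lemma μ_toCenter (M N : DMod) : μ (toCenter T Z S hS hΩ) M N = eqToHom (toCenter_tensor M N) := rfl

lemma ε_toCenter : ε (toCenter T Z S hS hΩ) = eqToHom toCenter_unit := rfl

/-! ### The inverse functor and the braiding -/

lemma doubleMod_hom {M N : T.Mod} {z : Z.Z.obj M.A ⟶ M.A} {w : Z.Z.obj N.A ⟶ N.A}
    (f : M ⟶ N) (hf : Z.Z.map f.f ≫ w = z ≫ f.f) :
    Z.Z.map (T.map f.f) ≫ Z.Z.map N.a ≫ w = (Z.Z.map M.a ≫ z) ≫ f.f := by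
  rw [← Z.Z.map_comp_assoc, f.h, Z.Z.map_comp_assoc, hf, Category.assoc]

/-- The action of `Z` on an object of the center. -/
noncomputable def centerZ (X : Center T.Mod) : Z.Z.obj X.1.A ⟶ X.1.A :=
  (exists_halfBraiding_eq X.2).choose

lemma cross_centerZ (X : Center T.Mod) (N : T.Mod) :
    Z.cross X.1.A N ≫ N.A ◁ centerZ X = (X.2.β N).hom.f :=
  (exists_halfBraiding_eq X.2).choose_spec N

lemma isLiftAction_centerZ (X : Center T.Mod) : S.IsLiftAction X.1 (centerZ X) :=
  isLiftAction_of_halfBraiding X.2 (cross_centerZ X)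

lemma centerZ_hom {X Y : Center T.Mod} (f : X ⟶ Y) :
    Z.Z.map f.f.f ≫ centerZ Y = centerZ X ≫ f.f.f := by
  refine Z.isDetecting_cross _ _ _ fun N => ?_
  have h : f.f.f ▷ N.A ≫ (Y.2.β N).hom.f = (X.2.β N).hom.f ≫ N.A ◁ f.f.f :=
    congrArg Monad.Algebra.Hom.f (f.comm N)
  let σX : X.1.A ⊗ N.A ⟶ N.A ⊗ X.1.A := (X.2.β N).hom.f
  let σY : Y.1.A ⊗ N.A ⟶ N.A ⊗ Y.1.A := (Y.2.β N).hom.f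
  have hX : Z.cross X.1.A N ≫ N.A ◁ centerZ X = σX := cross_centerZ X N
  have hY : Z.cross Y.1.A N ≫ N.A ◁ centerZ Y = σY := cross_centerZ Y N
  have h' : f.f.f ▷ N.A ≫ σY = σX ≫ N.A ◁ f.f.f := h
  rw [MonoidalCategory.whiskerLeft_comp, ← reassoc_of% cross_naturality_left, hY, h', ← hX,
    MonoidalCategory.whiskerLeft_comp, Category.assoc]

variable (T Z S hS hΩ) in
/-- The functor from the center to modules over the double. -/
noncomputable def ofCenter : Center T.Mod ⥤ DMod where
  obj X := doubleMod hS hΩ (isLiftAction_centerZ X)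
  map f :=
    { f := f.f.f
      h := doubleMod_hom f.f (centerZ_hom f) }
  map_id _ := rfl
  map_comp _ _ := rfl

lemma centerZ_toCenter (M : DMod) : centerZ ((toCenter T Z S hS hΩ).obj M) = doubleZ M := by
  refine Z.isDetecting_cross M.A _ _ fun N => ?_
  exact ((cross_centerZ ((toCenter T Z S hS hΩ).obj M) N).trans
    (doubleHalfBraiding_hom M N)).trans (doubleBraiding_eq M N)

lemma toCenter_ofCenter_obj (M : DMod) :
    (ofCenter T Z S hS hΩ).obj ((toCenter T Z S hS hΩ).obj M) = M := by
  refine mod_eq ?_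
  refine Eq.trans ?_ (map_act_doubleZ M)
  exact congrArg (Z.Z.map (doubleRestrict T Z S hS Z.law hΩ M).a ≫ ·) (centerZ_toCenter M)

lemma doubleZ_doubleMod {M : T.Mod} {z : Z.Z.obj M.A ⟶ M.A} (hz : S.IsLiftAction M z) :
    doubleZ (doubleMod hS hΩ hz) = z := by
  change Z.Z.map (T.eta M.A) ≫ Z.Z.map M.a ≫ z = z
  rw [← Z.Z.map_comp_assoc, Bimonad.eta_act, Z.Z.map_id, Category.id_comp]

lemma restrict_doubleMod {M : T.Mod} {z : Z.Z.obj M.A ⟶ M.A} (hz : S.IsLiftAction M z) :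
    (doubleRestrict T Z S hS Z.law hΩ (doubleMod hS hΩ hz)).a = M.a := by
  change S.u (T.obj M.A) ≫ Z.Z.map M.a ≫ z = M.a
  rw [← reassoc_of% S.u_naturality, hz.unit, Category.comp_id]

lemma ofCenter_toCenter_obj (X : Center T.Mod) :
    (toCenter T Z S hS hΩ).obj ((ofCenter T Z S hS hΩ).obj X) = X := by
  obtain ⟨M, σ⟩ := X
  refine center_eq (A := M.A) (restrict_doubleMod (isLiftAction_centerZ ⟨M, σ⟩)) fun N => ?_
  refine (doubleHalfBraiding_hom _ N).trans ((doubleBraiding_eq _ N).trans ?_)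
  refine Eq.trans ?_ (cross_centerZ (Z := Z) ⟨M, σ⟩ N)
  exact congrArg (fun z => Z.cross M.A N ≫ N.A ◁ z)
    (doubleZ_doubleMod (hΩ := hΩ) (isLiftAction_centerZ ⟨M, σ⟩))

/-- A module over the double is determined by the half braiding on its underlying `T`-module. -/
theorem toCenter_comp_ofCenter : toCenter T Z S hS hΩ ⋙ ofCenter T Z S hS hΩ = 𝟭 _ := by
  refine CategoryTheory.Functor.ext toCenter_ofCenter_obj fun M N f => ?_
  apply Monad.Algebra.Hom.ext'
  have h (e : M.A ⟶ M.A) (he : e = 𝟙 _) (e' : N.A ⟶ N.A) (he' : e' = 𝟙 _) (φ : M.A ⟶ N.A) :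
      φ = e ≫ φ ≫ e' := by simp [he, he']
  exact h _ (mod_eqToHom_f (toCenter_ofCenter_obj M)) _
    (mod_eqToHom_f (toCenter_ofCenter_obj N).symm) f.f

/-- Every half braiding on a `T`-module comes from a module over the double. -/
theorem ofCenter_comp_toCenter : ofCenter T Z S hS hΩ ⋙ toCenter T Z S hS hΩ = 𝟭 _ := by
  refine CategoryTheory.Functor.ext ofCenter_toCenter_obj fun X Y f => ?_
  apply center_hom_ext
  have h (e : X.1.A ⟶ X.1.A) (he : e = 𝟙 _) (e' : Y.1.A ⟶ Y.1.A) (he' : e' = 𝟙 _)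
      (φ : X.1.A ⟶ Y.1.A) : φ = e ≫ φ ≫ e' := by simp [he, he']
  exact h _ (center_eqToHom_f_f (ofCenter_toCenter_obj (hΩ := hΩ) X)) _
    (center_eqToHom_f_f (ofCenter_toCenter_obj (hΩ := hΩ) Y).symm) f.f.f

instance faithful_toCenter : (toCenter T Z S hS hΩ).Faithful where
  map_injective {M N f g} h := by
    apply Monad.Algebra.Hom.ext'
    exact congrArg (fun k : (toCenter T Z S hS hΩ).obj M ⟶ (toCenter T Z S hS hΩ).obj N => k.f.f) h

/-- A morphism of the center is linear for the actions of `Z` which the half braidings determine,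
hence for the double. -/
instance full_toCenter : (toCenter T Z S hS hΩ).Full where
  map_surjective {M N} f := by
    refine ⟨{ f := f.f.f, h := ?_ }, rfl⟩
    have h₁ := centerZ_hom (Z := Z) f
    have h₂ := doubleMod_hom f.f h₁
    have h₃ := centerZ_toCenter M
    have h₄ := centerZ_toCenter N
    have h₅ := map_act_doubleZ M
    have h₆ := map_act_doubleZ N
    rw [h₃, h₄] at h₂
    change Z.Z.map (T.map f.f.f) ≫ doubleAct T Z S hS Z.law hΩ N =
      doubleAct T Z S hS Z.law hΩ M ≫ f.f.f
    rw [← h₅, ← h₆]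
    exact h₂

/-- The braiding of modules over the double, transported from the center. -/
noncomputable instance braidedDouble : BraidedCategory DMod :=
  BraidedCategory.ofFullyFaithful (toCenter T Z S hS hΩ)

noncomputable instance toCenterBraided : (toCenter T Z S hS hΩ).Braided where
  braided M N := by
    change _ ≫ (toCenter T Z S hS hΩ).map ((toCenter T Z S hS hΩ).preimage _) = _
    rw [Functor.map_preimage]
    simp [Functor.Monoidal.μIso]

lemma braiding_eq (M N : DMod) : (β_ M N).hom.f =
    doubleBraiding T Z S hS Z.law hΩ M (doubleRestrict T Z S hS Z.law hΩ N) := by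
  have h₀ := (toCenterBraided (hΩ := hΩ)).braided M N
  rw [μ_toCenter, μ_toCenter] at h₀
  have h₁ : (toCenter T Z S hS hΩ).map (β_ M N).hom = eqToHom (toCenter_tensor M N).symm ≫
      (β_ ((toCenter T Z S hS hΩ).obj M) ((toCenter T Z S hS hΩ).obj N)).hom ≫
        eqToHom (toCenter_tensor N M) := by
    rw [← h₀, eqToHom_trans_assoc, eqToHom_refl, Category.id_comp]
  have h₂ := congrArg (fun k : (toCenter T Z S hS hΩ).obj (M ⊗ N) ⟶
    (toCenter T Z S hS hΩ).obj (N ⊗ M) => k.f.f) h₁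
  have h (e : M.A ⊗ N.A ⟶ M.A ⊗ N.A) (he : e = 𝟙 _) (e' : N.A ⊗ M.A ⟶ N.A ⊗ M.A) (he' : e' = 𝟙 _)
      (φ : M.A ⊗ N.A ⟶ N.A ⊗ M.A) : e ≫ φ ≫ e' = φ := by simp [he, he']
  refine Eq.trans h₂ (Eq.trans ?_
    (doubleHalfBraiding_hom M (doubleRestrict T Z S hS Z.law hΩ N)))
  exact h _ (center_eqToHom_f_f (toCenter_tensor M N).symm) _ (eqToHom_toCenter_tensor N M) _

lemma braiding_eq_doubleR (M N : DMod) :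
    (β_ M N).hom.f = doubleR T Z S hS Z.law hΩ M.A N.A ≫ (N.a ⊗ₘ M.a) := by
  rw [braiding_eq]
  let r := doubleAct T Z S hS Z.law hΩ M
  let s := doubleAct T Z S hS Z.law hΩ N
  change Z.del M.A N.A ≫ ((S.u (T.obj N.A) ≫ s) ⊗ₘ (Z.Z.map (T.eta M.A) ≫ r)) =
    (Z.del M.A N.A ≫ (S.u (T.obj N.A) ⊗ₘ Z.Z.map (T.eta M.A))) ≫ (s ⊗ₘ r)
  rw [Category.assoc, tensorHom_comp_tensorHom]

theorem isStrictMonoidal_toCenter : IsStrictMonoidal (toCenter T Z S hS hΩ) where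
  obj_tensor := toCenter_tensor
  obj_unit := toCenter_unit
  μ_eq := μ_toCenter
  ε_eq := ε_toCenter

/-- The composites with the forgetful functors agree as functors on the nose, and the structural
morphisms of both are carried by identities of `C`. -/
theorem toCenter_forget :
    LaxMonoidalFunctor.of (toCenter T Z S hS hΩ ⋙ (Center.forget T.Mod ⋙ T.toMonad.forget)) =
      LaxMonoidalFunctor.of (double T Z S hS Z.law hΩ).toMonad.forget := by
  refine laxMonoidalFunctor_of_eq rfl (heq_of_eq ?_) fun M N => heq_of_eq ?_
  · have h (e₁ e₂ e₃ : 𝟙_ C ⟶ 𝟙_ C) (he₁ : e₁ = 𝟙 _) (he₂ : e₂ = 𝟙 _) (he₃ : e₃ = 𝟙 _) :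
        (e₁ ≫ e₂) ≫ e₃ = 𝟙 _ := by simp [he₁, he₂, he₃]
    exact h _ _ _ rfl rfl (eqToHom_toCenter_unit (hΩ := hΩ))
  · have h (e₁ e₂ e₃ : M.A ⊗ N.A ⟶ M.A ⊗ N.A) (he₁ : e₁ = 𝟙 _) (he₂ : e₂ = 𝟙 _)
        (he₃ : e₃ = 𝟙 _) : (e₁ ≫ e₂) ≫ e₃ = 𝟙 _ := by simp [he₁, he₂, he₃]
    exact h _ _ _ rfl rfl (eqToHom_toCenter_tensor M N)

end Centralizer

theorem mainTheorem1 {C : Type u} [Category.{v} C] [MonoidalCategory C] [RigidCategory C]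
    (T : HopfMonad C) (Z : Centralizer T.toFunctor) :
    -- the structural morphisms of `Z` are well defined by their defining relations,
    -- and they make it a bimonad
    ∃ S : Z.Structure, (∀ S' : Z.Structure, S' = S) ∧ ∃ hS : S.IsBimonad,
    -- the canonical distributive law is well defined by its defining relation,
    -- and it is a comonoidal distributive law
    ∃ Ω : Z.Z ⋙ T.toFunctor ⟶ T.toFunctor ⋙ Z.Z,
      (IsCanonicalLaw T Z Ω ∧ ∀ Ω', IsCanonicalLaw T Z Ω' → Ω' = Ω) ∧
    ∃ hΩ : IsComonoidalDistributiveLaw T.toBimonad (S.bimonad hS) Ω,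
    -- the R-matrix `R` of `D_T` defines a braiding of `D_T-C`, namely `τ = (s ⊗ r) R`
    ∃ _ : BraidedCategory (double T Z S hS Ω hΩ).Mod,
      (∀ M N : (double T Z S hS Ω hΩ).Mod,
        (β_ M N).hom.f = doubleR T Z S hS Ω hΩ M.A N.A ≫ (N.a ⊗ₘ M.a)) ∧
    -- the half braidings `σ` are well defined, so that the functor `I` is
    ∃ (σ : ∀ M : (double T Z S hS Ω hΩ).Mod, HalfBraiding (doubleRestrict T Z S hS Ω hΩ M))
      (hσ : ∀ M N, ((σ M).β N).hom.f = doubleBraiding T Z S hS Ω hΩ M N),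
    -- `I` is a braided functor, strict monoidal, and an isomorphism of categories
    ∃ _ : (doubleFunctor T Z S hS Ω hΩ σ hσ).Braided,
      IsStrictMonoidal (doubleFunctor T Z S hS Ω hΩ σ hσ) ∧
      (∃ J : Center T.Mod ⥤ (double T Z S hS Ω hΩ).Mod,
        doubleFunctor T Z S hS Ω hΩ σ hσ ⋙ J = 𝟭 _ ∧
        J ⋙ doubleFunctor T Z S hS Ω hΩ σ hσ = 𝟭 _) ∧
    -- `𝒰 I = U_{D_T}` as monoidal functors
      LaxMonoidalFunctor.of (doubleFunctor T Z S hS Ω hΩ σ hσ ⋙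
          (Center.forget T.Mod ⋙ T.toMonad.forget)) =
        LaxMonoidalFunctor.of (double T Z S hS Ω hΩ).toMonad.forget := by
  obtain ⟨S⟩ := Z.nonempty_structure
  refine ⟨S, fun S' => S'.eq S, S.isBimonad, Z.law, ⟨Centralizer.isCanonicalLaw_law,
    fun Ω' hΩ' => Centralizer.eq_law hΩ'⟩, Centralizer.isComonoidalDistributiveLaw_law S _,
    Centralizer.braidedDouble, Centralizer.braiding_eq_doubleR, Centralizer.doubleHalfBraiding,
    Centralizer.doubleHalfBraiding_hom, Centralizer.toCenterBraided,
    Centralizer.isStrictMonoidal_toCenter, ⟨Centralizer.ofCenter T Z S _ _,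
      Centralizer.toCenter_comp_ofCenter, Centralizer.ofCenter_comp_toCenter⟩,
    Centralizer.toCenter_forget⟩
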